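/- Let $\mathcal H$ be a complex separable Hilbert space. Write $\mathcal B(\mathcal H)$, $\mathcal B_1(\mathcal H)$ and $\mathcal B_2(\mathcal H)$ for the bounded, trace class and Hilbert–Schmidt operators on $\mathcal H$. For $T\in\mathcal B(\mathcal H)$ dissipative, that is, $\operatorname{Im}(T)=(T-T^*)/(2i)\ge 0$, let $L$ be the minimal self-adjoint dilation of $T$: a (possibly unbounded) self-adjoint operator in a Hilbert space $\mathcal K\supseteq\mathcal H$ such that $$P_{\mathcal H}(L-z)^{-1}|_{\mathcal H}=(T-z)^{-1}\quad\text{for all } z\in\mathbb C \text{ with } \operatorname{Im} z<0,$$ and such that $\mathcal K$ is the closed linear span of $\{(L-z)^{-1}x : z\in\mathbb C\setminus\mathbb R,\ x\in\mathcal H\}$, where $P_{\mathcal H}$ is the orthogonal projection in $\mathcal K$ onto $\mathcal H$. Such an $L$ exists and is unique up to unitary equivalence fixing $\mathcal H$. Define $$\Xi(T)=P_{\mathcal H}E_L((-\infty,0))|_{\mathcal H}\in\mathcal B(\mathcal H),$$ where $E_L$ is the spectral measure of $L$. (If $T=T^*$, then $\Xi(T)=E_T((-\infty,0))$.) Let $S\in\mathcal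 B(\mathcal H)$ be a signature operator, that is, $S=S^*=S^{-1}$, let $A=A^*\in\mathcal B_2(\mathcal H)$, and let $0\le B\in\mathcal B_1(\mathcal H)$. Then $$\Xi(S+A+iB)-\Xi(S)\in\mathcal B_1(\mathcal H)\quad\text{if and only if}\quad [A,S]=AS-SA\in\mathcal B_1(\mathcal H).$$ -/

import Mathlib

open MeasureTheory

open scoped InnerProductSpace ENNReal

universe u

/-- `T` is trace class: `tr |T| = ∑ ⟪e, |T| e⟫ < ∞` over an orthonormal basis, `|T| = (T* T)^(1/2)`.
Since `|T| ≥ 0`, the sum does not depend on the basis. -/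
def IsTraceClass {H : Type u} [NormedAddCommGroup H] [InnerProductSpace ℂ H] [CompleteSpace H]
    (T : H →L[ℂ] H) : Prop :=
  ∃ (w : Set H) (b : HilbertBasis w ℂ H), Summable fun i => (⟪b i, CFC.abs T (b i)⟫_ℂ).re

/-- `T` is Hilbert-Schmidt: `tr (T* T) = ∑ ‖T e‖ ^ 2 < ∞` over an orthonormal basis
(the sum does not depend on the basis). -/
def IsHilbertSchmidt {H : Type u} [NormedAddCommGroup H] [InnerProductSpace ℂ H] [CompleteSpace H]
    (T : H →L[ℂ] H) : Prop :=
  ∃ (w : Set H) (b : HilbertBasis w ℂ H), Summable fun i => ‖T (b i)‖ ^ 2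

/-- Projection-valued measures on the Borel sets of `ℝ` (values at non-Borel sets are irrelevant). -/
structure ProjectionValuedMeasure (K : Type u) [NormedAddCommGroup K] [InnerProductSpace ℂ K]
    [CompleteSpace K] where
  proj : Set ℝ → (K →L[ℂ] K)
  isStarProjection : ∀ s, MeasurableSet s → IsStarProjection (proj s)
  univ : proj Set.univ = 1
  inter : ∀ s t, MeasurableSet s → MeasurableSet t → proj (s ∩ t) = proj s * proj t
  hasSum_iUnion : ∀ f : ℕ → Set ℝ, (∀ n, MeasurableSet (f n)) →
    Pairwise (fun m n => Disjoint (f m) (f n)) →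
    ∀ x : K, HasSum (fun n => proj (f n) x) (proj (⋃ n, f n) x)

namespace ProjectionValuedMeasure

variable {K : Type u} [NormedAddCommGroup K] [InnerProductSpace ℂ K] [CompleteSpace K]

theorem proj_empty (E : ProjectionValuedMeasure K) : E.proj ∅ = 0 := by
  ext x
  have h := E.hasSum_iUnion (fun _ => ∅) (fun _ => MeasurableSet.empty)
    (fun _ _ _ => disjoint_bot_left) x
  have h1 := h.summable.tendsto_atTop_zero
  simpa using tendsto_nhds_unique tendsto_const_nhds h1

theorem inner_proj_self (E : ProjectionValuedMeasure K) {s : Set ℝ} (hs : MeasurableSet s) (x : K) :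
    (⟪x, E.proj s x⟫_ℂ).re = ‖E.proj s x‖ ^ 2 := by
  have hp := E.isStarProjection s hs
  have h1 : E.proj s (E.proj s x) = E.proj s x := by
    have := congrArg (fun T : K →L[ℂ] K => T x) hp.isIdempotentElem.eq
    simpa using this
  have h2 : ⟪E.proj s x, E.proj s x⟫_ℂ = ⟪x, E.proj s (E.proj s x)⟫_ℂ := by
    have h3 := ContinuousLinearMap.adjoint_inner_left (E.proj s) (E.proj s x) x
    rwa [hp.isSelfAdjoint.adjoint_eq] at h3
  rw [h1, inner_self_eq_norm_sq_to_K] at h2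
  rw [← h2]
  norm_cast

/-- The scalar spectral measure `s ↦ ‖E(s) x‖² = ⟪x, E(s) x⟫`. -/
noncomputable def diag (E : ProjectionValuedMeasure K) (x : K) : Measure ℝ :=
  Measure.ofMeasurable (fun s _ => ENNReal.ofReal (‖E.proj s x‖ ^ 2))
    (by simp [E.proj_empty])
    (by
      intro f hf hd
      have h := E.hasSum_iUnion f hf hd x
      have h2 := (Complex.hasSum_re ((innerSL ℂ x).hasSum h))
      simp only [innerSL_apply_apply] at h2
      rw [← E.inner_proj_self (MeasurableSet.iUnion hf), ← h2.tsum_eq,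
        ENNReal.ofReal_tsum_of_nonneg _ h2.summable]
      · exact tsum_congr fun n => by rw [E.inner_proj_self (hf n)]
      · intro n
        rw [E.inner_proj_self (hf n)]
        positivity)

theorem diag_apply (E : ProjectionValuedMeasure K) (x : K) {s : Set ℝ} (hs : MeasurableSet s) :
    E.diag x s = ENNReal.ofReal (‖E.proj s x‖ ^ 2) :=
  Measure.ofMeasurable_apply s hs

/-- `E` is the spectral measure of the (possibly unbounded) operator `L`: `L = ∫ t dE(t)`, with
`dom L = {x | ∫ t² d‖E(t)x‖² < ∞}`. -/
structure IsSpectralMeasureOf (E : ProjectionValuedMeasure K) (L : K →ₗ.[ℂ] K) : Prop where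
  mem_domain_iff : ∀ x : K, x ∈ L.domain ↔ ∫⁻ t, ENNReal.ofReal (t ^ 2) ∂(E.diag x) < ∞
  inner_apply : ∀ x : L.domain, ⟪(x : K), L x⟫_ℂ = ((∫ t, t ∂(E.diag (x : K)) : ℝ) : ℂ)

end ProjectionValuedMeasure

/-- The self-adjoint operator `L` in `K`, with `H` embedded isometrically into `K` by `V`, is a
minimal self-adjoint dilation of the bounded dissipative operator `T` in `H`. -/
structure IsMinimalSelfAdjointDilation {H K : Type u}
    [NormedAddCommGroup H] [InnerProductSpace ℂ H] [CompleteSpace H]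
    [NormedAddCommGroup K] [InnerProductSpace ℂ K] [CompleteSpace K]
    (T : H →L[ℂ] H) (V : H →ₗᵢ[ℂ] K) (L : K →ₗ.[ℂ] K) : Prop where
  isSelfAdjoint : IsSelfAdjoint L
  /-- `V* (L - z)⁻¹ V = (T - z)⁻¹` for all `z` in the open lower half-plane. -/
  dilation : ∀ z : ℂ, z.im < 0 → ∀ x : H, ∃ y : L.domain, L y - z • (y : K) = V x ∧
    T (V.toContinuousLinearMap.adjoint (y : K)) - z • V.toContinuousLinearMap.adjoint (y : K) = x
  /-- `K` is the closed linear span of the vectors `(L - z)⁻¹ V x`, `z ∉ ℝ`, `x ∈ H`. -/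
  minimal : (Submodule.span ℂ {k : K | ∃ (z : ℂ) (x : H) (y : L.domain),
    z.im ≠ 0 ∧ L y - z • (y : K) = V x ∧ k = y}).topologicalClosure = ⊤

/-- `X` is the compression to `H` of the spectral projection `E_L((-∞, 0))` of a minimal
self-adjoint dilation `L` of `T`. -/
def IsXi {H : Type u} [NormedAddCommGroup H] [InnerProductSpace ℂ H] [CompleteSpace H]
    (T X : H →L[ℂ] H) : Prop :=
  ∃ (K : Type u) (_ : NormedAddCommGroup K) (_ : InnerProductSpace ℂ K) (_ : CompleteSpace K)
    (V : H →ₗᵢ[ℂ] K) (L : K →ₗ.[ℂ] K) (E : ProjectionValuedMeasure K),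
    IsMinimalSelfAdjointDilation T V L ∧ E.IsSpectralMeasureOf L ∧
      X = V.toContinuousLinearMap.adjoint ∘L E.proj (Set.Iio 0) ∘L V.toContinuousLinearMap

open Classical in
/-- The operator `Ξ(T)` of a bounded dissipative operator `T`. The minimal self-adjoint dilation
exists and is unique up to unitary equivalence for every such `T`; for a bounded operator that is
not dissipative the value is `0` by convention. -/
noncomputable def Xi {H : Type u} [NormedAddCommGroup H] [InnerProductSpace ℂ H] [CompleteSpace H]
    (T : H →L[ℂ] H) : H →L[ℂ] H :=
  if h : ∃ X : H →L[ℂ] H, IsXi T X then h.choose else 0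

/-!
# Trace class perturbations of signature operators

For a bounded dissipative operator `T` let `μ_x` be the spectral measure of its dilation at the
vector `x`. The Stieltjes transform of `μ_x` is `⟪x, (T - z)⁻¹ x⟫` in the lower half-plane
(`IsXi.exists_measure`), and `⟪x, Ξ(T) x⟫ = μ_x(-∞, 0)`. Since `∫₀^N t / (t² + η²) dη = arctan (N / t)`,
integrating `Re (T + iη)⁻¹` along the half-axis `z = -iη` gives, weakly,

  `lim ∫₀^N Re R(η) dη = π/2 - π Ξ(T)`,

where `R(η)` is the resolvent `(T + iη)⁻¹`, corrected by a multiple of the projection `P` onto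
`ker T` so that it stays bounded at `η = 0` (`IsXi.tendsto_integral_re_inner`).

Let now `T = S + W`, `W = A + iB`. On `ker T` one has `P = (S W)² P`, hence `P` is trace class, and
`M = T + P` is `S` times an injective compact perturbation of the identity, so it is invertible
(`exists_kernel_projection`). With `R(η) = (M + iη)⁻¹`, `Q(η) = (S + iη)⁻¹ = (S - iη) / (1 + η²)` and
`W' = W + P` the resolvent identity gives

  `R - Q = - Q A Q - Q (P + iB) Q + Q W' Q W' R`.

All terms but the first are trace class with trace norm `O(1 / (1 + η²))`, because `A` is
Hilbert–Schmidt and `B`, `P` are trace class (`exists_traceBound_remainder`). The real part of the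
first one is explicit, `Re (Q A Q) = (S A S - η² A) / (1 + η²)²`, and its integral over the half-axis
is `π/4 (S A S - A)`. Trace norm bounds survive weak limits (`TraceBound.of_weak_tendsto`), therefore
`Ξ(T) - Ξ(S) - (S A S - A) / 4` is trace class (`isNuclear_xi_sub`), and `S A S - A = S [A, S]` with
`S` invertible.

The value `Ξ(T)` only has this meaning once a minimal self-adjoint dilation is known to exist. It is
built in `Colligation.exists_isXi`: the Cayley transform `C` of `T` is a corner of a unitary
`2 × 2` operator matrix, which together with a bilateral shift defines a unitary operator `U` on `ℓ²(ℤ, H)`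
whose powers compress to those of `C`. The inverse Cayley transform of the restriction of `U` to the
closed span of the vectors `Uⁿ x` is the generator of the dilation; its spectral measure comes from the
continuous functional calculus of `U`.
-/

/-! ### Trace class operators through duality with finite rank operators -/

section TraceBound

open InnerProductSpace Filter Topology

variable {H : Type u} [NormedAddCommGroup H] [InnerProductSpace ℂ H]

/-- The trace norm of `T` is at most `C`, expressed by duality with finite rank operators:
`|tr (T F)| ≤ C ‖F‖` for every finite rank `F = ∑ ⟪x i, ·⟫ y i`. -/
def TraceBound (T : H →L[ℂ] H) (C : ℝ) : Prop :=
  0 ≤ C ∧ ∀ (n : ℕ) (x y : Fin n → H),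
    ‖∑ i, ⟪x i, T (y i)⟫_ℂ‖ ≤ C * ‖∑ i, rankOne ℂ (y i) (x i)‖

namespace TraceBound

theorem add {S T : H →L[ℂ] H} {C D : ℝ} (hS : TraceBound S C) (hT : TraceBound T D) :
    TraceBound (S + T) (C + D) := by
  refine ⟨add_nonneg hS.1 hT.1, fun n x y => ?_⟩
  have : ∑ i, ⟪x i, (S + T) (y i)⟫_ℂ = ∑ i, ⟪x i, S (y i)⟫_ℂ + ∑ i, ⟪x i, T (y i)⟫_ℂ := by
    simp [Finset.sum_add_distrib]
  rw [this, add_mul]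
  exact (norm_add_le _ _).trans (add_le_add (hS.2 n x y) (hT.2 n x y))

theorem smul {T : H →L[ℂ] H} {C : ℝ} (c : ℂ) (hT : TraceBound T C) :
    TraceBound (c • T) (‖c‖ * C) := by
  refine ⟨mul_nonneg (norm_nonneg _) hT.1, fun n x y => ?_⟩
  have : ∑ i, ⟪x i, (c • T) (y i)⟫_ℂ = c * ∑ i, ⟪x i, T (y i)⟫_ℂ := by
    simp [Finset.mul_sum]
  rw [this, norm_mul, mul_assoc]
  exact mul_le_mul_of_nonneg_left (hT.2 n x y) (norm_nonneg _)

theorem neg {T : H →L[ℂ] H} {C : ℝ} (hT : TraceBound T C) : TraceBound (-T) C := by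
  simpa using hT.smul (-1)

theorem sub {S T : H →L[ℂ] H} {C D : ℝ} (hS : TraceBound S C) (hT : TraceBound T D) :
    TraceBound (S - T) (C + D) := by
  simpa [sub_eq_add_neg] using hS.add hT.neg

theorem mono {T : H →L[ℂ] H} {C D : ℝ} (hT : TraceBound T C) (h : C ≤ D) : TraceBound T D :=
  ⟨hT.1.trans h, fun n x y => (hT.2 n x y).trans
    (mul_le_mul_of_nonneg_right h (norm_nonneg _))⟩

theorem mul_right {T : H →L[ℂ] H} {C : ℝ} (hT : TraceBound T C) (R : H →L[ℂ] H) :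
    TraceBound (T * R) (C * ‖R‖) := by
  refine ⟨mul_nonneg hT.1 (norm_nonneg _), fun n x y => ?_⟩
  have h : ∑ i, rankOne ℂ (R (y i)) (x i) = R ∘L ∑ i, rankOne ℂ (y i) (x i) := by
    ext z; simp
  have h1 := hT.2 n x fun i => R (y i)
  rw [h] at h1
  calc _ ≤ _ := h1
    _ ≤ C * (‖R‖ * ‖∑ i, rankOne ℂ (y i) (x i)‖) :=
      mul_le_mul_of_nonneg_left (ContinuousLinearMap.opNorm_comp_le _ _) hT.1
    _ = _ := by ring

theorem mul_left [CompleteSpace H] {T : H →L[ℂ] H} {C : ℝ} (hT : TraceBound T C)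
    (R : H →L[ℂ] H) : TraceBound (R * T) (‖R‖ * C) := by
  refine ⟨mul_nonneg (norm_nonneg _) hT.1, fun n x y => ?_⟩
  have h : ∑ i, rankOne ℂ (y i) (R.adjoint (x i)) = (∑ i, rankOne ℂ (y i) (x i)) ∘L R := by
    ext z; simp [ContinuousLinearMap.adjoint_inner_left]
  have h1 := hT.2 n (fun i => R.adjoint (x i)) y
  rw [h] at h1
  simp only [ContinuousLinearMap.adjoint_inner_left] at h1
  calc _ ≤ _ := h1
    _ ≤ C * (‖∑ i, rankOne ℂ (y i) (x i)‖ * ‖R‖) :=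
      mul_le_mul_of_nonneg_left (ContinuousLinearMap.opNorm_comp_le _ _) hT.1
    _ = _ := by ring

theorem of_weak_tendsto {ι : Type*} {l : Filter ι} [l.NeBot] {F : ι → H →L[ℂ] H}
    {T : H →L[ℂ] H} {C : ℝ}
    (hF : ∀ x y : H, Tendsto (fun i => ⟪x, F i y⟫_ℂ) l (𝓝 ⟪x, T y⟫_ℂ))
    (hC : ∀ i, TraceBound (F i) C) : TraceBound T C := by
  obtain ⟨i0, -⟩ := (Filter.univ_mem : Set.univ ∈ l) |> l.nonempty_of_mem
  refine ⟨(hC i0).1, fun n x y => ?_⟩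
  exact le_of_tendsto (tendsto_finsetSum _ fun i _ => hF (x i) (y i)).norm
    (Eventually.of_forall fun i => (hC i).2 n x y)

theorem of_tendsto {ι : Type*} {l : Filter ι} [l.NeBot] {F : ι → H →L[ℂ] H}
    {T : H →L[ℂ] H} {C : ℝ} (hF : Tendsto F l (𝓝 T)) (hC : ∀ i, TraceBound (F i) C) :
    TraceBound T C := by
  refine of_weak_tendsto (F := F) (l := l) (fun x y => ?_) hC
  have h : Continuous fun S : H →L[ℂ] H => ⟪x, S y⟫_ℂ := by fun_prop
  exact (h.tendsto T).comp hF

theorem intervalIntegral [CompleteSpace H] {f : ℝ → H →L[ℂ] H} {g : ℝ → ℝ} {a b : ℝ} (hab : a ≤ b)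
    (hf : IntervalIntegrable f volume a b) (hg : IntervalIntegrable g volume a b)
    (h : ∀ t ∈ Set.Icc a b, TraceBound (f t) (g t)) :
    TraceBound (∫ t in a..b, f t) (∫ t in a..b, g t) := by
  refine ⟨intervalIntegral.integral_nonneg hab fun t ht => (h t ht).1, fun n x y => ?_⟩
  let φ : (H →L[ℂ] H) →L[ℂ] ℂ :=
    ∑ i, (innerSL ℂ (x i)) ∘L (ContinuousLinearMap.apply ℂ H (y i))
  have hφ : ∀ S : H →L[ℂ] H, φ S = ∑ i, ⟪x i, S (y i)⟫_ℂ := fun S => by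
    simp [φ]
  rw [← hφ, ← φ.intervalIntegral_comp_comm hf, ← intervalIntegral.integral_mul_const]
  refine intervalIntegral.norm_integral_le_of_norm_le hab ?_ (hg.mul_const _)
  refine Eventually.of_forall fun t ht => ?_
  rw [hφ]
  exact (h t ⟨ht.1.le, ht.2⟩).2 n x y

end TraceBound

/-- Trace class in the dual sense: some `TraceBound` holds. -/
def IsNuclear (T : H →L[ℂ] H) : Prop := ∃ C, TraceBound T C

namespace IsNuclear

theorem add {S T : H →L[ℂ] H} (hS : IsNuclear S) (hT : IsNuclear T) : IsNuclear (S + T) :=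
  let ⟨_, h⟩ := hS; let ⟨_, k⟩ := hT; ⟨_, h.add k⟩

theorem sub {S T : H →L[ℂ] H} (hS : IsNuclear S) (hT : IsNuclear T) : IsNuclear (S - T) :=
  let ⟨_, h⟩ := hS; let ⟨_, k⟩ := hT; ⟨_, h.sub k⟩

theorem smul {T : H →L[ℂ] H} (c : ℂ) (hT : IsNuclear T) : IsNuclear (c • T) :=
  let ⟨_, h⟩ := hT; ⟨_, h.smul c⟩

theorem mul_right {T : H →L[ℂ] H} (hT : IsNuclear T) (R : H →L[ℂ] H) : IsNuclear (T * R) :=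
  let ⟨_, h⟩ := hT; ⟨_, h.mul_right R⟩

theorem mul_left [CompleteSpace H] {T : H →L[ℂ] H} (hT : IsNuclear T) (R : H →L[ℂ] H) :
    IsNuclear (R * T) :=
  let ⟨_, h⟩ := hT; ⟨_, h.mul_left R⟩

end IsNuclear

end TraceBound

section HilbertSchmidt

open InnerProductSpace Filter Topology

variable {H : Type u} [NormedAddCommGroup H] [InnerProductSpace ℂ H] [CompleteSpace H]
  {ι : Type*}

theorem TraceBound.star {T : H →L[ℂ] H} {C : ℝ} (hT : TraceBound T C) :
    TraceBound (star T) C := by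
  refine ⟨hT.1, fun n x y => ?_⟩
  have h1 : ∑ i, ⟪x i, (Star.star T) (y i)⟫_ℂ = (starRingEnd ℂ) (∑ i, ⟪y i, T (x i)⟫_ℂ) := by
    rw [map_sum]
    refine Finset.sum_congr rfl fun i _ => ?_
    rw [inner_conj_symm, ContinuousLinearMap.star_eq_adjoint,
      ContinuousLinearMap.adjoint_inner_right]
  have h2 : ∑ i, rankOne ℂ (y i) (x i) = (∑ i, rankOne ℂ (x i) (y i)).adjoint := by
    rw [map_sum]
    simp only [adjoint_rankOne]
  rw [h1, RCLike.norm_conj, h2, LinearIsometryEquiv.norm_map]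
  exact hT.2 n y x

omit [CompleteSpace H] in
theorem HilbertBasis.hasSum_norm_inner_sq (b : HilbertBasis ι ℂ H) (x : H) :
    HasSum (fun i => ‖⟪b i, x⟫_ℂ‖ ^ 2) (‖x‖ ^ 2) := by
  have h := Complex.hasSum_re (b.hasSum_inner_mul_inner x x)
  rw [inner_self_eq_norm_sq_to_K] at h
  convert h using 1
  · ext i
    rw [← inner_conj_symm x (b i), RCLike.conj_mul]
    norm_cast
  · norm_cast

theorem HilbertBasis.summable_norm_sq_adjoint (b : HilbertBasis ι ℂ H) {T : H →L[ℂ] H}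
    (hT : Summable fun i => ‖T (b i)‖ ^ 2) : Summable fun i => ‖T.adjoint (b i)‖ ^ 2 := by
  have h1 : Summable fun p : ι × ι => ‖⟪b p.2, T (b p.1)⟫_ℂ‖ ^ 2 := by
    refine (summable_prod_of_nonneg fun p => sq_nonneg _).2
      ⟨fun i => (b.hasSum_norm_inner_sq (T (b i))).summable, ?_⟩
    simpa only [(b.hasSum_norm_inner_sq _).tsum_eq] using hT
  have h2 := ((summable_prod_of_nonneg fun p => sq_nonneg _).1
    ((Equiv.prodComm ι ι).summable_iff.2 h1)).2
  refine h2.congr fun i => ?_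
  rw [← (b.hasSum_norm_inner_sq (T.adjoint (b i))).tsum_eq]
  refine tsum_congr fun j => ?_
  simp only [Equiv.prodComm_apply, Prod.swap]
  rw [ContinuousLinearMap.adjoint_inner_right, ← inner_conj_symm, RCLike.norm_conj]

/-- The product of two Hilbert–Schmidt operators is trace class. -/
theorem HilbertBasis.isNuclear_mul (b : HilbertBasis ι ℂ H) {S T : H →L[ℂ] H}
    (hS : Summable fun i => ‖S (b i)‖ ^ 2) (hT : Summable fun i => ‖T (b i)‖ ^ 2) :
    IsNuclear (S * T) := by
  have hT' := b.summable_norm_sq_adjoint hT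
  have hsum := (hT'.add hS).div_const 2
  refine ⟨∑' i, (‖T.adjoint (b i)‖ ^ 2 + ‖S (b i)‖ ^ 2) / 2,
    tsum_nonneg fun i => by positivity, fun n x y => ?_⟩
  set F := ∑ i, rankOne ℂ (y i) (x i) with hF
  have h1 : HasSum (fun k => ⟪T.adjoint (b k), F (S (b k))⟫_ℂ) (∑ i, ⟪x i, (S * T) (y i)⟫_ℂ) := by
    have h2 := hasSum_sum (s := Finset.univ) fun i _ =>
      b.hasSum_inner_mul_inner (S.adjoint (x i)) (T (y i))
    have h3 : ∀ k, ⟪T.adjoint (b k), F (S (b k))⟫_ℂ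
        = ∑ i, ⟪S.adjoint (x i), b k⟫_ℂ * ⟪b k, T (y i)⟫_ℂ := fun k => by
      rw [ContinuousLinearMap.adjoint_inner_left, hF, sum_apply, map_sum, inner_sum]
      refine Finset.sum_congr rfl fun i _ => ?_
      rw [rankOne_apply, map_smul, inner_smul_right, ContinuousLinearMap.adjoint_inner_left]
    have h4 : ∑ i, ⟪x i, (S * T) (y i)⟫_ℂ = ∑ i, ⟪S.adjoint (x i), T (y i)⟫_ℂ := by
      refine Finset.sum_congr rfl fun i _ => ?_
      rw [ContinuousLinearMap.adjoint_inner_left]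
      rfl
    rw [h4, funext h3]
    exact h2
  have hb : ∀ k, ‖⟪T.adjoint (b k), F (S (b k))⟫_ℂ‖
      ≤ (‖T.adjoint (b k)‖ ^ 2 + ‖S (b k)‖ ^ 2) / 2 * ‖F‖ := fun k => by
    calc _ ≤ ‖T.adjoint (b k)‖ * ‖F (S (b k))‖ := norm_inner_le_norm _ _
      _ ≤ ‖T.adjoint (b k)‖ * (‖F‖ * ‖S (b k)‖) := by gcongr; exact F.le_opNorm _
      _ = (‖T.adjoint (b k)‖ * ‖S (b k)‖) * ‖F‖ := by ring
      _ ≤ _ := by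
        gcongr
        nlinarith [sq_nonneg (‖T.adjoint (b k)‖ - ‖S (b k)‖)]
  rw [← h1.tsum_eq, ← tsum_mul_right]
  exact tsum_of_norm_bounded (hsum.mul_right _).hasSum hb

/-- A Hilbert–Schmidt operator is compact: it is the norm limit of the finite rank operators obtained by
cutting off the basis expansion. -/
theorem HilbertBasis.isCompactOperator (b : HilbertBasis ι ℂ H) {T : H →L[ℂ] H}
    (hT : Summable fun i => ‖T (b i)‖ ^ 2) : IsCompactOperator T := by
  classical
  have hb : ∀ x, HasSum (fun i => ⟪b i, x⟫_ℂ • T (b i)) (T x) := fun x => by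
    have := T.hasSum (b.hasSum_repr x)
    simpa [b.repr_apply_apply] using this
  refine isCompactOperator_of_tendsto (l := atTop)
    (F := fun s : Finset ι => ∑ i ∈ s, rankOne ℂ (T (b i)) (b i)) ?_ ?_
  · rw [tendsto_iff_norm_sub_tendsto_zero]
    have hlim : Tendsto (fun s : Finset ι => √(∑' i : {i // i ∉ s}, ‖T (b i)‖ ^ 2)) atTop (𝓝 0) := by
      simpa [Function.comp_def] using (Real.continuous_sqrt.tendsto _).comp
        (tendsto_tsum_compl_atTop_zero fun i => ‖T (b i)‖ ^ 2)
    refine squeeze_zero (fun _ => norm_nonneg _) (fun s => ?_) hlim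
    refine ContinuousLinearMap.opNorm_le_bound _ (Real.sqrt_nonneg _) fun x => ?_
    have h1 : HasSum (fun i : {i // i ∉ s} => ⟪b i, x⟫_ℂ • T (b i))
        (T x - ∑ i ∈ s, ⟪b i, x⟫_ℂ • T (b i)) := by
      have := (hasSum_subtype_iff_indicator (s := {i | i ∉ s})
        (f := fun i => ⟪b i, x⟫_ℂ • T (b i))
        (a := T x - ∑ i ∈ s, ⟪b i, x⟫_ℂ • T (b i))).2 ?_
      · exact this
      · have h2 := (hb x).sub (hasSum_sum_of_ne_finset_zero
          (f := fun i => if i ∈ s then ⟪b i, x⟫_ℂ • T (b i) else 0) (s := s)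
          (fun i hi => by simp [hi]))
        convert h2 using 1
        · ext i
          by_cases hi : i ∈ s <;> simp [hi]
        · congr 1
          exact Finset.sum_congr rfl fun i hi => by simp [hi]
    have h3 : Summable fun i : {i // i ∉ s} => ‖⟪b i, x⟫_ℂ‖ ^ 2 :=
      (b.hasSum_norm_inner_sq x).summable.subtype _
    have h4 : Summable fun i : {i // i ∉ s} => ‖T (b i)‖ ^ 2 := hT.subtype _
    have h5 := Real.summable_and_inner_le_Lp_mul_Lq_tsum_of_nonneg
      (Real.HolderConjugate.two_two) (f := fun i : {i // i ∉ s} => ‖⟪b i, x⟫_ℂ‖)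
      (g := fun i : {i // i ∉ s} => ‖T (b i)‖) (fun _ => norm_nonneg _) (fun _ => norm_nonneg _)
      (by simpa using h3) (by simpa using h4)
    simp only [Real.rpow_two, ← Real.sqrt_eq_rpow] at h5
    have h6 : ‖T x - ∑ i ∈ s, ⟪b i, x⟫_ℂ • T (b i)‖
        ≤ ∑' i : {i // i ∉ s}, ‖⟪b i, x⟫_ℂ‖ * ‖T (b i)‖ := by
      rw [← h1.tsum_eq]
      exact tsum_of_norm_bounded h5.1.hasSum fun i => (norm_smul _ _).le
    have h7 : √(∑' i : {i // i ∉ s}, ‖⟪b i, x⟫_ℂ‖ ^ 2) ≤ ‖x‖ := by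
      rw [Real.sqrt_le_left (norm_nonneg _), ← (b.hasSum_norm_inner_sq x).tsum_eq]
      exact (b.hasSum_norm_inner_sq x).summable.tsum_subtype_le _ _ (fun i => sq_nonneg _)
    calc _ = ‖T x - ∑ i ∈ s, ⟪b i, x⟫_ℂ • T (b i)‖ := by
          rw [← norm_neg]; simp
      _ ≤ _ := h6
      _ ≤ _ := h5.2
      _ ≤ _ := by rw [mul_comm]; gcongr
  · refine Eventually.of_forall fun s => ?_
    have : ∀ s : Finset ι, IsCompactOperator
        (∑ i ∈ s, rankOne ℂ (T (b i)) (b i) : H →L[ℂ] H) := fun s => by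
      induction s using Finset.induction_on with
      | empty => simpa using isCompactOperator_zero
      | insert i s hi ih =>
        rw [Finset.sum_insert hi]
        refine IsCompactOperator.add ?_ ih
        rw [rankOne_def']
        exact (isCompactOperator_of_locallyCompactSpace_rng
          (ContinuousLinearMap.toSpanSingleton ℂ (T (b i)))).comp_clm (innerSL ℂ (b i))
    exact this s

end HilbertSchmidt

section TraceClass

open InnerProductSpace Filter Topology

variable {H : Type u} [NormedAddCommGroup H] [InnerProductSpace ℂ H] [CompleteSpace H]

theorem norm_abs_apply (T : H →L[ℂ] H) (x : H) : ‖CFC.abs T x‖ = ‖T x‖ := by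
  have hsa : (CFC.abs T).adjoint = CFC.abs T := (CFC.abs_nonneg T).isSelfAdjoint.adjoint_eq
  have h1 : ⟪CFC.abs T x, CFC.abs T x⟫_ℂ = ⟪T x, T x⟫_ℂ := by
    rw [← ContinuousLinearMap.adjoint_inner_left, hsa]
    have := congrArg (fun S : H →L[ℂ] H => S x) (CFC.abs_mul_abs T)
    simp only [mul_apply_eq_comp, ContinuousLinearMap.star_eq_adjoint] at this
    rw [this, ContinuousLinearMap.adjoint_inner_left]
  have h2 : ‖CFC.abs T x‖ ^ 2 = ‖T x‖ ^ 2 := by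
    rw [inner_self_eq_norm_sq_to_K, inner_self_eq_norm_sq_to_K] at h1
    exact_mod_cast h1
  exact (sq_eq_sq₀ (norm_nonneg _) (norm_nonneg _)).1 h2

/-- An approximate polar decomposition: `V = T (|T| + ε)⁻¹` is a contraction with `V |T|` close
to `T` and `V* T` close to `|T|`. -/
theorem exists_approx_polar (T : H →L[ℂ] H) {ε : ℝ} (hε : 0 < ε) :
    ∃ V : H →L[ℂ] H, ‖V‖ ≤ 1 ∧ ‖V * CFC.abs T - T‖ ≤ ε ∧ ‖star V * T - CFC.abs T‖ ≤ ε := by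
  set a := CFC.abs T with ha
  have hapos : a.IsPositive := (ContinuousLinearMap.nonneg_iff_isPositive a).1 (CFC.abs_nonneg T)
  have hsa : star a = a := (CFC.abs_nonneg T).isSelfAdjoint.star_eq
  have hlow : ∀ z, ‖a z‖ ≤ ‖(a + (ε : ℂ) • 1) z‖ ∧ ε * ‖z‖ ≤ ‖(a + (ε : ℂ) • 1) z‖ := fun z => by
    have h0 : 0 ≤ (⟪a z, z⟫_ℂ).re := hapos.re_inner_nonneg_left z
    have h1 : ‖(a + (ε : ℂ) • 1) z‖ ^ 2 = ‖a z‖ ^ 2 + 2 * (ε * (⟪a z, z⟫_ℂ).re) + (ε * ‖z‖) ^ 2 := by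
      have := @norm_add_sq ℂ H _ _ _ (a z) ((ε : ℂ) • z)
      rw [inner_smul_right] at this
      simpa [norm_smul, abs_of_pos hε] using this
    have h2 : 0 ≤ ε * (⟪a z, z⟫_ℂ).re := mul_nonneg hε.le h0
    constructor
    · refine le_of_sq_le_sq ?_ (norm_nonneg _)
      nlinarith [sq_nonneg (ε * ‖z‖)]
    · refine le_of_sq_le_sq ?_ (norm_nonneg _)
      nlinarith [sq_nonneg ‖a z‖]
  have hunit : IsUnit (a + (ε : ℂ) • 1) := by
    refine ContinuousLinearMap.isUnit_of_forall_le_norm_inner_map _ (c := ⟨ε, hε.le⟩) hε fun z => ?_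
    refine le_trans ?_ (Complex.re_le_norm _)
    have h0 : 0 ≤ (⟪a z, z⟫_ℂ).re := hapos.re_inner_nonneg_left z
    have h1 : (⟪(a + (ε : ℂ) • 1) z, z⟫_ℂ).re = (⟪a z, z⟫_ℂ).re + ‖z‖ ^ 2 * ε := by
      have : (a + (ε : ℂ) • 1) z = a z + (ε : ℂ) • z := rfl
      rw [this, inner_add_left, inner_smul_left, inner_self_eq_norm_sq_to_K, Complex.add_re,
        Complex.conj_ofReal, Complex.re_ofReal_mul, mul_comm ε]
      norm_cast
    rw [h1]
    exact le_add_of_nonneg_left h0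
  obtain ⟨u, hu⟩ := hunit
  set r : H →L[ℂ] H := ((u⁻¹ : (H →L[ℂ] H)ˣ) : H →L[ℂ] H) with hr
  have hru : r * (a + (ε : ℂ) • 1) = 1 := by rw [← hu]; exact u.inv_mul
  have hur : (a + (ε : ℂ) • 1) * r = 1 := by rw [← hu]; exact u.mul_inv
  have happ : ∀ x, (a + (ε : ℂ) • 1) (r x) = x := fun x =>
    congrArg (fun S : H →L[ℂ] H => S x) hur
  have hra : r * a = 1 - (ε : ℂ) • r := by
    rw [eq_sub_iff_add_eq, ← hru, mul_add, mul_smul_comm, mul_one]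
  have har : a * r = 1 - (ε : ℂ) • r := by
    rw [eq_sub_iff_add_eq, ← hur, add_mul, smul_mul_assoc, one_mul]
  have hrs : star r = r := by
    have h1 : star r * (a + (ε : ℂ) • 1) = 1 := by
      have := congrArg star hur
      simpa [star_mul, hsa] using this
    calc star r = star r * ((a + (ε : ℂ) • 1) * r) := by rw [hur, mul_one]
      _ = r := by rw [← mul_assoc, h1, one_mul]
  have hTr : ‖T * r‖ ≤ 1 := by
    refine ContinuousLinearMap.opNorm_le_bound _ zero_le_one fun x => ?_
    have h1 := (hlow (r x)).1
    rw [happ, ha, norm_abs_apply] at h1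
    simpa using h1
  have har1 : ‖r * a‖ ≤ 1 := by
    rw [hra, ← har]
    refine ContinuousLinearMap.opNorm_le_bound _ zero_le_one fun x => ?_
    have h1 := (hlow (r x)).1
    rw [happ] at h1
    simpa using h1
  refine ⟨T * r, hTr, ?_, ?_⟩
  · have : T * r * a - T = -((ε : ℂ) • (T * r)) := by
      rw [mul_assoc, hra, mul_sub, mul_one, mul_smul_comm]; abel
    rw [this, norm_neg, norm_smul]
    simpa [abs_of_pos hε] using mul_le_mul_of_nonneg_left hTr hε.le
  · have : star (T * r) * T - a = -((ε : ℂ) • (r * a)) := by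
      rw [star_mul, hrs, mul_assoc, ← CFC.abs_mul_abs, ← ha, ← mul_assoc, hra, sub_mul, one_mul,
        smul_mul_assoc, hra]; abel
    rw [this, norm_neg, norm_smul]
    simpa [abs_of_pos hε] using mul_le_mul_of_nonneg_left har1 hε.le

theorem norm_sqrt_apply_sq {a : H →L[ℂ] H} (ha : 0 ≤ a) (x : H) :
    ‖CFC.sqrt a x‖ ^ 2 = (⟪x, a x⟫_ℂ).re := by
  have hsa : (CFC.sqrt a).adjoint = CFC.sqrt a := (CFC.sqrt_nonneg a).isSelfAdjoint.adjoint_eq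
  have h1 : ⟪CFC.sqrt a x, CFC.sqrt a x⟫_ℂ = ⟪x, a x⟫_ℂ := by
    nth_rw 1 [← hsa]
    rw [ContinuousLinearMap.adjoint_inner_left]
    conv_rhs => rw [← CFC.sqrt_mul_sqrt_self a ha]
    rfl
  rw [← h1, inner_self_eq_norm_sq_to_K]
  norm_cast

theorem IsTraceClass.exists_summable_sqrt {T : H →L[ℂ] H} (hT : IsTraceClass T) :
    ∃ (w : Set H) (b : HilbertBasis w ℂ H),
      Summable fun i => ‖CFC.sqrt (CFC.abs T) (b i)‖ ^ 2 := by
  obtain ⟨w, b, h⟩ := hT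
  exact ⟨w, b, h.congr fun i => (norm_sqrt_apply_sq (CFC.abs_nonneg T) _).symm⟩

/-- The definition of trace class by the basis sum of `|T|` agrees with the one by duality. The dual
one is visibly stable under sums, products, weak limits and integrals. The approximate polar
decomposition transfers bounds between `T` and `|T|`, and `|T|` is the square of a Hilbert–Schmidt
operator. -/
theorem isTraceClass_iff_isNuclear {T : H →L[ℂ] H} : IsTraceClass T ↔ IsNuclear T := by
  have hpos : ∀ n : ℕ, (0 : ℝ) < 1 / ((n : ℝ) + 1) := fun n => by positivity
  choose V hV hVT hVT' using fun n : ℕ => exists_approx_polar T (hpos n)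
  have hlim : ∀ {F : ℕ → H →L[ℂ] H} {S : H →L[ℂ] H},
      (∀ n, ‖F n - S‖ ≤ 1 / ((n : ℝ) + 1)) → Tendsto F atTop (𝓝 S) := fun {F S} h => by
    rw [tendsto_iff_norm_sub_tendsto_zero]
    exact squeeze_zero (fun _ => norm_nonneg _) h tendsto_one_div_add_atTop_nhds_zero_nat
  constructor
  · intro hT
    obtain ⟨w, b, h⟩ := hT.exists_summable_sqrt
    obtain ⟨C, hC⟩ := b.isNuclear_mul h h
    rw [CFC.sqrt_mul_sqrt_self _ (CFC.abs_nonneg T)] at hC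
    refine ⟨C, TraceBound.of_tendsto (hlim hVT) fun n => (hC.mul_left (V n)).mono ?_⟩
    exact mul_le_of_le_one_left hC.1 (hV n)
  · rintro ⟨C, hC⟩
    have hC' : TraceBound (CFC.abs T) C := by
      refine TraceBound.of_tendsto (hlim hVT') fun n => (hC.mul_left (star (V n))).mono ?_
      exact mul_le_of_le_one_left hC.1 (by rw [norm_star]; exact hV n)
    obtain ⟨w, b, -⟩ := exists_hilbertBasis ℂ H
    refine ⟨w, b, ?_⟩
    have hnn : ∀ x, 0 ≤ (⟪x, CFC.abs T x⟫_ℂ).re := fun x =>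
      ((ContinuousLinearMap.nonneg_iff_isPositive _).1 (CFC.abs_nonneg T)).re_inner_nonneg_right x
    refine summable_of_sum_le (c := C) (fun i => hnn _) fun s => ?_
    let e := s.equivFin
    have h1 := hC'.2 s.card (fun k => b (e.symm k)) (fun k => b (e.symm k))
    have h2 : ‖∑ k, rankOne ℂ (b (e.symm k : w)) (b (e.symm k : w))‖ ≤ 1 := by
      rw [e.symm.sum_comp (fun k : s => rankOne ℂ (b (k : w)) (b (k : w))),
        Finset.sum_coe_sort s (fun k => rankOne ℂ (b k) (b k))]
      refine ContinuousLinearMap.opNorm_le_bound _ zero_le_one fun x => ?_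
      have h3 : (∑ i ∈ s, rankOne ℂ (b i) (b i)) x = ∑ i ∈ s, ⟪b i, x⟫_ℂ • b i := by
        simp
      have h4 : ‖∑ i ∈ s, ⟪b i, x⟫_ℂ • b i‖ ^ 2 = ∑ i ∈ s, ‖⟪b i, x⟫_ℂ‖ ^ 2 := by
        have h5 := b.orthonormal.inner_sum (fun i => ⟪b i, x⟫_ℂ) (fun i => ⟪b i, x⟫_ℂ) s
        rw [inner_self_eq_norm_sq_to_K] at h5
        simp only [RCLike.conj_mul] at h5
        exact_mod_cast h5
      rw [h3, one_mul]
      refine le_of_sq_le_sq ?_ (norm_nonneg _)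
      rw [h4]
      exact Orthonormal.sum_inner_products_le x b.orthonormal
    rw [e.symm.sum_comp (fun k : s => ⟪b (k : w), CFC.abs T (b (k : w))⟫_ℂ),
        Finset.sum_coe_sort s (fun k => ⟪b k, CFC.abs T (b k)⟫_ℂ)] at h1
    calc ∑ i ∈ s, (⟪b i, CFC.abs T (b i)⟫_ℂ).re = (∑ i ∈ s, ⟪b i, CFC.abs T (b i)⟫_ℂ).re := by simp
      _ ≤ ‖∑ i ∈ s, ⟪b i, CFC.abs T (b i)⟫_ℂ‖ := Complex.re_le_norm _
      _ ≤ C := h1.trans (mul_le_of_le_one_right hC.1 h2)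

theorem IsTraceClass.isCompactOperator {B : H →L[ℂ] H} (hB1 : IsTraceClass B)
    (hB : B.IsPositive) : IsCompactOperator B := by
  have hB0 : 0 ≤ B := (ContinuousLinearMap.nonneg_iff_isPositive B).2 hB
  obtain ⟨w, b, h⟩ := hB1.exists_summable_sqrt
  rw [CFC.abs_of_nonneg B hB0] at h
  have h1 := (b.isCompactOperator h).clm_comp (CFC.sqrt B)
  have h2 : B = CFC.sqrt B * CFC.sqrt B := (CFC.sqrt_mul_sqrt_self B hB0).symm
  rw [h2]
  exact h1

end TraceClass

/-! ### Spectral measures from a continuous functional calculus -/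

namespace ContinuousCalculus

open Filter Topology

variable {X : Type*} [MetricSpace X] [CompactSpace X] [MeasurableSpace X] [BorelSpace X]
  {K : Type u} [NormedAddCommGroup K] [InnerProductSpace ℂ K] [CompleteSpace K]
  (Φ : C(X, ℂ) →⋆ₐ[ℂ] (K →L[ℂ] K))

/-- A real continuous function as a complex one. -/
def toComplex (f : C(X, ℝ)) : C(X, ℂ) := ⟨fun t => (f t : ℂ), by fun_prop⟩

omit [CompactSpace X] [MeasurableSpace X] [BorelSpace X] in
variable {Φ} in
theorem inner_map_star_mul (f g : C(X, ℂ)) (x y : K) :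
    ⟪x, Φ (star f * g) y⟫_ℂ = ⟪Φ f x, Φ g y⟫_ℂ := by
  rw [map_mul, map_star, mul_apply_eq_comp, ContinuousLinearMap.star_eq_adjoint,
    ContinuousLinearMap.adjoint_inner_right]

/-- The positive functional `f ↦ ⟪x, Φ f x⟫` on real continuous functions. -/
noncomputable def functional (x : K) : CompactlySupportedContinuousMap X ℝ →ₚ[ℝ] ℝ :=
  PositiveLinearMap.mk₀
    { toFun := fun f => (⟪x, Φ (toComplex f) x⟫_ℂ).re
      map_add' := fun f g => by
        have : toComplex ((f + g : CompactlySupportedContinuousMap X ℝ) : C(X, ℝ))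
            = toComplex (f : C(X, ℝ)) + toComplex (g : C(X, ℝ)) := by ext; simp [toComplex]
        rw [this]; simp
      map_smul' := fun c f => by
        have : toComplex ((c • f : CompactlySupportedContinuousMap X ℝ) : C(X, ℝ))
            = (c : ℂ) • toComplex (f : C(X, ℝ)) := by ext; simp [toComplex]
        rw [this, map_smul]
        simp }
    (by
      intro f hf
      -- a nonnegative continuous function is the square of its square root
      let g : C(X, ℂ) := toComplex ⟨fun t => √(f t), by fun_prop⟩
      have : toComplex (f : C(X, ℝ)) = star g * g := by
        ext t
        have h0 : 0 ≤ f t := hf t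
        simp only [toComplex, g, ContinuousMap.coe_mk, ContinuousMap.mul_apply,
          ContinuousMap.star_apply, RCLike.star_def, Complex.conj_ofReal]
        rw [← Complex.ofReal_mul, Real.mul_self_sqrt h0]
      change 0 ≤ (⟪x, Φ (toComplex (f : C(X, ℝ))) x⟫_ℂ).re
      rw [this, inner_map_star_mul, inner_self_eq_norm_sq_to_K]
      norm_cast
      exact sq_nonneg _)

/-- The scalar spectral measure of `x`: `∫ f dμ = ⟪x, Φ f x⟫`. -/
noncomputable def scalarMeasure (x : K) : Measure X := RealRMK.rieszMeasure (functional Φ x)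

instance (x : K) : IsFiniteMeasure (scalarMeasure Φ x) := by
  unfold scalarMeasure; infer_instance

theorem integral_scalarMeasure (x : K) (f : C(X, ℝ)) :
    ∫ t, f t ∂(scalarMeasure Φ x) = (⟪x, Φ (toComplex f) x⟫_ℂ).re :=
  RealRMK.integral_rieszMeasure (functional Φ x) (CompactlySupportedContinuousMap.continuousMapEquiv f)

theorem lintegral_enorm_sq_scalarMeasure (x : K) (f : C(X, ℂ)) :
    ∫⁻ t, ‖f t‖ₑ ^ 2 ∂(scalarMeasure Φ x) = ‖Φ f x‖ₑ ^ 2 := by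
  let g : C(X, ℝ) := ⟨fun t => ‖f t‖ ^ 2, by fun_prop⟩
  have hg : toComplex g = star f * f := by
    ext t
    simp only [toComplex, g, ContinuousMap.coe_mk, ContinuousMap.mul_apply,
          ContinuousMap.star_apply, RCLike.star_def, RCLike.conj_mul]
    norm_cast
  have h1 := integral_scalarMeasure Φ x g
  rw [hg, inner_map_star_mul, inner_self_eq_norm_sq_to_K] at h1
  have h2 : ∫⁻ t, ‖f t‖ₑ ^ 2 ∂(scalarMeasure Φ x)
      = ∫⁻ t, ENNReal.ofReal (g t) ∂(scalarMeasure Φ x) := by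
    refine lintegral_congr fun t => ?_
    simp only [g, ContinuousMap.coe_mk]
    rw [ENNReal.ofReal_pow (norm_nonneg _), ofReal_norm]
  rw [h2, ← ofReal_integral_eq_lintegral_ofReal
    ((g.continuous.integrable_of_hasCompactSupport (HasCompactSupport.of_compactSpace _)))
    (Eventually.of_forall fun t => by simp only [g, ContinuousMap.coe_mk]; positivity), h1,
    ← ofReal_norm, ← ENNReal.ofReal_pow (norm_nonneg _)]
  norm_cast

omit [MetricSpace X] [CompactSpace X] [BorelSpace X] in
theorem sq_eLpNorm_two {μ : Measure X} (h : X → ℂ) :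
    eLpNorm h 2 μ ^ 2 = ∫⁻ t, ‖h t‖ₑ ^ 2 ∂μ := by
  have := eLpNorm_nnreal_pow_eq_lintegral (μ := μ) (f := h) (p := 2) two_ne_zero
  simpa using this

omit [MetricSpace X] [CompactSpace X] [BorelSpace X] in
theorem eLpNorm_two_congr {μ ν : Measure X} {h k : X → ℂ}
    (H : ∫⁻ t, ‖h t‖ₑ ^ 2 ∂μ = ∫⁻ t, ‖k t‖ₑ ^ 2 ∂ν) : eLpNorm h 2 μ = eLpNorm k 2 ν := by
  rw [← sq_eLpNorm_two, ← sq_eLpNorm_two] at H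
  exact (ENNReal.pow_right_strictMono two_ne_zero).injective H

/-- `f ↦ Φ f x` is isometric for the norm of `L²` of the scalar spectral measure. -/
theorem enorm_map_apply (x : K) (f : C(X, ℂ)) :
    ‖Φ f x‖ₑ = eLpNorm f 2 (scalarMeasure Φ x) := by
  have h := lintegral_enorm_sq_scalarMeasure Φ x f
  rw [← sq_eLpNorm_two] at h
  exact ((ENNReal.pow_right_strictMono two_ne_zero).injective h).symm

theorem exists_continuous_tendsto {ν : Measure X} [IsFiniteMeasure ν] {h : X → ℂ} (hh : MemLp h 2 ν) :
    ∃ f : ℕ → C(X, ℂ), Tendsto (fun n => eLpNorm (⇑(f n) - h) 2 ν) atTop (𝓝 0) := by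
  have hpos : ∀ n : ℕ, ENNReal.ofReal (1 / ((n : ℝ) + 1)) ≠ 0 := fun n => by
    rw [Ne, ENNReal.ofReal_eq_zero, not_le]; positivity
  choose g hg hg' using fun n => hh.exists_boundedContinuous_eLpNorm_sub_le ENNReal.ofNat_ne_top (hpos n)
  refine ⟨fun n => (g n).toContinuousMap, ?_⟩
  refine tendsto_of_tendsto_of_tendsto_of_le_of_le tendsto_const_nhds ?_ (fun n => zero_le)
    (fun n => ?_) (h := fun n : ℕ => ENNReal.ofReal (1 / ((n : ℝ) + 1)))
  · have := (ENNReal.continuous_ofReal.tendsto 0).comp (tendsto_one_div_add_atTop_nhds_zero_nat (𝕜 := ℝ))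
    simpa [Function.comp_def] using this
  · rw [eLpNorm_sub_comm]; exact hg n

theorem edist_map_apply_le (x : K) {h : X → ℂ} (hh : MemLp h 2 (scalarMeasure Φ x))
    (f g : C(X, ℂ)) : edist (Φ f x) (Φ g x) ≤
      eLpNorm (⇑f - h) 2 (scalarMeasure Φ x) + eLpNorm (⇑g - h) 2 (scalarMeasure Φ x) := by
  have h1 : Φ f x - Φ g x = Φ (f - g) x := by simp
  rw [edist_eq_enorm_sub, h1, enorm_map_apply, eLpNorm_sub_comm (⇑g)]
  have h2 : (⇑(f - g) : X → ℂ) = (⇑f - h) + (h - ⇑g) := by ext t; simp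
  rw [h2]
  exact eLpNorm_add_le (f.continuous.aestronglyMeasurable.sub hh.1)
    (hh.1.sub g.continuous.aestronglyMeasurable) one_le_two

/-- The vectors `Φ (f n) x` converge for continuous `f n → h` in `L²`, to a limit that depends only
on `h`. -/
theorem exists_forall_tendsto (x : K) {h : X → ℂ} (hh : MemLp h 2 (scalarMeasure Φ x)) :
    ∃ v : K, ∀ (f : ℕ → C(X, ℂ)),
      Tendsto (fun n => eLpNorm (⇑(f n) - h) 2 (scalarMeasure Φ x)) atTop (𝓝 0) →
      Tendsto (fun n => Φ (f n) x) atTop (𝓝 v) := by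
  obtain ⟨g, hg⟩ := exists_continuous_tendsto hh
  have hC : CauchySeq fun n => Φ (g n) x := by
    rw [EMetric.cauchySeq_iff]
    intro ε hε
    have h1 := (ENNReal.tendsto_nhds_zero.1 hg) (ε / 3) (ENNReal.div_pos hε.ne' (by simp))
    obtain ⟨N, hN⟩ := eventually_atTop.1 h1
    rcases eq_or_ne ε ⊤ with rfl | hε'
    · exact ⟨0, fun m _ n _ => edist_lt_top _ _⟩
    refine ⟨N, fun m hm n hn => (edist_map_apply_le Φ x hh _ _).trans_lt ?_⟩
    refine (add_le_add (hN m hm) (hN n hn)).trans_lt ?_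
    calc ε / 3 + ε / 3 < ε / 3 + ε / 3 + ε / 3 :=
          ENNReal.lt_add_right (by simp [ENNReal.div_eq_top, hε'])
            (ENNReal.div_pos hε.ne' (by simp)).ne'
      _ = ε := ENNReal.add_thirds ε
  obtain ⟨v, hv⟩ := cauchySeq_tendsto_of_complete hC
  refine ⟨v, fun f hf => ?_⟩
  rw [tendsto_iff_edist_tendsto_0] at hv ⊢
  refine tendsto_of_tendsto_of_tendsto_of_le_of_le tendsto_const_nhds ?_ (fun n => zero_le)
    (fun n => (edist_triangle _ (Φ (g n) x) _).trans
      (add_le_add_left (edist_map_apply_le Φ x hh (f n) (g n)) _))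
  simpa using (hf.add hg).add hv

open Classical in
/-- The vector `h(a) x` for a Borel function `h` that is square integrable with respect to the
scalar spectral measure of `x`; it is the limit of `Φ (f n) x` for continuous `f n → h` in `L²`.
The value is `0` if `h` is not square integrable. -/
noncomputable def apply (x : K) (h : X → ℂ) : K :=
  if hh : MemLp h 2 (scalarMeasure Φ x) then (exists_forall_tendsto Φ x hh).choose else 0

theorem tendsto_apply {x : K} {h : X → ℂ} (hh : MemLp h 2 (scalarMeasure Φ x))
    {f : ℕ → C(X, ℂ)}
    (hf : Tendsto (fun n => eLpNorm (⇑(f n) - h) 2 (scalarMeasure Φ x)) atTop (𝓝 0)) :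
    Tendsto (fun n => Φ (f n) x) atTop (𝓝 (apply Φ x h)) := by
  rw [apply, dif_pos hh]
  exact (exists_forall_tendsto Φ x hh).choose_spec f hf

theorem memLp_coe {ν : Measure X} [IsFiniteMeasure ν] (g : C(X, ℂ)) : MemLp g 2 ν :=
  g.continuous.memLp_of_hasCompactSupport (HasCompactSupport.of_compactSpace _)

theorem apply_coe (x : K) (g : C(X, ℂ)) : apply Φ x g = Φ g x :=
  tendsto_nhds_unique (tendsto_apply Φ (memLp_coe g) (f := fun _ => g) (by simp)) tendsto_const_nhds

theorem enorm_apply {x : K} {h : X → ℂ} (hh : MemLp h 2 (scalarMeasure Φ x)) :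
    ‖apply Φ x h‖ₑ = eLpNorm h 2 (scalarMeasure Φ x) := by
  obtain ⟨f, hf⟩ := exists_continuous_tendsto hh
  have h1 : Tendsto (fun n => ‖Φ (f n) x‖ₑ) atTop (𝓝 ‖apply Φ x h‖ₑ) :=
    (continuous_enorm.tendsto _).comp (tendsto_apply Φ hh hf)
  simp only [enorm_map_apply] at h1
  have h2 : ∀ n, AEStronglyMeasurable (f n) (scalarMeasure Φ x) :=
    fun n => (f n).continuous.aestronglyMeasurable
  refine le_antisymm ?_ ?_
  · have h3 : Tendsto (fun n => eLpNorm (⇑(f n) - h) 2 (scalarMeasure Φ x) +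
        eLpNorm h 2 (scalarMeasure Φ x)) atTop (𝓝 (0 + eLpNorm h 2 (scalarMeasure Φ x))) :=
      hf.add tendsto_const_nhds
    rw [zero_add] at h3
    refine le_of_tendsto_of_tendsto' h1 h3 fun n => ?_
    have := eLpNorm_add_le ((h2 n).sub hh.1) hh.1 (p := 2) one_le_two
    simpa using this
  · have h3 : Tendsto (fun n => eLpNorm (⇑(f n) - h) 2 (scalarMeasure Φ x) +
        eLpNorm (f n) 2 (scalarMeasure Φ x)) atTop (𝓝 (0 + ‖apply Φ x h‖ₑ)) :=
      hf.add h1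
    rw [zero_add] at h3
    refine ge_of_tendsto' h3 fun n => ?_
    have := eLpNorm_add_le (hh.1.sub (h2 n)) (h2 n) (p := 2) one_le_two
    rw [eLpNorm_sub_comm h] at this
    simpa using this

theorem apply_sub {x : K} {h k : X → ℂ} (hh : MemLp h 2 (scalarMeasure Φ x))
    (hk : MemLp k 2 (scalarMeasure Φ x)) : apply Φ x (h - k) = apply Φ x h - apply Φ x k := by
  obtain ⟨f, hf⟩ := exists_continuous_tendsto hh
  obtain ⟨g, hg⟩ := exists_continuous_tendsto hk
  have h1 := (tendsto_apply Φ hh hf).sub (tendsto_apply Φ hk hg)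
  refine tendsto_nhds_unique (tendsto_apply Φ (hh.sub hk) (f := fun n => f n - g n) ?_) ?_
  · refine tendsto_of_tendsto_of_tendsto_of_le_of_le tendsto_const_nhds (by simpa using hf.add hg)
      (fun n => zero_le) (fun n => ?_)
    have : (⇑(f n - g n) - (h - k) : X → ℂ) = (⇑(f n) - h) - (⇑(g n) - k) := by
      ext t; simp; ring
    rw [this]
    exact eLpNorm_sub_le ((f n).continuous.aestronglyMeasurable.sub hh.1)
      ((g n).continuous.aestronglyMeasurable.sub hk.1) one_le_two
  · simpa using h1

theorem apply_congr {x : K} {h k : X → ℂ} (hh : MemLp h 2 (scalarMeasure Φ x))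
    (hhk : h =ᵐ[scalarMeasure Φ x] k) : apply Φ x h = apply Φ x k := by
  have hk : MemLp k 2 (scalarMeasure Φ x) := hh.ae_eq hhk
  rw [← sub_eq_zero, ← apply_sub Φ hh hk, ← enorm_eq_zero, enorm_apply Φ (hh.sub hk),
    eLpNorm_eq_zero_iff (hh.sub hk).1 two_ne_zero]
  filter_upwards [hhk] with t ht using by simp [ht]

theorem map_apply_apply {x : K} {h : X → ℂ} (hh : MemLp h 2 (scalarMeasure Φ x)) (g : C(X, ℂ)) :
    MemLp (⇑g * h) 2 (scalarMeasure Φ x) ∧ Φ g (apply Φ x h) = apply Φ x (⇑g * h) := by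
  have hb : ∀ k : X → ℂ, eLpNorm (⇑g * k) 2 (scalarMeasure Φ x)
      ≤ ENNReal.ofReal ‖g‖ * eLpNorm k 2 (scalarMeasure Φ x) := fun k => by
    refine eLpNorm_le_mul_eLpNorm_of_ae_le_mul (Eventually.of_forall fun t => ?_) 2
    rw [Pi.mul_apply, norm_mul]
    gcongr
    exact g.norm_coe_le_norm t
  have hm : MemLp (⇑g * h) 2 (scalarMeasure Φ x) :=
    ⟨g.continuous.aestronglyMeasurable.mul hh.1, (hb h).trans_lt
      (ENNReal.mul_lt_top ENNReal.ofReal_lt_top hh.2)⟩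
  refine ⟨hm, ?_⟩
  obtain ⟨f, hf⟩ := exists_continuous_tendsto hh
  have h1 := ((Φ g).continuous.tendsto _).comp (tendsto_apply Φ hh hf)
  refine tendsto_nhds_unique h1 ?_
  have h2 := tendsto_apply Φ hm (f := fun n => g * f n) ?_
  · simpa [Function.comp_def] using h2
  · refine tendsto_of_tendsto_of_tendsto_of_le_of_le tendsto_const_nhds ?_
      (fun n => zero_le) (fun n => ?_) (h := fun n => ENNReal.ofReal ‖g‖ *
        eLpNorm (⇑(f n) - h) 2 (scalarMeasure Φ x))
    · simpa only [mul_zero] using ENNReal.Tendsto.const_mul hf (Or.inr ENNReal.ofReal_ne_top)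
    · have : (⇑(g * f n) - ⇑g * h : X → ℂ) = ⇑g * (⇑(f n) - h) := by ext t; simp; ring
      rw [this]
      exact hb _

theorem scalarMeasure_apply {x : K} {h : X → ℂ} (hh : MemLp h 2 (scalarMeasure Φ x))
    (hmeas : Measurable h) :
    scalarMeasure Φ (apply Φ x h) = (scalarMeasure Φ x).withDensity fun t => ‖h t‖ₑ ^ 2 := by
  refine ext_of_forall_lintegral_eq_of_IsFiniteMeasure fun g => ?_
  let r : C(X, ℂ) := toComplex ⟨fun t => √(g t), by fun_prop⟩
  have hr : ∀ t, (g t : ℝ≥0∞) = ‖r t‖ₑ ^ 2 := fun t => by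
    simp only [toComplex, r, ContinuousMap.coe_mk]
    rw [← ofReal_norm, ← ENNReal.ofReal_pow (norm_nonneg _), Complex.norm_real, Real.norm_eq_abs,
      sq_abs, Real.sq_sqrt NNReal.zero_le_coe, ENNReal.ofReal_coe_nnreal]
  simp_rw [hr]
  obtain ⟨h1, h2⟩ := map_apply_apply Φ hh r
  rw [lintegral_enorm_sq_scalarMeasure, h2, enorm_apply Φ h1, sq_eLpNorm_two,
    lintegral_withDensity_eq_lintegral_mul _ (by fun_prop) (by fun_prop)]
  refine lintegral_congr fun t => ?_
  simp only [Pi.mul_apply, enorm_mul]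
  ring

theorem scalarMeasure_map_apply (x : K) (g : C(X, ℂ)) :
    scalarMeasure Φ (Φ g x) = (scalarMeasure Φ x).withDensity fun t => ‖g t‖ₑ ^ 2 := by
  rw [← apply_coe]
  exact scalarMeasure_apply Φ (memLp_coe g) g.continuous.measurable

theorem eLpNorm_scalarMeasure_apply {x : K} {h k : X → ℂ}
    (hh : MemLp h 2 (scalarMeasure Φ x)) (hmeas : Measurable h) (hk : Measurable k) :
    eLpNorm k 2 (scalarMeasure Φ (apply Φ x h)) = eLpNorm (k * h) 2 (scalarMeasure Φ x) := by
  refine eLpNorm_two_congr ?_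
  rw [scalarMeasure_apply Φ hh hmeas,
    lintegral_withDensity_eq_lintegral_mul _ (by fun_prop) (by fun_prop)]
  refine lintegral_congr fun t => ?_
  simp only [Pi.mul_apply, enorm_mul]
  ring

theorem apply_apply {x : K} {h k : X → ℂ} (hh : MemLp h 2 (scalarMeasure Φ x))
    (hmeas : Measurable h) (hk : Measurable k) (hkh : MemLp (k * h) 2 (scalarMeasure Φ x)) :
    apply Φ (apply Φ x h) k = apply Φ x (k * h) := by
  have hk' : MemLp k 2 (scalarMeasure Φ (apply Φ x h)) :=
    ⟨hk.aestronglyMeasurable, by rw [eLpNorm_scalarMeasure_apply Φ hh hmeas hk]; exact hkh.2⟩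
  obtain ⟨f, hf⟩ := exists_continuous_tendsto hk'
  have h1 := tendsto_apply Φ hk' hf
  refine tendsto_nhds_unique h1 ?_
  rw [tendsto_iff_edist_tendsto_0]
  refine hf.congr fun n => ?_
  obtain ⟨h2, h3⟩ := map_apply_apply Φ hh (f n)
  rw [h3, edist_eq_enorm_sub, ← apply_sub Φ h2 hkh, enorm_apply Φ (h2.sub hkh),
    eLpNorm_scalarMeasure_apply Φ hh hmeas ((f n).continuous.measurable.sub hk), sub_mul]

end ContinuousCalculus

namespace ContinuousCalculus

open Filter Topology

variable {X : Type*} [MetricSpace X] [CompactSpace X] [MeasurableSpace X] [BorelSpace X]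
  {K : Type u} [NormedAddCommGroup K] [InnerProductSpace ℂ K] [CompleteSpace K]
  (Φ : C(X, ℂ) →⋆ₐ[ℂ] (K →L[ℂ] K))

/-- The indicator function of `s`, with values in `ℂ`. -/
noncomputable def ind (s : Set X) : X → ℂ := s.indicator 1

omit [MetricSpace X] [CompactSpace X] [BorelSpace X] in
theorem measurable_ind {s : Set X} (hs : MeasurableSet s) : Measurable (ind s) :=
  measurable_one.indicator hs

omit [MetricSpace X] [CompactSpace X] [BorelSpace X] in
theorem memLp_ind {s : Set X} (hs : MeasurableSet s) (ν : Measure X) [IsFiniteMeasure ν] :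
    MemLp (ind s) 2 ν :=
  (memLp_const (1 : ℂ)).indicator hs

omit [MetricSpace X] [CompactSpace X] [BorelSpace X] [MeasurableSpace X] in
theorem ind_mul_ind (s t : Set X) : ind s * ind t = ind (s ∩ t) := by
  ext r
  by_cases h : r ∈ s <;> by_cases h' : r ∈ t <;> simp [ind, h, h']

theorem apply_ind_add {s : Set X} (hs : MeasurableSet s) (x y : K) :
    apply Φ (x + y) (ind s) = apply Φ x (ind s) + apply Φ y (ind s) := by
  obtain ⟨f, hf⟩ := exists_continuous_tendsto
    (memLp_ind hs (scalarMeasure Φ x + scalarMeasure Φ y + scalarMeasure Φ (x + y)))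
  have key : ∀ z, scalarMeasure Φ z ≤
      scalarMeasure Φ x + scalarMeasure Φ y + scalarMeasure Φ (x + y) →
      Tendsto (fun n => Φ (f n) z) atTop (𝓝 (apply Φ z (ind s))) := fun z hz =>
    tendsto_apply Φ (memLp_ind hs _) (tendsto_of_tendsto_of_tendsto_of_le_of_le
      tendsto_const_nhds hf (fun n => zero_le) (fun n => eLpNorm_mono_measure _ hz))
  have h1 := key x (by rw [add_assoc]; exact Measure.le_add_right le_rfl)
  have h2 := key y ((Measure.le_add_left le_rfl).trans (Measure.le_add_right le_rfl))
  have h3 := key (x + y) (Measure.le_add_left le_rfl)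
  refine tendsto_nhds_unique h3 ?_
  simpa using h1.add h2

theorem inner_apply_ind {s : Set X} (hs : MeasurableSet s) (x y : K) :
    ⟪apply Φ x (ind s), y⟫_ℂ = ⟪x, apply Φ y (ind s)⟫_ℂ := by
  obtain ⟨f, hf⟩ := exists_continuous_tendsto
    (memLp_ind hs (scalarMeasure Φ x + scalarMeasure Φ y))
  have hstar : ∀ n, eLpNorm (⇑(star (f n)) - ind s) 2 (scalarMeasure Φ x + scalarMeasure Φ y)
      = eLpNorm (⇑(f n) - ind s) 2 (scalarMeasure Φ x + scalarMeasure Φ y) := fun n => by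
    refine eLpNorm_congr_norm_ae (Eventually.of_forall fun t => ?_)
    have : star (ind s t) = ind s t := by by_cases h : t ∈ s <;> simp [ind, h]
    simp only [Pi.sub_apply, ContinuousMap.star_apply]
    rw [← norm_star (f n t - ind s t), star_sub, this]
  have hf' : Tendsto (fun n => eLpNorm (⇑(star (f n)) - ind s) 2
      (scalarMeasure Φ x + scalarMeasure Φ y)) atTop (𝓝 0) := hf.congr fun n => (hstar n).symm
  have h1 := tendsto_apply Φ (memLp_ind hs (scalarMeasure Φ y)) (f := f) (tendsto_of_tendsto_of_tendsto_of_le_of_le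
      tendsto_const_nhds hf (fun n => zero_le)
      (fun n => eLpNorm_mono_measure _ (Measure.le_add_left (le_refl (scalarMeasure Φ y)))))
  have h2 := tendsto_apply Φ (memLp_ind hs (scalarMeasure Φ x)) (f := fun n => star (f n))
    (tendsto_of_tendsto_of_tendsto_of_le_of_le
      tendsto_const_nhds hf' (fun n => zero_le)
      (fun n => eLpNorm_mono_measure _ (Measure.le_add_right (le_refl (scalarMeasure Φ x)))))
  refine tendsto_nhds_unique (h2.inner tendsto_const_nhds) ?_
  refine (Tendsto.inner tendsto_const_nhds h1).congr fun n => ?_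
  rw [map_star, ContinuousLinearMap.star_eq_adjoint, ContinuousLinearMap.adjoint_inner_left]

theorem norm_apply_ind_sq {s : Set X} (hs : MeasurableSet s) (x : K) :
    ‖apply Φ x (ind s)‖ₑ ^ 2 = scalarMeasure Φ x s := by
  rw [enorm_apply Φ (memLp_ind hs _), sq_eLpNorm_two]
  have : ∀ t, ‖ind s t‖ₑ ^ 2 = s.indicator 1 t := fun t => by
    by_cases h : t ∈ s <;> simp [ind, h]
  simp_rw [this]
  exact lintegral_indicator_one hs

theorem apply_ind_univ (x : K) : apply Φ x (ind Set.univ) = x := by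
  have : ind (Set.univ : Set X) = ⇑(1 : C(X, ℂ)) := by ext; simp [ind]
  rw [this, apply_coe, map_one, one_apply_eq_self]

theorem scalarMeasure_univ (x : K) : scalarMeasure Φ x Set.univ = ‖x‖ₑ ^ 2 := by
  rw [← norm_apply_ind_sq Φ MeasurableSet.univ, apply_ind_univ]

theorem norm_apply_ind_le {s : Set X} (hs : MeasurableSet s) (x : K) :
    ‖apply Φ x (ind s)‖ ≤ ‖x‖ := by
  have h : ‖apply Φ x (ind s)‖ₑ ^ 2 ≤ ‖x‖ₑ ^ 2 := by
    rw [norm_apply_ind_sq Φ hs, ← scalarMeasure_univ Φ]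
    exact measure_mono (Set.subset_univ _)
  exact enorm_le_iff_norm_le.1 ((ENNReal.pow_right_strictMono two_ne_zero).le_iff_le.1 h)

theorem map_apply_ind {s : Set X} (hs : MeasurableSet s) (g : C(X, ℂ)) (x : K) :
    apply Φ (Φ g x) (ind s) = Φ g (apply Φ x (ind s)) := by
  obtain ⟨h1, h2⟩ := map_apply_apply Φ (memLp_ind hs (scalarMeasure Φ x)) g
  rw [h2, mul_comm, ← apply_coe, apply_apply Φ (memLp_coe g) g.continuous.measurable
    (measurable_ind hs)]
  rwa [mul_comm]

/-- The spectral projection of a Borel set `s`. -/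
noncomputable def spectralProj {s : Set X} (hs : MeasurableSet s) : K →L[ℂ] K :=
  LinearMap.mkContinuous
    { toFun := fun x => apply Φ x (ind s)
      map_add' := apply_ind_add Φ hs
      map_smul' := fun c x => by
        have h1 : Φ (algebraMap ℂ C(X, ℂ) c) = algebraMap ℂ _ c := AlgHomClass.commutes Φ c
        have h2 := map_apply_ind Φ hs (algebraMap ℂ C(X, ℂ) c) x
        rw [h1] at h2
        simpa [Algebra.algebraMap_eq_smul_one] using h2 } 1
    (fun x => by simpa using norm_apply_ind_le Φ hs x)

theorem spectralProj_apply {s : Set X} (hs : MeasurableSet s) (x : K) :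
    spectralProj Φ hs x = apply Φ x (ind s) := rfl

theorem spectralProj_mul {s t : Set X} (hs : MeasurableSet s) (ht : MeasurableSet t) :
    spectralProj Φ hs * spectralProj Φ ht = spectralProj Φ (hs.inter ht) := by
  ext x
  rw [mul_apply_eq_comp, spectralProj_apply, spectralProj_apply, spectralProj_apply,
    apply_apply Φ (memLp_ind ht _) (measurable_ind ht) (measurable_ind hs), ind_mul_ind]
  rw [ind_mul_ind]
  exact memLp_ind (hs.inter ht) _

theorem isStarProjection_spectralProj {s : Set X} (hs : MeasurableSet s) :
    IsStarProjection (spectralProj Φ hs) := by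
  refine ⟨?_, ?_⟩
  · have := spectralProj_mul Φ hs hs
    simp only [Set.inter_self] at this
    exact this
  · rw [ContinuousLinearMap.isSelfAdjoint_iff_isSymmetric]
    exact fun x y => inner_apply_ind Φ hs x y

omit [MetricSpace X] [CompactSpace X] [BorelSpace X] [MeasurableSpace X] in
theorem ind_add_of_disjoint {s t : Set X} (h : Disjoint s t) : ind s + ind t = ind (s ∪ t) :=
  (Set.indicator_union_of_disjoint h _).symm

theorem hasSum_spectralProj {f : ℕ → Set X} (hf : ∀ n, MeasurableSet (f n))
    (hd : Pairwise fun m n => Disjoint (f m) (f n)) (x : K) :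
    HasSum (fun n => spectralProj Φ (hf n) x)
      (spectralProj Φ (MeasurableSet.iUnion hf) x) := by
  classical
  have hfin : ∀ s : Finset ℕ, ∑ n ∈ s, spectralProj Φ (hf n) x
      = apply Φ x (ind (⋃ n ∈ s, f n)) := fun s => by
    induction s using Finset.induction_on with
    | empty =>
      have : (ind (∅ : Set X)) = ⇑(0 : C(X, ℂ)) := by ext; simp [ind]
      rw [Finset.sum_empty]
      simp only [Finset.notMem_empty, Set.iUnion_of_empty, Set.iUnion_empty, this]
      rw [apply_coe, map_zero, zero_apply]
    | insert i s hi ih =>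
      have hm : MeasurableSet (⋃ n ∈ s, f n) := s.measurableSet_biUnion fun n _ => hf n
      have hdj : Disjoint (f i) (⋃ n ∈ s, f n) := by
        rw [Set.disjoint_iUnion₂_right]
        exact fun n hn => hd (by rintro rfl; exact hi hn)
      rw [Finset.sum_insert hi, ih, Finset.set_biUnion_insert, ← ind_add_of_disjoint hdj,
        spectralProj_apply]
      have h1 := apply_sub Φ ((memLp_ind (hf i) (scalarMeasure Φ x)).add (memLp_ind hm _))
        (memLp_ind hm _)
      rw [add_sub_cancel_right] at h1
      rw [h1, sub_add_cancel]
  rw [HasSum, SummationFilter.unconditional_filter]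
  simp_rw [hfin]
  rw [tendsto_iff_edist_tendsto_0, spectralProj_apply]
  have hU : MeasurableSet (⋃ n, f n) := MeasurableSet.iUnion hf
  have hμ : Tendsto (fun s : Finset ℕ => scalarMeasure Φ x ((⋃ n, f n) \ ⋃ n ∈ s, f n)) atTop (𝓝 0) := by
    have h0 : ⋂ s : Finset ℕ, ((⋃ n, f n) \ ⋃ n ∈ s, f n) = ∅ := by
      ext t
      simp only [Set.mem_iInter, Set.mem_sdiff, Set.mem_iUnion, Set.mem_empty_iff_false, iff_false]
      intro h
      obtain ⟨⟨n, hn⟩, -⟩ := h ∅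
      exact (h {n}).2 ⟨n, by simp, hn⟩
    have := tendsto_measure_iInter_atTop (μ := scalarMeasure Φ x)
      (s := fun s : Finset ℕ => (⋃ n, f n) \ ⋃ n ∈ s, f n)
      (fun s => (hU.diff (s.measurableSet_biUnion fun n _ => hf n)).nullMeasurableSet)
      (fun s t hst => Set.sdiff_subset_sdiff_right (Set.biUnion_subset_biUnion_left hst))
      ⟨∅, measure_ne_top _ _⟩
    rwa [h0, measure_empty] at this
  have hsq : ∀ s : Finset ℕ, edist (apply Φ x (ind (⋃ n ∈ s, f n))) (apply Φ x (ind (⋃ n, f n))) ^ 2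
      = scalarMeasure Φ x ((⋃ n, f n) \ ⋃ n ∈ s, f n) := fun s => by
    have hm : MeasurableSet (⋃ n ∈ s, f n) := s.measurableSet_biUnion fun n _ => hf n
    have hdec : ind (⋃ n, f n) - ind (⋃ n ∈ s, f n) = ind ((⋃ n, f n) \ ⋃ n ∈ s, f n) := by
      rw [sub_eq_iff_eq_add, ind_add_of_disjoint Set.disjoint_sdiff_left,
        Set.sdiff_union_of_subset (Set.iUnion₂_subset fun n _ => Set.subset_iUnion f n)]
    rw [edist_comm, edist_eq_enorm_sub, ← apply_sub Φ (memLp_ind hU _) (memLp_ind hm _), hdec,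
      norm_apply_ind_sq Φ (hU.diff hm)]
  simp_rw [← hsq] at hμ
  rw [ENNReal.tendsto_nhds_zero] at hμ ⊢
  intro ε hε
  filter_upwards [hμ (ε ^ 2) (pos_iff_ne_zero.2 (pow_ne_zero 2 hε.ne'))] with s hs
  exact (ENNReal.pow_right_strictMono two_ne_zero).le_iff_le.1 hs

open Classical in
/-- The projection valued measure on `ℝ` obtained by pushing the spectral measure forward along a
Borel function `τ`; it takes the value `0` at sets that are not Borel. -/
noncomputable def pvm {τ : X → ℝ} (hτ : Measurable τ) : ProjectionValuedMeasure K where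
  proj s := if hs : MeasurableSet s then spectralProj Φ (hτ hs) else 0
  isStarProjection s hs := by
    rw [dif_pos hs]; exact isStarProjection_spectralProj Φ _
  univ := by
    rw [dif_pos MeasurableSet.univ]
    ext x
    exact apply_ind_univ Φ x
  inter s t hs ht := by
    rw [dif_pos hs, dif_pos ht, dif_pos (hs.inter ht), spectralProj_mul]
    rfl
  hasSum_iUnion f hf hd x := by
    rw [dif_pos (MeasurableSet.iUnion hf)]
    have h1 := hasSum_spectralProj Φ (fun n => hτ (hf n))
      (fun m n hmn => (hd hmn).preimage τ) x
    have h2 : ∀ n, (if hs : MeasurableSet (f n) then spectralProj Φ (hτ hs) else 0) x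
        = spectralProj Φ (hτ (hf n)) x := fun n => by rw [dif_pos (hf n)]
    have h3 : spectralProj Φ (hτ (MeasurableSet.iUnion hf)) x
        = spectralProj Φ (MeasurableSet.iUnion fun n => hτ (hf n)) x := by
      simp only [spectralProj_apply, Set.preimage_iUnion]
    rw [h3, funext h2]
    exact h1

theorem diag_pvm {τ : X → ℝ} (hτ : Measurable τ) (x : K) :
    (pvm Φ hτ).diag x = (scalarMeasure Φ x).map τ := by
  ext s hs
  rw [ProjectionValuedMeasure.diag_apply _ _ hs, Measure.map_apply hτ hs,
    ← norm_apply_ind_sq Φ (hτ hs), ENNReal.ofReal_pow (norm_nonneg _), ofReal_norm]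
  simp only [pvm, dif_pos hs]
  rfl

end ContinuousCalculus

/-! ### The inverse Cayley transform of a unitary operator -/

namespace InverseCayley

open Filter Topology

variable {K : Type u} [NormedAddCommGroup K] [InnerProductSpace ℂ K] [CompleteSpace K]
  {U : K →L[ℂ] K}

/-- The operator `i (1 + U) (1 - U)⁻¹` with domain the range of `1 - U`. -/
noncomputable def op (U : K →L[ℂ] K) (hinj : Function.Injective (1 - U : K →L[ℂ] K)) :
    K →ₗ.[ℂ] K where
  domain := (1 - U : K →L[ℂ] K).toLinearMap.range
  toFun := (Complex.I • (1 + U) : K →L[ℂ] K).toLinearMap ∘ₗ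
    (LinearEquiv.ofInjective (1 - U : K →L[ℂ] K).toLinearMap hinj).symm.toLinearMap

variable {hinj : Function.Injective (1 - U : K →L[ℂ] K)}

omit [CompleteSpace K] in
theorem mem_domain (y : K) : y - U y ∈ (op U hinj).domain := ⟨y, rfl⟩

omit [CompleteSpace K] in
theorem op_apply (x : (op U hinj).domain) {y : K} (h : y - U y = x) :
    op U hinj x = Complex.I • (y + U y) := by
  have h1 : (LinearEquiv.ofInjective (1 - U : K →L[ℂ] K).toLinearMap hinj).symm x = y :=
    (LinearEquiv.symm_apply_eq _).2 (Subtype.ext h.symm)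
  change (Complex.I • (1 + U) : K →L[ℂ] K)
    ((LinearEquiv.ofInjective (1 - U : K →L[ℂ] K).toLinearMap hinj).symm x) = _
  rw [h1]
  rfl

omit [CompleteSpace K] in
theorem exists_eq (x : (op U hinj).domain) : ∃ y, y - U y = x := x.2

omit [CompleteSpace K] in
theorem injective_one_sub (h : ∀ x, U x = x → x = 0) :
    Function.Injective (1 - U : K →L[ℂ] K) := by
  rw [injective_iff_map_eq_zero]
  intro x hx
  refine h x ?_
  have : x - U x = 0 := hx
  exact (sub_eq_zero.1 this).symm

section Unitary

variable (hU : U ∈ unitary (K →L[ℂ] K))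

include hU in
theorem adjoint_apply_apply (x : K) : U.adjoint (U x) = x := by
  have := congrArg (fun T : K →L[ℂ] K => T x) hU.1
  simpa [ContinuousLinearMap.star_eq_adjoint] using this

include hU in
theorem apply_adjoint_apply (x : K) : U (U.adjoint x) = x := by
  have := congrArg (fun T : K →L[ℂ] K => T x) hU.2
  simpa [ContinuousLinearMap.star_eq_adjoint] using this

include hU hinj in
theorem eq_zero_of_adjoint_apply_eq {x : K} (h : U.adjoint x = x) : x = 0 := by
  have h1 : U x = x := by conv_lhs => rw [← h, apply_adjoint_apply hU]
  exact hinj (by simp [h1])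

include hU in
theorem dense_domain : Dense ((op U hinj).domain : Set K) := by
  rw [Submodule.dense_iff_topologicalClosure_eq_top, Submodule.topologicalClosure_eq_top_iff,
    Submodule.eq_bot_iff]
  intro k hk
  refine eq_zero_of_adjoint_apply_eq hU (hinj := hinj) (ext_inner_left ℂ fun y => ?_)
  have h1 := (Submodule.mem_orthogonal _ _).1 hk _ (mem_domain y)
  rw [inner_sub_left, sub_eq_zero] at h1
  rw [ContinuousLinearMap.adjoint_inner_right, h1]

include hU in
theorem isFormalAdjoint_op : (op U hinj).IsFormalAdjoint (op U hinj) := by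
  intro x y
  obtain ⟨a, ha⟩ := exists_eq x
  obtain ⟨b, hb⟩ := exists_eq y
  have hab : ⟪U a, U b⟫_ℂ = ⟪a, b⟫_ℂ := by
    rw [← ContinuousLinearMap.adjoint_inner_right, adjoint_apply_apply hU]
  rw [op_apply x ha, op_apply y hb, ← ha, ← hb]
  simp only [inner_sub_left, inner_sub_right, inner_add_left, inner_add_right, inner_smul_left,
    inner_smul_right, hab, Complex.conj_I]
  ring

include hU in
theorem isSelfAdjoint_op : IsSelfAdjoint (op U hinj) := by
  rw [LinearPMap.isSelfAdjoint_def]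
  have hd := dense_domain hU (hinj := hinj)
  have hle : op U hinj ≤ (op U hinj).adjoint :=
    LinearPMap.IsFormalAdjoint.le_adjoint hd (isFormalAdjoint_op hU)
  refine (LinearPMap.eq_of_le_of_domain_eq hle (le_antisymm hle.1 fun x hx => ?_)).symm
  set w := (op U hinj).adjoint ⟨x, hx⟩ with hw
  have h1 : w - U.adjoint w = - (Complex.I • (x + U.adjoint x)) := by
    refine ext_inner_right ℂ fun y => ?_
    have h2 := LinearPMap.adjoint_isFormalAdjoint hd ⟨x, hx⟩ ⟨y - U y, mem_domain y⟩
    rw [op_apply (y := y) _ rfl, ← hw] at h2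
    simp only [inner_sub_left, inner_sub_right, inner_add_left, inner_add_right, inner_smul_left,
      inner_smul_right, inner_neg_left, ContinuousLinearMap.adjoint_inner_left,
      Complex.conj_I] at h2 ⊢
    rw [h2]; ring
  have h3 : U w - w = - (Complex.I • (U x + x)) := by
    have := congrArg U h1
    simpa [apply_adjoint_apply hU] using this
  refine ⟨(2 * Complex.I)⁻¹ • (w + Complex.I • x), ?_⟩
  have h4 : (w + Complex.I • x) - U (w + Complex.I • x) = (2 * Complex.I) • x := by
    rw [map_add, map_smul]
    have h5 : U w = w - Complex.I • (U x + x) := by rw [sub_eq_add_neg, ← h3]; abel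
    rw [h5]; module
  change (2 * Complex.I)⁻¹ • (w + Complex.I • x) - U ((2 * Complex.I)⁻¹ • (w + Complex.I • x)) = x
  rw [map_smul, ← smul_sub, h4, smul_smul, inv_mul_cancel₀ (by simp), one_smul]

end Unitary

/-! #### The spectral measure of the inverse Cayley transform -/

section Spectral

open ContinuousCalculus

variable (hU : U ∈ unitary (K →L[ℂ] K))

/-- The real number `i (1 + ζ) / (1 - ζ)` for `ζ ≠ 1` on the unit circle, and `0` for `ζ = 1`. -/
noncomputable def cayleyRe (ζ : spectrum ℂ U) : ℝ :=
  (Complex.I * (1 + (ζ : ℂ)) / (1 - (ζ : ℂ))).re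

omit [CompleteSpace K] in
theorem measurable_cayleyRe : Measurable (cayleyRe (U := U)) := by
  unfold cayleyRe
  exact Complex.measurable_re.comp (by fun_prop)

include hU in
theorem conj_mul_self_spectrum (ζ : spectrum ℂ U) :
    (starRingEnd ℂ) (ζ : ℂ) * (ζ : ℂ) = 1 := by
  have h := spectrum.subset_circle_of_unitary hU ζ.2
  rw [mem_sphere_zero_iff_norm] at h
  rw [RCLike.conj_mul, h]
  simp

include hU in
/-- On the circle the quotient defining `cayleyRe` is real. -/
theorem cayleyRe_mul (ζ : spectrum ℂ U) (hζ : (ζ : ℂ) ≠ 1) :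
    (cayleyRe ζ : ℂ) * (1 - (ζ : ℂ)) = Complex.I * (1 + (ζ : ℂ)) := by
  have h0 : (1 - (ζ : ℂ)) ≠ 0 := sub_ne_zero.2 hζ.symm
  have hc := conj_mul_self_spectrum hU ζ
  have hc0 : (starRingEnd ℂ) (1 - (ζ : ℂ)) ≠ 0 := (map_ne_zero _).2 h0
  have hre : (starRingEnd ℂ) (Complex.I * (1 + (ζ : ℂ)) / (1 - (ζ : ℂ)))
      = Complex.I * (1 + (ζ : ℂ)) / (1 - (ζ : ℂ)) := by
    rw [map_div₀, div_eq_div_iff hc0 h0]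
    simp only [map_mul, map_add, map_sub, map_one, Complex.conj_I]
    linear_combination (2 * Complex.I) * hc
  rw [cayleyRe, Complex.conj_eq_iff_re.1 hre, div_mul_cancel₀ _ h0]

/-- The continuous functional calculus of a unitary operator. -/
noncomputable abbrev calculus : C(spectrum ℂ U, ℂ) →⋆ₐ[ℂ] (K →L[ℂ] K) :=
  cfcHom (R := ℂ) (p := IsStarNormal) (a := U) (isStarNormal_of_mem_unitary hU)

/-- The coordinate function on the spectrum. -/
def coord : C(spectrum ℂ U, ℂ) := ⟨fun ζ => (ζ : ℂ), continuous_subtype_val⟩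

theorem calculus_coord : calculus hU coord = U :=
  cfcHom_id (R := ℂ) (p := IsStarNormal) (isStarNormal_of_mem_unitary hU)

/-- The spectral measure of the inverse Cayley transform. -/
noncomputable def pvm : ProjectionValuedMeasure K :=
  ContinuousCalculus.pvm (calculus hU) measurable_cayleyRe

include hinj in
/-- The point `1` carries no spectral mass, as `1` is not an eigenvalue. -/
theorem scalarMeasure_one (x : K) :
    scalarMeasure (calculus hU) x {ζ | (ζ : ℂ) = 1} = 0 := by
  have hs : MeasurableSet {ζ : spectrum ℂ U | (ζ : ℂ) = 1} :=
    (isClosed_eq continuous_subtype_val continuous_const).measurableSet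
  have h1 := (map_apply_apply (calculus hU) (memLp_ind hs (scalarMeasure (calculus hU) x)) coord).2
  have h2 : ⇑(coord (U := U)) * ind {ζ : spectrum ℂ U | (ζ : ℂ) = 1}
      = ind {ζ : spectrum ℂ U | (ζ : ℂ) = 1} := by
    ext ζ
    by_cases h : (ζ : ℂ) = 1 <;> simp [ind, coord, h]
  rw [h2, calculus_coord] at h1
  have h3 : apply (calculus hU) x (ind {ζ : spectrum ℂ U | (ζ : ℂ) = 1}) = 0 :=
    hinj (by simp [h1])
  rw [← norm_apply_ind_sq _ hs, h3]
  simp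

/-- A vector `x` with finite second moment is `(1 - U) y` with `y = (1 - ζ)⁻¹(U) x`; the function
`(1 - ζ)⁻¹` is square integrable as `4 |1 - ζ|⁻² = 1 + t²`. -/
theorem exists_mem_of_lintegral_lt_top (x : K)
    (hx : ∫⁻ ζ, ENNReal.ofReal (cayleyRe ζ ^ 2) ∂(scalarMeasure (calculus hU) x) < ∞) :
    x ∈ (op U hinj).domain := by
  let h : spectrum ℂ U → ℂ := fun ζ => (1 - (ζ : ℂ))⁻¹
  have hmeas : Measurable h := by fun_prop
  have hbd : ∀ ζ, ‖h ζ‖ₑ ^ 2 ≤ 1 + ENNReal.ofReal (cayleyRe ζ ^ 2) := fun ζ => by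
    have : ‖h ζ‖ ^ 2 ≤ 1 + cayleyRe ζ ^ 2 := by
      by_cases hζ : (ζ : ℂ) = 1
      · simp only [h, hζ, sub_self, inv_zero, norm_zero]; nlinarith [sq_nonneg (cayleyRe ζ)]
      · have h0 : (1 - (ζ : ℂ)) ≠ 0 := sub_ne_zero.2 (Ne.symm hζ)
        have e1 := cayleyRe_mul hU ζ hζ
        -- `2 = (1 - ζ) + (1 + ζ) = (1 - i t) (1 - ζ)`
        have e2 : h ζ = (1 - Complex.I * cayleyRe ζ) / 2 := by
          simp only [h]
          rw [inv_eq_one_div, div_eq_div_iff h0 two_ne_zero]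
          linear_combination (Complex.I) * e1 + (1 + (ζ : ℂ)) * Complex.I_sq
        have e3 : ‖h ζ‖ ^ 2 = (1 + cayleyRe ζ ^ 2) / 4 := by
          rw [e2, norm_div, div_pow, ← Complex.normSq_eq_norm_sq]
          simp [Complex.normSq_apply]
          ring
        rw [e3]
        nlinarith [sq_nonneg (cayleyRe ζ)]
    rw [← ofReal_norm, ← ENNReal.ofReal_pow (norm_nonneg _), ← ENNReal.ofReal_one,
      ← ENNReal.ofReal_add zero_le_one (sq_nonneg _)]
    exact ENNReal.ofReal_le_ofReal this
  have hL : MemLp h 2 (scalarMeasure (calculus hU) x) := by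
    refine ⟨hmeas.aestronglyMeasurable, ?_⟩
    have : eLpNorm h 2 (scalarMeasure (calculus hU) x) ^ 2 < ∞ := by
      rw [sq_eLpNorm_two]
      refine (lintegral_mono hbd).trans_lt ?_
      rw [lintegral_add_left measurable_const]
      refine ENNReal.add_lt_top.2 ⟨?_, hx⟩
      simp
    by_contra hcon
    rw [not_lt_top_iff.1 hcon] at this
    simp at this
  obtain ⟨h1, h2⟩ := map_apply_apply (calculus hU) hL (1 - coord)
  refine ⟨apply (calculus hU) x h, ?_⟩
  have h3 : (1 - U : K →L[ℂ] K) = calculus hU (1 - coord) := by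
    rw [map_sub, map_one, calculus_coord]
  change (1 - U : K →L[ℂ] K) _ = x
  rw [h3, h2]
  have h4 : (⇑(1 - coord : C(spectrum ℂ U, ℂ)) * h)
      =ᵐ[scalarMeasure (calculus hU) x] ⇑(1 : C(spectrum ℂ U, ℂ)) := by
    have h5 := scalarMeasure_one hU (hinj := hinj) x
    rw [measure_eq_zero_iff_ae_notMem] at h5
    filter_upwards [h5] with ζ hζ
    have h0 : (1 - (ζ : ℂ)) ≠ 0 := sub_ne_zero.2 (Ne.symm hζ)
    simp [h, coord, h0]
  rw [apply_congr _ h1 h4, apply_coe, map_one, one_apply_eq_self]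

include hU in
theorem conj_one_sub_mul (ζ : spectrum ℂ U) : (starRingEnd ℂ) (1 - (ζ : ℂ)) *
    (Complex.I * (1 + (ζ : ℂ))) = ((-2 * (ζ : ℂ).im : ℝ) : ℂ) := by
  have hc := conj_mul_self_spectrum hU ζ
  have : (ζ : ℂ) - (starRingEnd ℂ) (ζ : ℂ) = 2 * (ζ : ℂ).im * Complex.I := by
    rw [Complex.sub_conj]; push_cast; ring
  simp only [map_sub, map_one]
  push_cast
  linear_combination -Complex.I * hc + Complex.I * this + 2 * ((ζ : ℂ).im : ℂ) * Complex.I_sq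

theorem calculus_one_sub : calculus hU (1 - coord) = 1 - U := by
  rw [map_sub, map_one, calculus_coord]

/-- Vectors of the form `(1 - U) y` have finite second moment, as `t (1 - ζ) = i (1 + ζ)` is
bounded. -/
theorem lintegral_lt_top (y : K) :
    ∫⁻ ζ, ENNReal.ofReal (cayleyRe ζ ^ 2)
      ∂(scalarMeasure (calculus hU) ((1 - U : K →L[ℂ] K) y)) < ∞ := by
    have hm : Measurable fun ζ : spectrum ℂ U => ENNReal.ofReal (cayleyRe ζ ^ 2) :=
      (measurable_cayleyRe.pow_const 2).ennreal_ofReal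
    rw [← calculus_one_sub hU, scalarMeasure_map_apply, lintegral_withDensity_eq_lintegral_mul _ (by fun_prop) hm]
    have hlt : ∫⁻ ζ, ‖(1 + coord : C(spectrum ℂ U, ℂ)) ζ‖ₑ ^ 2 ∂(scalarMeasure (calculus hU) y)
        < ∞ := by
      rw [lintegral_enorm_sq_scalarMeasure]
      exact ENNReal.pow_lt_top enorm_lt_top
    refine (lintegral_mono fun ζ => ?_).trans_lt hlt
    simp only [Pi.mul_apply, coord, ContinuousMap.sub_apply, ContinuousMap.one_apply,
      ContinuousMap.coe_mk, ContinuousMap.add_apply]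
    by_cases hζ : (ζ : ℂ) = 1
    · simp [hζ]
    · have e1 := congrArg (fun w : ℂ => ‖w‖ₑ ^ 2) (cayleyRe_mul hU ζ hζ)
      simp only [enorm_mul] at e1
      rw [mul_pow, mul_pow] at e1
      have e2 : ‖(cayleyRe ζ : ℂ)‖ₑ ^ 2 = ENNReal.ofReal (cayleyRe ζ ^ 2) := by
        rw [← ofReal_norm, ← ENNReal.ofReal_pow (norm_nonneg _), Complex.norm_real,
          Real.norm_eq_abs, sq_abs]
      have e3 : ‖Complex.I‖ₑ = 1 := by rw [← ofReal_norm]; simp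
      rw [e2, e3, one_pow, one_mul, mul_comm] at e1
      exact e1.le

/-- The continuous function `-2 Im ζ = Re (conj (1 - ζ) i (1 + ζ))` on the spectrum. -/
def negTwoIm : C(spectrum ℂ U, ℝ) := ⟨fun ζ => -2 * (ζ : ℂ).im, by fun_prop⟩

include hU in
theorem star_mul_eq_toComplex :
    star (1 - coord) * (Complex.I • (1 + coord)) = toComplex (negTwoIm (U := U)) := by
  ext ζ
  have h := conj_one_sub_mul hU ζ
  simpa [coord, negTwoIm, toComplex] using h

theorem inner_eq_inner_calculus (y : K) :
    ⟪y - U y, Complex.I • (y + U y)⟫_ℂ = ⟪y, calculus hU (toComplex negTwoIm) y⟫_ℂ := by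
  have h4 : calculus hU (Complex.I • (1 + coord)) = Complex.I • (1 + U) := by
    rw [map_smul, map_add, map_one, calculus_coord]
  rw [← star_mul_eq_toComplex hU, inner_map_star_mul, calculus_one_sub, h4]
  rfl

theorem inner_calculus_eq_integral (y : K) (g : C(spectrum ℂ U, ℝ)) :
    ⟪y, calculus hU (toComplex g) y⟫_ℂ = ((∫ ζ, g ζ ∂(scalarMeasure (calculus hU) y) : ℝ) : ℂ) := by
  have hg : star (toComplex g) = toComplex g := by
    ext ζ; simp [toComplex]
  rw [integral_scalarMeasure]
  refine (Complex.conj_eq_iff_re.1 ?_).symm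
  rw [inner_conj_symm]
  conv_rhs => rw [← hg, map_star, ContinuousLinearMap.star_eq_adjoint,
    ContinuousLinearMap.adjoint_inner_right]

include hU in
theorem normSq_mul_cayleyRe (ζ : spectrum ℂ U) :
    ‖1 - (ζ : ℂ)‖ ^ 2 * cayleyRe ζ = negTwoIm ζ := by
  change _ = -2 * (ζ : ℂ).im
  by_cases hζ : (ζ : ℂ) = 1
  · simp [hζ]
  · have e1 := conj_one_sub_mul hU ζ
    rw [← cayleyRe_mul hU ζ hζ, mul_left_comm, RCLike.conj_mul] at e1
    have e2 : cayleyRe ζ * ‖1 - (ζ : ℂ)‖ ^ 2 = -2 * (ζ : ℂ).im := by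
      refine Complex.ofReal_injective ?_
      rw [Complex.ofReal_mul, Complex.ofReal_pow]
      exact e1
    rw [← e2, mul_comm]

theorem inner_eq_integral (y : K) :
    ⟪y - U y, Complex.I • (y + U y)⟫_ℂ = ((∫ ζ, cayleyRe ζ
      ∂(scalarMeasure (calculus hU) ((1 - U : K →L[ℂ] K) y)) : ℝ) : ℂ) := by
  have hm : Measurable fun ζ : spectrum ℂ U => ‖(1 - coord : C(spectrum ℂ U, ℂ)) ζ‖ₑ ^ 2 :=
    (1 - coord : C(spectrum ℂ U, ℂ)).continuous.measurable.enorm.pow_const 2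
  rw [inner_eq_inner_calculus hU, inner_calculus_eq_integral, ← calculus_one_sub hU,
    scalarMeasure_map_apply, integral_withDensity_eq_integral_toReal_smul hm
      (Eventually.of_forall fun ζ => ENNReal.pow_lt_top enorm_lt_top)]
  refine congrArg Complex.ofReal (integral_congr_ae (Eventually.of_forall fun ζ => ?_))
  change negTwoIm ζ = (‖1 - (ζ : ℂ)‖ₑ ^ 2).toReal * cayleyRe ζ
  rw [ENNReal.toReal_pow, toReal_enorm, normSq_mul_cayleyRe hU]

theorem isSpectralMeasureOf_op : (pvm hU).IsSpectralMeasureOf (op U hinj) where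
  mem_domain_iff x := by
    rw [pvm, diag_pvm, lintegral_map (by fun_prop) measurable_cayleyRe]
    refine ⟨?_, exists_mem_of_lintegral_lt_top hU x⟩
    rintro ⟨y, rfl⟩
    exact lintegral_lt_top hU y
  inner_apply x := by
    obtain ⟨y, hy⟩ := exists_eq x
    rw [op_apply x hy, ← hy, pvm, diag_pvm,
      integral_map measurable_cayleyRe.aemeasurable (by fun_prop)]
    exact inner_eq_integral hU y

end Spectral

end InverseCayley

/-! ### From a unitary dilation of the Cayley transform to a self-adjoint dilation -/

section PowerSeries

open Filter Topology

/-- The constant term is isolated by letting the variable tend to zero from the right. -/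
theorem zeroth_eq_zero_of_forall_hasSum_pow {M : ℝ} {a : ℕ → ℂ} (hM : ∀ n, ‖a n‖ ≤ M)
    (h : ∀ q : ℝ, 0 < q → q < 1 → HasSum (fun n => (q : ℂ) ^ n * a n) 0) : a 0 = 0 := by
  have hb : ∀ q : ℝ, 0 < q → q < 1 → ‖a 0‖ ≤ q * (M * (1 - q)⁻¹) := fun q hq hq1 => by
    have h1 := (hasSum_nat_add_iff' 1).2 (h q hq hq1)
    simp only [Finset.range_one, Finset.sum_singleton, pow_zero, one_mul, zero_sub] at h1
    have h2 : HasSum (fun n : ℕ => q * (M * q ^ n)) (q * (M * (1 - q)⁻¹)) :=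
      ((hasSum_geometric_of_lt_one hq.le hq1).mul_left M).mul_left q
    have h3 := tsum_of_norm_bounded h2 (f := fun n => (q : ℂ) ^ (n + 1) * a (n + 1)) fun n => by
      rw [norm_mul, norm_pow, Complex.norm_real, Real.norm_eq_abs, abs_of_pos hq]
      calc q ^ (n + 1) * ‖a (n + 1)‖ ≤ q ^ (n + 1) * M := by gcongr; exact hM _
        _ = _ := by ring
    rwa [h1.tsum_eq, norm_neg] at h3
  have hlim : Tendsto (fun q : ℝ => q * (M * (1 - q)⁻¹)) (𝓝[>] 0) (𝓝 (0 * (M * (1 - 0)⁻¹))) := by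
    refine Tendsto.mono_left ?_ nhdsWithin_le_nhds
    have : ContinuousAt (fun q : ℝ => q * (M * (1 - q)⁻¹)) 0 := by
      refine continuousAt_id.mul (continuousAt_const.mul (ContinuousAt.inv₀ ?_ (by norm_num)))
      fun_prop
    exact this
  rw [zero_mul] at hlim
  refine norm_le_zero_iff.1 (ge_of_tendsto hlim ?_)
  filter_upwards [Ioo_mem_nhdsGT (zero_lt_one' ℝ)] with q hq using hb q hq.1 hq.2

/-- A bounded sequence whose power series vanishes on `(0, 1)` is zero. -/
theorem eq_zero_of_forall_hasSum_pow {M : ℝ} {a : ℕ → ℂ} (hM : ∀ n, ‖a n‖ ≤ M)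
    (h : ∀ q : ℝ, 0 < q → q < 1 → HasSum (fun n => (q : ℂ) ^ n * a n) 0) (n : ℕ) : a n = 0 := by
  have h0 := zeroth_eq_zero_of_forall_hasSum_pow hM h
  induction n generalizing a with
  | zero => exact h0
  | succ n ih =>
    have hs : ∀ q : ℝ, 0 < q → q < 1 → HasSum (fun n => (q : ℂ) ^ n * a (n + 1)) 0 :=
      fun q hq hq1 => by
        have h1 := (hasSum_nat_add_iff' 1).2 (h q hq hq1)
        simp only [Finset.range_one, Finset.sum_singleton, pow_zero, one_mul, zero_sub, h0,
          neg_zero] at h1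
        have h2 := h1.mul_left ((q : ℂ)⁻¹)
        have hq0 : (q : ℂ) ≠ 0 := by exact_mod_cast hq.ne'
        rw [mul_zero] at h2
        refine h2.congr_fun fun n => ?_
        rw [pow_succ']
        field_simp
    exact ih (a := fun n => a (n + 1)) (fun n => hM _) hs
      (zeroth_eq_zero_of_forall_hasSum_pow (a := fun n => a (n + 1)) (fun n => hM _) hs)

end PowerSeries

namespace InverseCayley

open Filter Topology

variable {K : Type u} [NormedAddCommGroup K] [InnerProductSpace ℂ K] [CompleteSpace K]

/-- The Neumann series: for a contraction `W` and `‖q‖ < 1` the vector `s = ∑ qⁿ Wⁿ v` solves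
`(1 - q W) s = v`. -/
theorem exists_hasSum_geometric {W : K →L[ℂ] K} (hW : ‖W‖ ≤ 1) {q : ℂ} (hq : ‖q‖ < 1) (v : K) :
    ∃ s : K, HasSum (fun n : ℕ => q ^ n • (W ^ n) v) s ∧ s - q • W s = v := by
  have hn : ‖q • W‖ < 1 := by
    rw [norm_smul]
    calc ‖q‖ * ‖W‖ ≤ ‖q‖ * 1 := by gcongr
      _ < 1 := by simpa using hq
  have h1 := (summable_geometric_of_norm_lt_one hn).hasSum
  have h2 := (ContinuousLinearMap.apply ℂ K v).hasSum h1
  refine ⟨(∑' n : ℕ, (q • W) ^ n) v, ?_, ?_⟩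
  · simpa [smul_pow] using h2
  · have h3 := congrArg (fun S : K →L[ℂ] K => S v) (mul_neg_geom_series (q • W) hn)
    simpa [sub_mul] using h3

variable {U : K →L[ℂ] K} {hinj : Function.Injective (1 - U : K →L[ℂ] K)}

omit [CompleteSpace K] in
/-- The resolvent of the inverse Cayley transform in the lower half-plane: `(L - z)⁻¹ v` is a
multiple of `(1 - U) (1 - q U)⁻¹ v`. -/
theorem resolvent_lower {z q : ℂ} (hz : Complex.I - z ≠ 0) (hq : q * (Complex.I - z) = -(Complex.I + z))
    {s v : K} (hs : s - q • U s = v) :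
    ∃ y : (op U hinj).domain, op U hinj y - z • (y : K) = v ∧
      (y : K) = (Complex.I - z)⁻¹ • (s - U s) := by
  set s' := (Complex.I - z)⁻¹ • s with hs'
  have hU' : U s' = (Complex.I - z)⁻¹ • U s := map_smul _ _ _
  refine ⟨⟨s' - U s', mem_domain s'⟩, ?_, ?_⟩
  · rw [op_apply (y := s') _ rfl]
    change Complex.I • (s' + U s') - z • (s' - U s') = v
    rw [hU', hs', ← hs]
    have h1 : (Complex.I - z)⁻¹ * (Complex.I - z) = 1 := inv_mul_cancel₀ hz
    have h2 : q = -(Complex.I + z) * (Complex.I - z)⁻¹ := by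
      rw [← hq, mul_assoc, mul_inv_cancel₀ hz, mul_one]
    rw [h2]
    simp only [← smul_sub, ← smul_add, smul_smul]
    match_scalars
    · linear_combination h1
    · ring
  · change s' - U s' = _
    rw [hU', hs', smul_sub]

/-- The resolvent of the inverse Cayley transform at the point `i (1 + q) / (1 - q)` of the upper
half-plane, expressed through the inverse of `U`. -/
theorem resolvent_upper (hU : U ∈ unitary (K →L[ℂ] K)) {q : ℂ} (hq : 1 - q ≠ 0)
    {s v : K} (hs : s - q • U.adjoint s = v) :
    ∃ y : (op U hinj).domain, op U hinj y - (Complex.I * (1 + q) / (1 - q)) • (y : K) = v ∧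
      (y : K) = ((1 - q) / (2 * Complex.I)) • (U.adjoint s - s) := by
  set s' := ((1 - q) / (2 * Complex.I)) • U.adjoint s with hs'
  have hU' : U s' = ((1 - q) / (2 * Complex.I)) • s := by
    rw [hs', map_smul, apply_adjoint_apply hU]
  refine ⟨⟨s' - U s', mem_domain s'⟩, ?_, ?_⟩
  · rw [op_apply (y := s') _ rfl]
    change Complex.I • (s' + U s') - (Complex.I * (1 + q) / (1 - q)) • (s' - U s') = v
    rw [hU', hs', ← hs]
    simp only [← smul_sub, ← smul_add, smul_smul]
    match_scalars
    · field_simp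
      ring
    · field_simp
      ring
  · change s' - U s' = _
    rw [hU', hs', smul_sub]

variable {H : Type u} [NormedAddCommGroup H] [InnerProductSpace ℂ H] [CompleteSpace H]

/-- If `U` is a minimal unitary dilation of the Cayley transform `C` of `T`, then the inverse
Cayley transform of `U` is a minimal self-adjoint dilation of `T`. -/
theorem isMinimalSelfAdjointDilation_op (hU : U ∈ unitary (K →L[ℂ] K)) {T C : H →L[ℂ] H}
    (hC1 : ‖C‖ ≤ 1) (hTC : T * (1 - C) = Complex.I • (1 + C)) (V : H →ₗᵢ[ℂ] K)
    (hdil : ∀ (n : ℕ) (x : H),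
      V.toContinuousLinearMap.adjoint ((U ^ n) (V x)) = (C ^ n) x)
    (hgen : ∀ k : K, (∀ (n : ℕ) (x : H), ⟪(U ^ n) (V x), k⟫_ℂ = 0) →
      (∀ (n : ℕ) (x : H), ⟪(U.adjoint ^ n) (V x), k⟫_ℂ = 0) → k = 0) :
    IsMinimalSelfAdjointDilation T V (op U hinj) := by
  have hU1 : ‖U‖ ≤ 1 := ContinuousLinearMap.opNorm_le_bound _ zero_le_one fun x => by
    rw [ContinuousLinearMap.norm_map_of_mem_unitary hU, one_mul]
  have hU1' : ‖U.adjoint‖ ≤ 1 := by rw [← ContinuousLinearMap.star_eq_adjoint, norm_star]; exact hU1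
  refine ⟨isSelfAdjoint_op hU, fun z hz x => ?_, ?_⟩
  · have hz0 : Complex.I - z ≠ 0 := fun h => by
      have := congrArg Complex.im h
      simp at this; linarith
    set q : ℂ := -(Complex.I + z) / (Complex.I - z) with hq
    have hqz : q * (Complex.I - z) = -(Complex.I + z) := div_mul_cancel₀ _ hz0
    have hq1 : ‖q‖ < 1 := by
      rw [hq, norm_div, norm_neg, div_lt_one (norm_pos_iff.2 hz0)]
      refine lt_of_pow_lt_pow_left₀ 2 (norm_nonneg _) ?_
      rw [← Complex.normSq_eq_norm_sq, ← Complex.normSq_eq_norm_sq, Complex.normSq_apply,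
        Complex.normSq_apply]
      simp only [Complex.add_re, Complex.add_im, Complex.sub_re, Complex.sub_im, Complex.I_re,
        Complex.I_im]
      nlinarith
    obtain ⟨s, hs, hsv⟩ := exists_hasSum_geometric hU1 hq1 (V x)
    obtain ⟨t, ht, htx⟩ := exists_hasSum_geometric hC1 hq1 x
    obtain ⟨y, hy, hyv⟩ := resolvent_lower (hinj := hinj) hz0 hqz hsv
    refine ⟨y, hy, ?_⟩
    have h1 : V.toContinuousLinearMap.adjoint s = t := by
      refine (V.toContinuousLinearMap.adjoint.hasSum hs).unique ?_
      simpa only [map_smul, hdil] using ht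
    have h2 : V.toContinuousLinearMap.adjoint (U s) = C t := by
      refine ((V.toContinuousLinearMap.adjoint ∘L U).hasSum hs).unique ?_
      have h3 : ∀ n, (V.toContinuousLinearMap.adjoint ∘L U) (q ^ n • (U ^ n) (V x))
          = C (q ^ n • (C ^ n) x) := fun n => by
        have e1 : U ((U ^ n) (V x)) = (U ^ (n + 1)) (V x) := by rw [pow_succ']; rfl
        have e2 : C ((C ^ n) x) = (C ^ (n + 1)) x := by rw [pow_succ']; rfl
        simp only [ContinuousLinearMap.comp_apply, map_smul, e1, e2, hdil]
      simp only [h3]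
      exact C.hasSum ht
    have h4 : T (t - C t) = Complex.I • (t + C t) := congrArg (fun S : H →L[ℂ] H => S t) hTC
    rw [hyv, map_smul, map_sub, h1, h2, map_smul, h4, smul_comm z, ← smul_sub,
      inv_smul_eq_iff₀ hz0, ← htx, smul_sub (Complex.I - z), smul_smul, mul_comm (Complex.I - z), hqz]
    module
  · rw [Submodule.topologicalClosure_eq_top_iff, Submodule.eq_bot_iff]
    intro k hk
    have hk' : ∀ (z : ℂ) (x : H) (y : (op U hinj).domain), z.im ≠ 0 →
        op U hinj y - z • (y : K) = V x → ⟪(y : K), k⟫_ℂ = 0 := fun z x y hz hy =>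
      (Submodule.mem_orthogonal _ _).1 hk _ (Submodule.subset_span ⟨z, x, y, hz, hy, rfl⟩)
    refine eq_zero_of_adjoint_apply_eq hU (hinj := hinj) ?_
    rw [← sub_eq_zero]
    have him : ∀ q : ℝ, 0 < q → q < 1 → 0 < (1 + q) / (1 - q) := fun q h0 h1 => by
      have : 0 < 1 - q := by linarith
      positivity
    have hone : ∀ q : ℝ, q < 1 → (1 - (q : ℂ)) ≠ 0 := fun q h1 => by
      norm_cast; linarith
    have hpow : ∀ {W : K →L[ℂ] K}, ‖W‖ ≤ 1 → ∀ (n : ℕ) (x : H) (w : K),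
        ‖⟪w, (W ^ n) (V x)⟫_ℂ‖ ≤ ‖w‖ * ‖V x‖ := fun {W} hW n x w => by
      refine (norm_inner_le_norm _ _).trans ?_
      gcongr
      refine ((W ^ n).le_opNorm _).trans (mul_le_of_le_one_left (norm_nonneg _) ?_)
      cases n with
      | zero => exact ContinuousLinearMap.norm_id_le
      | succ n => exact (norm_pow_le' W n.succ_pos).trans (pow_le_one₀ (norm_nonneg _) hW)
    -- the generating functions of both sequences of inner products vanish on `(0, 1)`
    have hgenfun : ∀ {W : K →L[ℂ] K}, ‖W‖ ≤ 1 → ∀ (x : H) (w : K),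
        (∀ q : ℝ, 0 < q → q < 1 → ∀ s : K, s - (q : ℂ) • W s = V x → ⟪w, s⟫_ℂ = 0) →
        ∀ n, ⟪w, (W ^ n) (V x)⟫_ℂ = 0 := fun {W} hW x w hw => by
      refine eq_zero_of_forall_hasSum_pow (fun n => hpow hW n x w) fun q hq hq1 => ?_
      obtain ⟨s, hs, hsv⟩ := exists_hasSum_geometric hW (q := (q : ℂ))
        (by rw [Complex.norm_real, Real.norm_eq_abs, abs_of_pos hq]; exact hq1) (V x)
      have := (innerSL ℂ w).hasSum hs
      simpa [hw q hq hq1 s hsv] using this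
    -- resolvents at the points `-i (1 + q) / (1 - q)` reach the vectors `(1 - U) Uⁿ V x`, those at
    -- `i (1 + q) / (1 - q)` the vectors `(1 - U*) U*ⁿ V x`
    have hlow : ∀ (n : ℕ) (x : H), ⟪k - U.adjoint k, (U ^ n) (V x)⟫_ℂ = 0 := fun n x => by
      refine hgenfun hU1 x _ (fun q hq hq1 s hs => ?_) n
      have hz : Complex.I - (-(Complex.I * ((1 + q) / (1 - q)))) = 2 * Complex.I / (1 - q) := by
        have := hone q hq1; field_simp; ring
      have hz0 : Complex.I - (-(Complex.I * ((1 + q) / (1 - q)))) ≠ 0 := by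
        rw [hz]; exact div_ne_zero (by simp) (hone q hq1)
      obtain ⟨y, hy, hyv⟩ := resolvent_lower (hinj := hinj) (U := U) hz0 (q := q) (by
        have := hone q hq1; field_simp; ring) hs
      have h1 := hk' _ x y (by
        have e : -(Complex.I * ((1 + q) / (1 - q))) = ((-((1 + q) / (1 - q)) : ℝ) : ℂ) * Complex.I := by
          push_cast; ring
        rw [e, Complex.im_ofReal_mul, Complex.I_im, mul_one]
        exact (neg_neg_of_pos (him q hq hq1)).ne) hy
      rw [hyv, inner_smul_left, mul_eq_zero] at h1
      have h2 := h1.resolve_left ((map_ne_zero _).2 (inv_ne_zero hz0))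
      rw [← inner_conj_symm, inner_sub_right, ContinuousLinearMap.adjoint_inner_right,
        ← inner_sub_left, h2, map_zero]
    have hupp : ∀ (n : ℕ) (x : H), ⟪k - U k, (U.adjoint ^ n) (V x)⟫_ℂ = 0 := fun n x => by
      refine hgenfun hU1' x _ (fun q hq hq1 s hs => ?_) n
      obtain ⟨y, hy, hyv⟩ := resolvent_upper (hinj := hinj) hU (hone q hq1) hs
      have h1 := hk' _ x y (by
        have e : Complex.I * (1 + q) / (1 - q) = (((1 + q) / (1 - q) : ℝ) : ℂ) * Complex.I := by
          push_cast; ring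
        rw [e, Complex.im_ofReal_mul, Complex.I_im, mul_one]
        exact (him q hq hq1).ne') hy
      rw [hyv, inner_smul_left, mul_eq_zero] at h1
      have h2 := h1.resolve_left
        ((map_ne_zero _).2 (div_ne_zero (hone q hq1) (by simp)))
      rw [← inner_conj_symm, inner_sub_right, ← ContinuousLinearMap.adjoint_inner_left,
        ← inner_sub_left, ← neg_sub (U.adjoint s), inner_neg_left, h2, neg_zero, map_zero]
    refine hgen _ (fun n x => ?_) fun n x => ?_
    · rw [← inner_conj_symm, ← neg_sub k, inner_neg_left, hlow, neg_zero, map_zero]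
    · cases n with
      | zero =>
        have := hlow 0 x
        rw [← inner_conj_symm, ← neg_sub k, inner_neg_left]
        simp only [pow_zero] at this ⊢
        rw [this, neg_zero, map_zero]
      | succ n =>
        have h1 := hupp n x
        have h2 : U.adjoint k - k = U.adjoint (k - U k) := by
          rw [map_sub, adjoint_apply_apply hU]
        rw [h2, ContinuousLinearMap.adjoint_inner_right, pow_succ', mul_apply_eq_comp,
          apply_adjoint_apply hU, ← inner_conj_symm, h1, map_zero]

end InverseCayley

/-! ### Existence of the minimal self-adjoint dilation -/

section ReducingSubspace

variable {K : Type u} [NormedAddCommGroup K] [InnerProductSpace ℂ K] [CompleteSpace K]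
  {H : Type u} [NormedAddCommGroup H] [InnerProductSpace ℂ H] [CompleteSpace H]

omit [CompleteSpace K] in
theorem ContinuousLinearMap.map_mem_topologicalClosure_span {T : K →L[ℂ] K} {S : Set K}
    (h : ∀ s ∈ S, T s ∈ (Submodule.span ℂ S).topologicalClosure) {x : K}
    (hx : x ∈ (Submodule.span ℂ S).topologicalClosure) :
    T x ∈ (Submodule.span ℂ S).topologicalClosure := by
  have h1 : Submodule.span ℂ S ≤ (Submodule.span ℂ S).topologicalClosure.comap T.toLinearMap :=
    Submodule.span_le.2 h
  have h2 : IsClosed (((Submodule.span ℂ S).topologicalClosure.comap T.toLinearMap : Submodule ℂ K) : Set K) :=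
    (Submodule.isClosed_topologicalClosure _).preimage T.continuous
  exact Submodule.topologicalClosure_minimal _ h1 h2 hx

/-- Cutting a unitary dilation down to the reducing subspace generated by `H` gives a minimal
one, and thereby a minimal self-adjoint dilation of `T` with a spectral measure. -/
theorem exists_isXi_of_unitary_dilation {U : K →L[ℂ] K} (hU : U ∈ unitary (K →L[ℂ] K))
    (hinj : ∀ x, U x = x → x = 0) {T C : H →L[ℂ] H} (hC1 : ‖C‖ ≤ 1)
    (hTC : T * (1 - C) = Complex.I • (1 + C)) (V : H →ₗᵢ[ℂ] K)
    (hdil : ∀ (n : ℕ) (x : H),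
      V.toContinuousLinearMap.adjoint ((U ^ n) (V x)) = (C ^ n) x) :
    ∃ X, IsXi T X := by
  let S : Set K := {k | ∃ (n : ℕ) (x : H), k = (U ^ n) (V x) ∨ k = (U.adjoint ^ n) (V x)}
  let M : Submodule ℂ K := (Submodule.span ℂ S).topologicalClosure
  have hSM : S ⊆ M := fun s hs => Submodule.le_topologicalClosure _ (Submodule.subset_span hs)
  have hMU : ∀ k ∈ M, U k ∈ M := fun k hk => by
    refine ContinuousLinearMap.map_mem_topologicalClosure_span ?_ hk
    rintro _ ⟨n, x, rfl | rfl⟩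
    · exact hSM ⟨n + 1, x, Or.inl (by rw [pow_succ']; rfl)⟩
    · cases n with
      | zero => exact hSM ⟨1, x, Or.inl (by simp)⟩
      | succ n =>
        refine hSM ⟨n, x, Or.inr ?_⟩
        rw [pow_succ', mul_apply_eq_comp, InverseCayley.apply_adjoint_apply hU]
  have hMU' : ∀ k ∈ M, U.adjoint k ∈ M := fun k hk => by
    refine ContinuousLinearMap.map_mem_topologicalClosure_span ?_ hk
    rintro _ ⟨n, x, rfl | rfl⟩
    · cases n with
      | zero => exact hSM ⟨1, x, Or.inr (by simp)⟩
      | succ n =>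
        refine hSM ⟨n, x, Or.inl ?_⟩
        rw [pow_succ', mul_apply_eq_comp, InverseCayley.adjoint_apply_apply hU]
    · exact hSM ⟨n + 1, x, Or.inr (by rw [pow_succ']; rfl)⟩
  have : CompleteSpace M := (Submodule.isClosed_topologicalClosure _).completeSpace_coe
  let W : M →L[ℂ] M := (U ∘L M.subtypeL).codRestrict M fun k => hMU k k.2
  let W' : M →L[ℂ] M := (U.adjoint ∘L M.subtypeL).codRestrict M fun k => hMU' k k.2
  have hW : ∀ k : M, ((W k : M) : K) = U k := fun _ => rfl
  have hW' : ∀ k : M, ((W' k : M) : K) = U.adjoint k := fun _ => rfl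
  have hadj : W.adjoint = W' := by
    symm
    rw [ContinuousLinearMap.eq_adjoint_iff]
    intro x y
    rw [Submodule.coe_inner, Submodule.coe_inner, hW, hW', ContinuousLinearMap.adjoint_inner_left]
  have hWU : W ∈ unitary (M →L[ℂ] M) := by
    refine ⟨?_, ?_⟩ <;> rw [ContinuousLinearMap.star_eq_adjoint, hadj] <;> ext k <;>
      simp only [mul_apply_eq_comp, one_apply_eq_self, hW, hW',
        InverseCayley.adjoint_apply_apply hU, InverseCayley.apply_adjoint_apply hU]
  have hpow : ∀ (n : ℕ) (k : M), (((W ^ n) k : M) : K) = (U ^ n) k := fun n k => by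
    induction n with
    | zero => rfl
    | succ n ih => rw [pow_succ', pow_succ', mul_apply_eq_comp, mul_apply_eq_comp, hW, ih]
  have hpow' : ∀ (n : ℕ) (k : M), (((W.adjoint ^ n) k : M) : K) = (U.adjoint ^ n) k := fun n k => by
    rw [hadj]
    induction n with
    | zero => rfl
    | succ n ih => rw [pow_succ', pow_succ', mul_apply_eq_comp, mul_apply_eq_comp, hW', ih]
  let J : H →ₗᵢ[ℂ] M :=
    { toLinearMap := V.toLinearMap.codRestrict M fun x => hSM ⟨0, x, Or.inl (by simp)⟩
      norm_map' := fun x => V.norm_map x }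
  have hJ : ∀ x, ((J x : M) : K) = V x := fun _ => rfl
  have hJadj : ∀ k : M, J.toContinuousLinearMap.adjoint k
      = V.toContinuousLinearMap.adjoint (k : K) := fun k => by
    refine ext_inner_left ℂ fun y => ?_
    rw [ContinuousLinearMap.adjoint_inner_right, ContinuousLinearMap.adjoint_inner_right]
    rfl
  have hWinj : Function.Injective (1 - W : M →L[ℂ] M) :=
    InverseCayley.injective_one_sub fun x hx =>
      Subtype.ext (hinj x (by rw [← hW, hx]))
  have hmin := InverseCayley.isMinimalSelfAdjointDilation_op (hinj := hWinj) hWU hC1 hTC J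
    (fun n x => by rw [hJadj, hpow, hJ, hdil])
    (fun k h1 h2 => by
      have hk : (k : K) ∈ (Submodule.span ℂ S)ᗮ := by
        rw [Submodule.mem_orthogonal]
        intro u hu
        induction hu using Submodule.span_induction with
        | mem u hu =>
          obtain ⟨n, x, rfl | rfl⟩ := hu
          · have := h1 n x
            rwa [Submodule.coe_inner, hpow, hJ] at this
          · have := h2 n x
            rwa [Submodule.coe_inner, hpow', hJ] at this
        | zero => exact inner_zero_left _
        | add u v _ _ hu hv => rw [inner_add_left, hu, hv, add_zero]
        | smul c u _ hu => rw [inner_smul_left, hu, mul_zero]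
      rw [← Submodule.orthogonal_closure] at hk
      exact Subtype.ext (inner_self_eq_zero.1 ((Submodule.mem_orthogonal _ _).1 hk k k.2)))
  exact ⟨_, M, inferInstance, inferInstance, inferInstance, J, InverseCayley.op W hWinj,
    InverseCayley.pvm hWU, hmin, InverseCayley.isSpectralMeasureOf_op hWU, rfl⟩

end ReducingSubspace

namespace Colligation

open Filter Topology

variable {H : Type u} [NormedAddCommGroup H] [InnerProductSpace ℂ H] [CompleteSpace H]

/-- The `H`-valued square summable sequences indexed by `ℤ`. -/
abbrev SeqSpace (H : Type u) [NormedAddCommGroup H] : Type u := lp (fun _ : ℤ => H) 2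

omit [InnerProductSpace ℂ H] [CompleteSpace H] in
theorem hasSum_norm_sq (f : SeqSpace H) : HasSum (fun n => ‖f n‖ ^ 2) (‖f‖ ^ 2) := by
  have := lp.hasSum_norm (p := 2) (by simp) f
  simpa using this

variable (C G' G Z : H →L[ℂ] H)

/-- The sequence obtained by shifting `f` to the right and mixing the entries that arrive at the
positions `0` and `1` by the operator matrix with rows `(C, G')` and `(G, Z)`. -/
noncomputable def mixShift (f : ℤ → H) (n : ℤ) : H :=
  if n = 0 then C (f 0) + G' (f (-1)) else if n = 1 then G (f 0) + Z (f (-1)) else f (n - 1)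

variable {C G' G Z}

omit [CompleteSpace H] in
theorem hasSum_mixShift
    (hiso : ∀ a b, ‖C a + G' b‖ ^ 2 + ‖G a + Z b‖ ^ 2 = ‖a‖ ^ 2 + ‖b‖ ^ 2) (f : SeqSpace H) :
    HasSum (fun n => ‖mixShift C G' G Z f n‖ ^ 2) (‖f‖ ^ 2) := by
  have h1 : HasSum (fun n : ℤ => ‖f (n - 1)‖ ^ 2) (‖f‖ ^ 2) :=
    (Equiv.subRight (1 : ℤ)).hasSum_iff.2 (hasSum_norm_sq f)
  have h2 : HasSum (fun n : ℤ => ‖mixShift C G' G Z f n‖ ^ 2 - ‖f (n - 1)‖ ^ 2)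
      (∑ n ∈ {0, 1}, (‖mixShift C G' G Z f n‖ ^ 2 - ‖f (n - 1)‖ ^ 2)) := by
    refine hasSum_sum_of_ne_finset_zero fun n hn => ?_
    simp only [Finset.mem_insert, Finset.mem_singleton, not_or] at hn
    simp [mixShift, hn.1, hn.2]
  have h3 : ∑ n ∈ ({0, 1} : Finset ℤ), (‖mixShift C G' G Z f n‖ ^ 2 - ‖f (n - 1)‖ ^ 2) = 0 := by
    rw [Finset.sum_pair zero_ne_one]
    have := hiso (f 0) (f (-1))
    simp only [mixShift, if_true, if_neg one_ne_zero, zero_sub, sub_self]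
    linarith
  rw [h3] at h2
  simpa using h1.add h2

/-- The isometry of `SeqSpace H` that shifts and mixes by an isometric operator matrix. -/
noncomputable def mixShiftIsometry
    (hiso : ∀ a b, ‖C a + G' b‖ ^ 2 + ‖G a + Z b‖ ^ 2 = ‖a‖ ^ 2 + ‖b‖ ^ 2) :
    SeqSpace H →ₗᵢ[ℂ] SeqSpace H where
  toFun f := ⟨mixShift C G' G Z f, by
    refine (memℓp_gen_iff (p := 2) (by simp)).2 ?_
    simpa using (hasSum_mixShift hiso f).summable⟩
  map_add' f g := by
    ext n
    simp only [mixShift, lp.coeFn_add, Pi.add_apply, map_add]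
    split_ifs <;> abel
  map_smul' c f := by
    ext n
    simp only [mixShift, lp.coeFn_smul, Pi.smul_apply, map_smul, RingHom.id_apply]
    split_ifs <;> simp
  norm_map' f := by
    refine (sq_eq_sq₀ (norm_nonneg _) (norm_nonneg _)).1 ?_
    exact (hasSum_norm_sq _).unique (hasSum_mixShift hiso f)

omit [CompleteSpace H] in
theorem mixShiftIsometry_apply
    (hiso : ∀ a b, ‖C a + G' b‖ ^ 2 + ‖G a + Z b‖ ^ 2 = ‖a‖ ^ 2 + ‖b‖ ^ 2) (f : SeqSpace H) (n : ℤ) :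
    mixShiftIsometry hiso f n = mixShift C G' G Z f n := rfl

/-- An isometry is unitary once its range has trivial orthogonal complement. -/
theorem mem_unitary_of_isometry {K : Type u} [NormedAddCommGroup K] [InnerProductSpace ℂ K]
    [CompleteSpace K] {J : K →ₗᵢ[ℂ] K} (h : ∀ k, (∀ f, ⟪J f, k⟫_ℂ = 0) → k = 0) :
    J.toContinuousLinearMap ∈ unitary (K →L[ℂ] K) := by
  have h1 : ∀ x, J.toContinuousLinearMap.adjoint (J x) = x := fun x =>
    ext_inner_left ℂ fun y => by
      rw [ContinuousLinearMap.adjoint_inner_right]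
      exact J.inner_map_map y x
  refine ⟨ContinuousLinearMap.ext fun x => h1 x, ContinuousLinearMap.ext fun x => ?_⟩
  refine sub_eq_zero.1 (h _ fun f => ?_)
  change ⟪J f, J (J.toContinuousLinearMap.adjoint x) - x⟫_ℂ = 0
  rw [inner_sub_right, J.inner_map_map, ContinuousLinearMap.adjoint_inner_right]
  exact sub_self _

theorem mixShiftIsometry_mem_unitary
    (hiso : ∀ a b, ‖C a + G' b‖ ^ 2 + ‖G a + Z b‖ ^ 2 = ‖a‖ ^ 2 + ‖b‖ ^ 2)
    (h1 : C * star C + G' * star G' = 1) (h2 : C * star G + G' * star Z = 0)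
    (h3 : G * star C + Z * star G' = 0) (h4 : G * star G + Z * star Z = 1) :
    (mixShiftIsometry hiso).toContinuousLinearMap ∈ unitary (SeqSpace H →L[ℂ] SeqSpace H) := by
  classical
  refine mem_unitary_of_isometry fun k hk => ?_
  have key : ∀ (j : ℤ) (a : H), HasSum
      (fun n => ⟪mixShift C G' G Z (lp.single (E := fun _ : ℤ => H) 2 j a) n, k n⟫_ℂ) 0 := fun j a => by
    have := lp.hasSum_inner (𝕜 := ℂ) (mixShiftIsometry hiso (lp.single (E := fun _ : ℤ => H) 2 j a)) k
    rwa [hk] at this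
  have hshift : ∀ j : ℤ, j ≠ 0 → j ≠ -1 → k (j + 1) = 0 := fun j hj0 hj1 => by
    refine ext_inner_left ℂ fun a => ?_
    rw [inner_zero_right]
    refine HasSum.unique ?_ (key j a)
    have : ⟪a, k (j + 1)⟫_ℂ = ⟪mixShift C G' G Z (lp.single (E := fun _ : ℤ => H) 2 j a) (j + 1), k (j + 1)⟫_ℂ := by
      have e1 : j + 1 ≠ 0 := by omega
      have e2 : j + 1 ≠ 1 := by omega
      simp [mixShift, e1, hj0]
    rw [this]
    refine hasSum_single (j + 1) fun n hn => ?_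
    have e3 : n - 1 ≠ j := by omega
    by_cases hn0 : n = 0
    · simp [mixShift, hn0, hj0.symm, hj1.symm]
    · by_cases hn1 : n = 1
      · simp [mixShift, hn1, hj0.symm, hj1.symm]
      · simp [mixShift, hn0, hn1, e3]
  have hmix : ∀ (j : ℤ) (a : H), (j = 0 ∨ j = -1) →
      ⟪mixShift C G' G Z (lp.single (E := fun _ : ℤ => H) 2 j a) 0, k 0⟫_ℂ
      + ⟪mixShift C G' G Z (lp.single (E := fun _ : ℤ => H) 2 j a) 1, k 1⟫_ℂ = 0 := fun j a hj => by
    rw [← Finset.sum_pair (f := fun n : ℤ => ⟪mixShift C G' G Z (lp.single (E := fun _ : ℤ => H) 2 j a) n, k n⟫_ℂ) zero_ne_one]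
    refine HasSum.unique (hasSum_sum_of_ne_finset_zero fun n hn => ?_) (key j a)
    simp only [Finset.mem_insert, Finset.mem_singleton, not_or] at hn
    have e3 : n - 1 ≠ j := by omega
    simp [mixShift, hn.1, hn.2, e3]
  have hc : star C (k 0) + star G (k 1) = 0 := by
    refine ext_inner_left ℂ fun a => ?_
    have := hmix 0 a (Or.inl rfl)
    simp only [mixShift] at this
    simp only [ContinuousLinearMap.star_eq_adjoint, inner_add_right,
      ContinuousLinearMap.adjoint_inner_right, inner_zero_right]
    simpa using this
  have hz : star G' (k 0) + star Z (k 1) = 0 := by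
    refine ext_inner_left ℂ fun a => ?_
    have := hmix (-1) a (Or.inr rfl)
    simp only [mixShift] at this
    simp only [ContinuousLinearMap.star_eq_adjoint, inner_add_right,
      ContinuousLinearMap.adjoint_inner_right, inner_zero_right]
    simpa using this
  have hk0 : k 0 = 0 := by
    have e1 := congrArg (fun T : H →L[ℂ] H => T (k 0)) h1
    have e2 := congrArg (fun T : H →L[ℂ] H => T (k 1)) h2
    simp only [add_apply, mul_apply_eq_comp, one_apply_eq_self, zero_apply] at e1 e2
    calc k 0 = C (star C (k 0) + star G (k 1)) + G' (star G' (k 0) + star Z (k 1)) := by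
          rw [map_add, map_add, add_add_add_comm, e1, e2, add_zero]
      _ = 0 := by rw [hc, hz, map_zero, map_zero, add_zero]
  have hk1 : k 1 = 0 := by
    have e1 := congrArg (fun T : H →L[ℂ] H => T (k 0)) h3
    have e2 := congrArg (fun T : H →L[ℂ] H => T (k 1)) h4
    simp only [add_apply, mul_apply_eq_comp, one_apply_eq_self, zero_apply] at e1 e2
    calc k 1 = G (star C (k 0) + star G (k 1)) + Z (star G' (k 0) + star Z (k 1)) := by
          rw [map_add, map_add, add_add_add_comm, e1, e2, zero_add]
      _ = 0 := by rw [hc, hz, map_zero, map_zero, add_zero]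
  ext n
  by_cases hn0 : n = 0
  · rw [hn0]; exact hk0
  · by_cases hn1 : n = 1
    · rw [hn1]; exact hk1
    · have := hshift (n - 1) (by omega) (by omega)
      simpa using this

end Colligation

section Dissipative

open InnerProductSpace

variable {H : Type u} [NormedAddCommGroup H] [InnerProductSpace ℂ H] [CompleteSpace H]

theorem IsSelfAdjoint.im_inner_apply_self {Z : H →L[ℂ] H} (hZ : IsSelfAdjoint Z) (x : H) :
    (⟪x, Z x⟫_ℂ).im = 0 := by
  rw [← Complex.conj_eq_iff_im, inner_conj_symm]
  exact (ContinuousLinearMap.isSelfAdjoint_iff_isSymmetric.1 hZ) x x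

/-- The numerical range of a dissipative operator lies in the closed upper half-plane, hence that
of `A + i B + i η` stays at distance at least `η` from the origin. -/
theorem le_norm_inner_dissipative {A B : H →L[ℂ] H} (hA : IsSelfAdjoint A) (hB : B.IsPositive)
    (η : ℝ) (x : H) :
    ‖x‖ ^ 2 * η ≤ ‖⟪(A + Complex.I • B + (Complex.I * η) • (1 : H →L[ℂ] H)) x, x⟫_ℂ‖ := by
  have h1 : (⟪A x, x⟫_ℂ).im = 0 := by
    rw [← Complex.conj_eq_iff_im, inner_conj_symm]
    exact ((ContinuousLinearMap.isSelfAdjoint_iff_isSymmetric.1 hA) x x).symm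
  have h2 : 0 ≤ (⟪B x, x⟫_ℂ).re := hB.re_inner_nonneg_left x
  have h3 : (⟪(A + Complex.I • B + (Complex.I * η) • (1 : H →L[ℂ] H)) x, x⟫_ℂ).im
      = -((⟪B x, x⟫_ℂ).re + ‖x‖ ^ 2 * η) := by
    have e : (A + Complex.I • B + (Complex.I * η) • (1 : H →L[ℂ] H)) x
      = A x + Complex.I • B x + (Complex.I * η) • x := rfl
    rw [e, inner_add_left, inner_add_left, inner_smul_left, inner_smul_left, Complex.add_im,
      Complex.add_im, h1, inner_self_eq_norm_sq_to_K, map_mul, Complex.conj_I, Complex.conj_ofReal]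
    have e2 : -Complex.I * (η : ℂ) * ((‖x‖ : ℝ) : ℂ) ^ 2 = ((-(‖x‖ ^ 2 * η) : ℝ) : ℂ) * Complex.I := by
      push_cast; ring
    erw [e2]
    rw [Complex.im_ofReal_mul, Complex.I_im]
    simp
    ring
  calc ‖x‖ ^ 2 * η ≤ |(⟪(A + Complex.I • B + (Complex.I * η) • (1 : H →L[ℂ] H)) x, x⟫_ℂ).im| := by
        rw [h3, abs_neg]
        exact (le_add_of_nonneg_left h2).trans (le_abs_self _)
    _ ≤ _ := Complex.abs_im_le_norm _

theorem isUnit_dissipative_add {A B : H →L[ℂ] H} (hA : IsSelfAdjoint A) (hB : B.IsPositive)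
    {η : ℝ} (hη : 0 < η) :
    IsUnit (A + Complex.I • B + (Complex.I * η) • (1 : H →L[ℂ] H)) :=
  ContinuousLinearMap.isUnit_of_forall_le_norm_inner_map _ (c := ⟨η, hη.le⟩) hη
    (le_norm_inner_dissipative hA hB η)

end Dissipative

namespace Colligation

open Filter Topology

variable {H : Type u} [NormedAddCommGroup H] [InnerProductSpace ℂ H] [CompleteSpace H]
  {C G' G Z : H →L[ℂ] H}

/-- The operator matrix with rows `(C, G')` and `(G, Z)` is isometric if `M* M = 1` holds entrywise. -/
theorem norm_sq_add_norm_sq (h1 : star C * C + star G * G = 1)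
    (h2 : star C * G' + star G * Z = 0) (h3 : star G' * C + star Z * G = 0)
    (h4 : star G' * G' + star Z * Z = 1) (a b : H) :
    ‖C a + G' b‖ ^ 2 + ‖G a + Z b‖ ^ 2 = ‖a‖ ^ 2 + ‖b‖ ^ 2 := by
  have key : ∀ (P Q : H →L[ℂ] H) (x y : H), ⟪P x, Q y⟫_ℂ = ⟪x, (star P * Q) y⟫_ℂ :=
    fun P Q x y => by
      rw [mul_apply_eq_comp, ContinuousLinearMap.star_eq_adjoint,
        ContinuousLinearMap.adjoint_inner_right]
  have e : ⟪C a + G' b, C a + G' b⟫_ℂ + ⟪G a + Z b, G a + Z b⟫_ℂ = ⟪a, a⟫_ℂ + ⟪b, b⟫_ℂ := by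
    have k1 : ⟪a, (star C * C) a⟫_ℂ + ⟪a, (star G * G) a⟫_ℂ = ⟪a, a⟫_ℂ := by
      rw [← inner_add_right, ← add_apply, h1, one_apply_eq_self]
    have k2 : ⟪a, (star C * G') b⟫_ℂ + ⟪a, (star G * Z) b⟫_ℂ = 0 := by
      rw [← inner_add_right, ← add_apply, h2, zero_apply, inner_zero_right]
    have k3 : ⟪b, (star G' * C) a⟫_ℂ + ⟪b, (star Z * G) a⟫_ℂ = 0 := by
      rw [← inner_add_right, ← add_apply, h3, zero_apply, inner_zero_right]
    have k4 : ⟪b, (star G' * G') b⟫_ℂ + ⟪b, (star Z * Z) b⟫_ℂ = ⟪b, b⟫_ℂ := by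
      rw [← inner_add_right, ← add_apply, h4, one_apply_eq_self]
    simp only [inner_add_left, inner_add_right, key]
    linear_combination k1 + k2 + k3 + k4
  simp only [inner_self_eq_norm_sq_to_K] at e
  exact_mod_cast e

/-- The embedding of `H` as the entries at position `0`. -/
noncomputable def embed : H →ₗᵢ[ℂ] SeqSpace H where
  toFun x := lp.single (E := fun _ : ℤ => H) 2 0 x
  map_add' x y := by ext n; simp [lp.single_apply]
  map_smul' c x := by ext n; simp [lp.single_apply]
  norm_map' x := lp.norm_single (E := fun _ : ℤ => H) (p := 2) (by simp) 0 x

omit [CompleteSpace H] in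
theorem embed_apply (x : H) (n : ℤ) : (embed x : SeqSpace H) n = if n = 0 then x else 0 := by
  change (lp.single (E := fun _ : ℤ => H) 2 0 x) n = _
  rw [lp.single_apply]
  by_cases h : n = 0
  · subst h; simp
  · simp [h]

theorem adjoint_embed (f : SeqSpace H) :
    (embed (H := H)).toContinuousLinearMap.adjoint f = f 0 := by
  refine ext_inner_left ℂ fun y => ?_
  rw [ContinuousLinearMap.adjoint_inner_right]
  exact lp.inner_single_left (𝕜 := ℂ) (G := fun _ : ℤ => H) 0 y f

variable (hiso : ∀ a b, ‖C a + G' b‖ ^ 2 + ‖G a + Z b‖ ^ 2 = ‖a‖ ^ 2 + ‖b‖ ^ 2)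

omit [CompleteSpace H] in
/-- Sequences starting at position `0` never see a contribution from negative positions, so the powers
of the mixed shift compress to the powers of `C`. -/
theorem mixShiftIsometry_pow_embed (n : ℕ) (x : H) :
    (∀ j : ℤ, j < 0 → (((mixShiftIsometry hiso).toContinuousLinearMap ^ n) (embed x)) j = 0) ∧
      (((mixShiftIsometry hiso).toContinuousLinearMap ^ n) (embed x)) 0 = (C ^ n) x := by
  induction n with
  | zero =>
    refine ⟨fun j hj => ?_, ?_⟩
    · simp only [pow_zero, one_apply_eq_self]
      rw [embed_apply, if_neg hj.ne]
    · simp only [pow_zero, one_apply_eq_self]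
      rw [embed_apply, if_pos rfl]
  | succ n ih =>
    set f := ((mixShiftIsometry hiso).toContinuousLinearMap ^ n) (embed x) with hf
    have hstep : ((mixShiftIsometry hiso).toContinuousLinearMap ^ (n + 1)) (embed x)
        = mixShiftIsometry hiso f := by rw [pow_succ']; rfl
    rw [hstep]
    refine ⟨fun j hj => ?_, ?_⟩
    · rw [mixShiftIsometry_apply, mixShift, if_neg hj.ne, if_neg (by omega)]
      exact ih.1 _ (by omega)
    · rw [mixShiftIsometry_apply, mixShift, if_pos rfl, ih.2, ih.1 (-1) (by omega), map_zero,
        add_zero, pow_succ']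
      rfl

omit [CompleteSpace H] in
/-- The mixed shift has no fixed vector if `C` has none: away from `0` a fixed sequence is constant in
each direction. -/
theorem eq_zero_of_mixShiftIsometry_eq (hC : ∀ a, C a = a → a = 0) {f : SeqSpace H}
    (hf : mixShiftIsometry hiso f = f) : f = 0 := by
  have hn : ∀ n : ℤ, mixShift C G' G Z f n = f n := fun n => by
    rw [← mixShiftIsometry_apply hiso, hf]
  have hs : Summable fun n => ‖f n‖ ^ 2 := (hasSum_norm_sq f).summable
  -- a square summable sequence that is constant along an injective sequence of indices vanishes
  have hconst : ∀ (e : ℕ → ℤ), Function.Injective e → (∀ m, f (e (m + 1)) = f (e m)) →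
      ∀ m, f (e m) = 0 := fun e he h => by
    have h0 : ∀ m, f (e m) = f (e 0) := fun m => by
      induction m with
      | zero => rfl
      | succ m ih => rw [h, ih]
    have h1 := (hs.comp_injective he).tendsto_atTop_zero
    simp only [Function.comp_def, h0] at h1
    have h2 := tendsto_nhds_unique h1 tendsto_const_nhds
    intro m
    rw [h0]
    simpa using h2.symm
  have hneg := hconst (fun m => -1 - m) (fun a b hab => by simpa using hab) fun m => by
    have := hn (-1 - m)
    rw [mixShift, if_neg (by omega), if_neg (by omega)] at this
    rw [← this]
    push_cast
    ring_nf
  have hpos := hconst (fun m => 1 + m) (fun a b hab => by simpa using hab) fun m => by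
    have := hn (1 + (m + 1 : ℕ))
    rw [mixShift, if_neg (by omega), if_neg (by omega)] at this
    rw [← this]
    push_cast
    ring_nf
  have hzero : f 0 = 0 := by
    refine hC _ ?_
    have h1 := hn 0
    have h2 := hneg 0
    simp only [Nat.cast_zero, sub_zero] at h2
    rw [mixShift, if_pos rfl, h2, map_zero, add_zero] at h1
    exact h1
  ext n
  rcases lt_trichotomy n 0 with h | h | h
  · have := hneg (-1 - n).toNat
    rw [Int.toNat_of_nonneg (by omega)] at this
    simpa using this
  · rw [h]; exact hzero
  · have := hpos (n - 1).toNat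
    rw [Int.toNat_of_nonneg (by omega)] at this
    simpa using this

/-- The block identities behind the unitarity of the colligation: they all follow from the
resolvent identity `R' - R = j R' (1 + b²) R`. -/
theorem colligation_identities {R R' b : H →L[ℂ] H} {j : ℂ} (hj : j * j = -4)
    (E : R' - R = j • (R' * (1 + b * b) * R)) :
    (1 + j • R') * (1 - j • R) + ((2 : ℂ) • (R' * b)) * ((2 : ℂ) • (b * R)) = 1 ∧
    (1 + j • R') * ((2 : ℂ) • (R * b)) + ((-2 : ℂ) • (R' * b)) * (1 - j • (b * R * b)) = 0 ∧
    ((2 : ℂ) • (b * R')) * (1 - j • R) + (1 + j • (b * R' * b)) * ((-2 : ℂ) • (b * R)) = 0 ∧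
    ((2 : ℂ) • (b * R')) * ((2 : ℂ) • (R * b)) + (1 + j • (b * R' * b)) * (1 - j • (b * R * b))
      = 1 := by
  have hE0 : j • (R' - R) = (-4 : ℂ) • (R' * (1 + b * b) * R) := by rw [E, smul_smul, hj]
  have hEr := congrArg (fun S => S * b) E
  have hEl := congrArg (fun S => b * S) E
  have hElr := congrArg (fun S => b * (S * b)) hE0
  have h22 : (2 : ℂ) * 2 = 4 := by norm_num
  refine ⟨?_, ?_, ?_, ?_⟩
  · simp only [mul_add, add_mul, mul_sub, mul_one, one_mul, smul_mul_assoc,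
      mul_smul_comm, mul_assoc, smul_smul, smul_add, hj, h22] at hE0 ⊢
    linear_combination (norm := module) hE0
  · simp only [mul_add, add_mul, mul_sub, sub_mul, mul_one, one_mul, smul_mul_assoc,
      mul_smul_comm, mul_assoc, smul_smul, smul_add] at hEr ⊢
    linear_combination (norm := module) (-2 : ℂ) • hEr
  · simp only [mul_add, add_mul, mul_sub, mul_one, one_mul, smul_mul_assoc,
      mul_smul_comm, mul_assoc, smul_smul, smul_add] at hEl ⊢
    linear_combination (norm := module) (2 : ℂ) • hEl
  · simp only [mul_add, add_mul, mul_sub, sub_mul, mul_one, one_mul, smul_mul_assoc,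
      mul_smul_comm, mul_assoc, smul_smul, smul_add, hj, h22] at hElr ⊢
    linear_combination (norm := module) hElr

/-- Every bounded dissipative operator has a minimal self-adjoint dilation. Its Cayley transform
`C = 1 - 2 i R`, `R = (T + i)⁻¹`, is the corner of the unitary operator matrix with entries
`C`, `2 R b`, `-2 b R`, `1 - 2 i b R b`, where `b` is the square root of the imaginary part. -/
theorem exists_isXi {A B : H →L[ℂ] H} (hA : IsSelfAdjoint A) (hB : B.IsPositive) :
    ∃ X, IsXi (A + Complex.I • B) X := by
  set T := A + Complex.I • B with hT
  have hB0 : 0 ≤ B := (ContinuousLinearMap.nonneg_iff_isPositive B).2 hB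
  have hTs : star T = A - Complex.I • B := by
    rw [hT, star_add, star_smul, hA.star_eq, hB.isSelfAdjoint.star_eq]
    simp [sub_eq_add_neg]
  obtain ⟨u, hu⟩ := isUnit_dissipative_add hA hB zero_lt_one
  rw [← hT, Complex.ofReal_one, mul_one] at hu
  set R : H →L[ℂ] H := ((u⁻¹ : (H →L[ℂ] H)ˣ) : H →L[ℂ] H) with hR
  have hRT : R * (T + Complex.I • 1) = 1 := by rw [← hu]; exact u.inv_mul
  have hTR : (T + Complex.I • 1) * R = 1 := by rw [← hu]; exact u.mul_inv
  have hRTs : star R * (star T - Complex.I • 1) = 1 := by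
    have := congrArg star hTR
    simpa [star_mul, sub_eq_add_neg] using this
  have hTRs : (star T - Complex.I • 1) * star R = 1 := by
    have := congrArg star hRT
    simpa [star_mul, sub_eq_add_neg] using this
  have hdiff : (T + Complex.I • 1) - (star T - Complex.I • 1) = (2 * Complex.I) • (1 + B) := by
    rw [hTs, hT]; module
  set b := CFC.sqrt B with hb
  have hbb : b * b = B := CFC.sqrt_mul_sqrt_self B hB0
  have hbs : star b = b := (CFC.sqrt_nonneg B).isSelfAdjoint.star_eq
  have E1 : star R - R = (2 * Complex.I) • (star R * (1 + b * b) * R) := by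
    calc star R - R = star R * ((T + Complex.I • 1) - (star T - Complex.I • 1)) * R := by
          rw [mul_sub, sub_mul, mul_assoc, hTR, hRTs, mul_one, one_mul]
      _ = _ := by rw [hdiff, hbb, mul_smul_comm, smul_mul_assoc]
  have E2 : star R - R = (2 * Complex.I) • (R * (1 + b * b) * star R) := by
    calc star R - R = R * ((T + Complex.I • 1) - (star T - Complex.I • 1)) * star R := by
          rw [mul_sub, sub_mul, hRT, mul_assoc, hTRs, mul_one, one_mul]
      _ = _ := by rw [hdiff, hbb, mul_smul_comm, smul_mul_assoc]
  set C := 1 - (2 * Complex.I) • R with hC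
  set G' := (2 : ℂ) • (R * b) with hG'
  set G := (-2 : ℂ) • (b * R) with hG
  set Z := 1 - (2 * Complex.I) • (b * R * b) with hZ
  have hCs : star C = 1 + (2 * Complex.I) • star R := by
    simp [hC, sub_eq_add_neg]
  have hGs' : star G' = (2 : ℂ) • (b * star R) := by simp [hG', hbs]
  have hGs : star G = (-2 : ℂ) • (star R * b) := by simp [hG, hbs]
  have hZs : star Z = 1 + (2 * Complex.I) • (b * star R * b) := by
    simp [hZ, hbs, sub_eq_add_neg, mul_assoc]
  have hj : (2 * Complex.I) * (2 * Complex.I) = -4 := by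
    linear_combination 4 * Complex.I_mul_I
  have hj' : (-(2 * Complex.I)) * (-(2 * Complex.I)) = -4 := by
    linear_combination 4 * Complex.I_mul_I
  have E2' : R - star R = (-(2 * Complex.I)) • (R * (1 + b * b) * star R) := by
    rw [neg_smul, ← E2, neg_sub]
  obtain ⟨h1, h2, h3, h4⟩ := colligation_identities hj E1
  obtain ⟨h5, h6, h7, h8⟩ := colligation_identities hj' E2'
  have hiso := norm_sq_add_norm_sq (C := C) (G' := G') (G := G) (Z := Z)
    (by rw [hCs, hC, hGs, hG]; refine Eq.trans ?_ h1; simp only [neg_smul, neg_mul_neg])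
    (by rw [hCs, hG', hGs, hZ]; exact h2)
    (by rw [hGs', hC, hZs, hG]; exact h3)
    (by rw [hGs', hG', hZs, hZ]; exact h4)
  have hUni := mixShiftIsometry_mem_unitary (C := C) (G' := G') (G := G) (Z := Z) hiso
    (by
      rw [hCs, hC, hGs', hG']
      refine Eq.trans ?_ h5
      simp only [neg_smul, sub_eq_add_neg, neg_neg])
    (by
      rw [hC, hGs, hG', hZs]
      refine neg_eq_zero.1 (Eq.trans ?_ h6)
      simp only [neg_smul, sub_eq_add_neg, neg_neg, neg_add, mul_neg, neg_mul])
    (by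
      rw [hG, hCs, hZ, hGs']
      refine neg_eq_zero.1 (Eq.trans ?_ h7)
      simp only [neg_smul, sub_eq_add_neg, neg_neg, neg_add, mul_neg, neg_mul])
    (by
      rw [hG, hGs, hZ, hZs]
      refine Eq.trans ?_ h8
      simp only [neg_smul, sub_eq_add_neg, neg_neg, neg_mul_neg])
  refine exists_isXi_of_unitary_dilation hUni (fun f hf => ?_) (C := C) ?_ ?_ embed fun n x => ?_
  · refine eq_zero_of_mixShiftIsometry_eq hiso (fun a ha => ?_) hf
    have h0 : (2 * Complex.I) • R a = 0 := by
      have : a - (2 * Complex.I) • R a = a := ha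
      simpa using this
    have h0' : R a = 0 := (smul_eq_zero.1 h0).resolve_left (by simp)
    have := congrArg (fun S : H →L[ℂ] H => S a) hTR
    simpa [h0'] using this.symm
  · refine ContinuousLinearMap.opNorm_le_bound _ zero_le_one fun a => ?_
    rw [one_mul]
    refine le_of_sq_le_sq ?_ (norm_nonneg _)
    have := hiso a 0
    simp only [map_zero, add_zero, norm_zero] at this
    nlinarith [sq_nonneg ‖G a‖]
  · have e1 : T * R = 1 - Complex.I • R := by
      have h := hTR
      rw [add_mul T _ R, smul_mul_assoc, one_mul] at h
      exact eq_sub_of_add_eq h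
    rw [hC, sub_sub_cancel, mul_smul_comm, e1]
    module
  · rw [adjoint_embed]
    exact (mixShiftIsometry_pow_embed hiso n x).2

end Colligation

/-! ### The functional calculus of a spectral measure -/

namespace ProjectionValuedMeasure

variable {K : Type u} [NormedAddCommGroup K] [InnerProductSpace ℂ K] [CompleteSpace K]
  (E : ProjectionValuedMeasure K) {s t : Set ℝ}

theorem inner_proj_left (hs : MeasurableSet s) (x y : K) :
    ⟪E.proj s x, y⟫_ℂ = ⟪x, E.proj s y⟫_ℂ := by
  have h3 := ContinuousLinearMap.adjoint_inner_left (E.proj s) y x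
  rwa [(E.isStarProjection s hs).isSelfAdjoint.adjoint_eq] at h3

theorem proj_proj (hs : MeasurableSet s) (ht : MeasurableSet t) (x : K) :
    E.proj s (E.proj t x) = E.proj (s ∩ t) x := by
  rw [E.inter s t hs ht]; rfl

theorem inner_proj_proj (hs : MeasurableSet s) (x y : K) :
    ⟪E.proj s x, E.proj s y⟫_ℂ = ⟪x, E.proj s y⟫_ℂ := by
  rw [E.inner_proj_left hs, E.proj_proj hs hs, Set.inter_self]

theorem inner_proj_self_eq (hs : MeasurableSet s) (x : K) :
    ⟪x, E.proj s x⟫_ℂ = ((‖E.proj s x‖ ^ 2 : ℝ) : ℂ) := by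
  rw [← E.inner_proj_proj hs, inner_self_eq_norm_sq_to_K]
  norm_cast

instance (x : K) : IsFiniteMeasure (E.diag x) :=
  ⟨by rw [E.diag_apply x MeasurableSet.univ]; exact ENNReal.ofReal_lt_top⟩

theorem diag_real_apply (x : K) (hs : MeasurableSet s) :
    (E.diag x).real s = ‖E.proj s x‖ ^ 2 := by
  rw [Measure.real, E.diag_apply x hs, ENNReal.toReal_ofReal (by positivity)]

theorem diag_real_univ (x : K) : (E.diag x).real Set.univ = ‖x‖ ^ 2 := by
  rw [E.diag_real_apply x MeasurableSet.univ, E.univ, one_apply_eq_self]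

theorem proj_compl (hs : MeasurableSet s) (x : K) : E.proj sᶜ x = x - E.proj s x := by
  have h : ((E.proj s + E.proj sᶜ - 1 : K →L[ℂ] K) : K →ₗ[ℂ] K) = 0 := by
    refine (inner_map_self_eq_zero _).1 fun y => ?_
    have h1 := measureReal_add_measureReal_compl (μ := E.diag y) hs
    rw [E.diag_real_apply y hs, E.diag_real_apply y hs.compl, E.diag_real_univ] at h1
    have h2 : ⟪y, (E.proj s + E.proj sᶜ - 1) y⟫_ℂ = 0 := by
      rw [sub_apply, add_apply, inner_sub_right, inner_add_right, E.inner_proj_self_eq hs,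
        E.inner_proj_self_eq hs.compl, one_apply_eq_self, inner_self_eq_norm_sq_to_K,
        ← Complex.ofReal_add, h1, Complex.ofReal_pow]
      exact sub_self _
    rw [← inner_conj_symm]
    exact (congrArg _ h2).trans (map_zero _)
  rw [eq_sub_iff_add_eq', ← sub_eq_zero]
  exact congrArg (fun S : K →ₗ[ℂ] K => S x) h

theorem diag_proj (hs : MeasurableSet s) (x : K) :
    E.diag (E.proj s x) = (E.diag x).restrict s := by
  ext t ht
  rw [Measure.restrict_apply ht, E.diag_apply _ ht, E.diag_apply _ (ht.inter hs), E.proj_proj ht hs]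

/-- Diagonal spectral measures are additive on vectors separated by a spectral projection. -/
theorem diag_add_of_proj_eq (hs : MeasurableSet s) {a b : K} (ha : E.proj s a = a)
    (hb : E.proj s b = 0) : E.diag (a + b) = E.diag a + E.diag b := by
  ext t ht
  have h0 : ⟪E.proj t a, E.proj t b⟫_ℂ = 0 := by
    rw [E.inner_proj_proj ht, ← ha, E.inner_proj_left hs, E.proj_proj hs ht, Set.inter_comm,
      ← E.proj_proj ht hs, hb, map_zero, inner_zero_right]
  rw [Measure.add_apply, E.diag_apply _ ht, E.diag_apply _ ht, E.diag_apply _ ht,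
    ← ENNReal.ofReal_add (by positivity) (by positivity), map_add, @norm_add_sq ℂ, h0]
  simp

theorem diag_smul_of_norm_eq_one {c : ℂ} (hc : ‖c‖ = 1) (x : K) :
    E.diag (c • x) = E.diag x := by
  ext t ht
  rw [E.diag_apply _ ht, E.diag_apply _ ht, map_smul, norm_smul, hc, one_mul]

variable {E} {L : K →ₗ.[ℂ] K}

namespace IsSpectralMeasureOf

theorem integrable_sq (hE : E.IsSpectralMeasureOf L) {y : K} (hy : y ∈ L.domain) :
    Integrable (fun t => t ^ 2) (E.diag y) := by
  refine ⟨by fun_prop, ?_⟩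
  rw [hasFiniteIntegral_iff_ofReal (ae_of_all _ fun t => sq_nonneg t)]
  exact (hE.mem_domain_iff y).1 hy

theorem integrable_id (hE : E.IsSpectralMeasureOf L) {y : K} (hy : y ∈ L.domain) :
    Integrable (fun t => t) (E.diag y) := by
  refine Integrable.mono' ((integrable_const (1 : ℝ)).add (hE.integrable_sq hy)) (by fun_prop)
    (ae_of_all _ fun t => ?_)
  simp only [Pi.add_apply, Real.norm_eq_abs]
  nlinarith [sq_abs t, sq_nonneg (|t| - 1), abs_nonneg t]

theorem proj_mem_domain (hE : E.IsSpectralMeasureOf L) (hs : MeasurableSet s) {y : K}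
    (hy : y ∈ L.domain) : E.proj s y ∈ L.domain := by
  rw [hE.mem_domain_iff, E.diag_proj hs]
  exact (setLIntegral_le_lintegral _ _).trans_lt ((hE.mem_domain_iff y).1 hy)

theorem proj_mem_domain_of_bounded (hE : E.IsSpectralMeasureOf L) (hs : MeasurableSet s) {r : ℝ}
    (hr : s ⊆ Set.Icc (-r) r) (y : K) : E.proj s y ∈ L.domain := by
  rw [hE.mem_domain_iff, E.diag_proj hs]
  refine (setLIntegral_mono (g := fun _ => ENNReal.ofReal (r ^ 2)) measurable_const
    fun t ht => ENNReal.ofReal_le_ofReal ?_).trans_lt ?_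
  · exact sq_le_sq' (hr ht).1 (hr ht).2
  · rw [setLIntegral_const]
    exact ENNReal.mul_lt_top ENNReal.ofReal_lt_top (measure_lt_top _ _)

/-- Vectors separated by a spectral projection have vanishing matrix element, because the quadratic
form of `L` is additive on `a + c b` for every phase `c`. -/
theorem inner_apply_eq_zero (hE : E.IsSpectralMeasureOf L) (hs : MeasurableSet s)
    (a b : L.domain) (ha : E.proj s a = a) (hb : E.proj s b = 0) : ⟪(a : K), L b⟫_ℂ = 0 := by
  have key : ∀ c : ℂ, ‖c‖ = 1 →
      c * ⟪(a : K), L b⟫_ℂ + (starRingEnd ℂ) c * ⟪(b : K), L a⟫_ℂ = 0 := fun c hc => by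
    have hd : E.diag ((a + c • b : L.domain) : K) = E.diag (a : K) + E.diag (b : K) := by
      rw [Submodule.coe_add, Submodule.coe_smul, E.diag_add_of_proj_eq hs ha (by simp [hb]),
        E.diag_smul_of_norm_eq_one hc]
    have h1 := hE.inner_apply (a + c • b)
    rw [hd, integral_add_measure (hE.integrable_id a.2) (hE.integrable_id b.2),
      Complex.ofReal_add, ← hE.inner_apply, ← hE.inner_apply, LinearPMap.map_add,
      LinearPMap.map_smul, Submodule.coe_add, Submodule.coe_smul, inner_add_left,
      inner_add_right, inner_add_right, inner_smul_left, inner_smul_left, inner_smul_right,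
      inner_smul_right] at h1
    have hcc : (starRingEnd ℂ) c * c = 1 := by
      rw [Complex.conj_mul', hc]; norm_num
    linear_combination h1 - hcc * ⟪(b : K), L b⟫_ℂ
  have h1 := key 1 (by simp)
  have hI := key Complex.I (by simp)
  rw [map_one] at h1
  rw [Complex.conj_I] at hI
  linear_combination (1 / 2) * h1 - (Complex.I / 2) * hI
    - (1 / 2) * (⟪(b : K), L a⟫_ℂ - ⟪(a : K), L b⟫_ℂ) * Complex.I_mul_I

/-- The spectral projections commute with the operator. -/
theorem apply_proj (hE : E.IsSpectralMeasureOf L) (hL : Dense (L.domain : Set K))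
    (hs : MeasurableSet s) (y : L.domain) :
    L ⟨E.proj s y, hE.proj_mem_domain hs y.2⟩ = E.proj s (L y) := by
  have key : ∀ (t : Set ℝ) (ht : MeasurableSet t),
      E.proj t (L ⟨E.proj tᶜ y, hE.proj_mem_domain ht.compl y.2⟩) = 0 := by
    intro t ht
    refine hL.eq_zero_of_inner_right ℂ fun v hv => ?_
    rw [← E.inner_proj_left ht]
    refine hE.inner_apply_eq_zero ht ⟨E.proj t v, hE.proj_mem_domain ht hv⟩ _ ?_ ?_
    · simp only [E.proj_proj ht ht, Set.inter_self]
    · simp only [E.proj_proj ht ht.compl, Set.inter_compl_self, E.proj_empty, zero_apply]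
  have h1 := key s hs
  have h2 := key sᶜ hs.compl
  rw [E.proj_compl hs, sub_eq_zero] at h2
  simp only [compl_compl] at h2
  have h3 : y = (⟨E.proj s y, hE.proj_mem_domain hs y.2⟩ : L.domain)
      + ⟨E.proj sᶜ y, hE.proj_mem_domain hs.compl y.2⟩ :=
    Subtype.ext (by simp [E.proj_compl hs])
  conv_rhs => rw [h3, LinearPMap.map_add, map_add, h1, add_zero, ← h2]

/-- A self-adjoint operator is symmetric. -/
theorem _root_.IsSelfAdjoint.inner_apply_left (hL : IsSelfAdjoint L) (x y : L.domain) :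
    ⟪L x, (y : K)⟫_ℂ = ⟪(x : K), L y⟫_ℂ := by
  have h := LinearPMap.adjoint_isFormalAdjoint hL.dense_domain
  rw [LinearPMap.isSelfAdjoint_def.1 hL] at h
  exact h x y

theorem inner_proj_apply (hE : E.IsSpectralMeasureOf L) (hL : IsSelfAdjoint L)
    (hs : MeasurableSet s) (v : L.domain) :
    ⟪E.proj s v, E.proj s (L v)⟫_ℂ = ((∫ t in s, t ∂(E.diag (v : K)) : ℝ) : ℂ) := by
  rw [← hE.apply_proj hL.dense_domain hs,
    hE.inner_apply ⟨E.proj s v, hE.proj_mem_domain hs v.2⟩, E.diag_proj hs]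

/-- `‖L v‖² = ∫ t² d‖E(t) v‖²` for `v` in a bounded spectral subspace: polarize the quadratic form
of `L` at `v ± L v`, whose spectral measures differ by `4 t d‖E(t) v‖²`. -/
theorem norm_sq_apply_of_bounded (hE : E.IsSpectralMeasureOf L) (hL : IsSelfAdjoint L)
    (hs : MeasurableSet s) {r : ℝ} (hr : s ⊆ Set.Icc (-r) r) (v : L.domain)
    (hv : E.proj s v = v) : ‖L v‖ ^ 2 = ∫ t, t ^ 2 ∂(E.diag (v : K)) := by
  have hw : E.proj s (L v) = L v := by
    rw [← hE.apply_proj hL.dense_domain hs]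
    congr 1
    exact Subtype.ext hv
  have hwd : L v ∈ L.domain := hw ▸ hE.proj_mem_domain_of_bounded hs hr (L v)
  set w : L.domain := ⟨L v, hwd⟩ with hw'
  -- the signed density `4 t` is split into its negative and positive parts, one on each side
  set μ := E.diag (v : K) with hμ
  have hi1 := hE.integrable_id v.2
  have hi2 := hE.integrable_sq v.2
  have hmeas : E.diag ((v + w : L.domain) : K) + μ.withDensity (fun t => ENNReal.ofReal (-(4 * t)))
      = E.diag ((v - w : L.domain) : K) + μ.withDensity (fun t => ENNReal.ofReal (4 * t)) := by
    ext u hu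
    have h1 : ‖E.proj u ((v + w : L.domain) : K)‖ ^ 2
        = ‖E.proj u ((v - w : L.domain) : K)‖ ^ 2 + ∫ t in u, 4 * t ∂μ := by
      have h2 := hE.inner_proj_apply hL hu v
      rw [integral_const_mul, Submodule.coe_add, Submodule.coe_sub, map_add, map_sub,
        @norm_add_sq ℂ, @norm_sub_sq ℂ]
      have h3 : (⟪E.proj u v, E.proj u w⟫_ℂ).re = ∫ t in u, t ∂μ := by
        rw [hw', h2, Complex.ofReal_re]
      simp only [RCLike.re_eq_complex_re, h3]
      ring
    have hi : Integrable (fun t => 4 * t) (μ.restrict u) := (hi1.const_mul 4).restrict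
    rw [integral_eq_lintegral_pos_part_sub_lintegral_neg_part hi] at h1
    have hp : ∫⁻ t in u, ENNReal.ofReal (4 * t) ∂μ ≠ ∞ := hi.lintegral_lt_top.ne
    have hn : ∫⁻ t in u, ENNReal.ofReal (-(4 * t)) ∂μ ≠ ∞ := hi.neg.lintegral_lt_top.ne
    rw [Measure.add_apply, Measure.add_apply, withDensity_apply _ hu, withDensity_apply _ hu,
      E.diag_apply _ hu, E.diag_apply _ hu, ← ENNReal.ofReal_toReal hp, ← ENNReal.ofReal_toReal hn,
      ← ENNReal.ofReal_add (by positivity) (by positivity),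
      ← ENNReal.ofReal_add (by positivity) (by positivity)]
    congr 1
    linarith
  have hd : ∀ c : ℝ, Integrable (fun t => t) (μ.withDensity (fun t => ENNReal.ofReal (c * t))) ∧
      ∫ t, t ∂(μ.withDensity (fun t => ENNReal.ofReal (c * t))) = ∫ t, max (c * t) 0 * t ∂μ :=
    fun c => by
    have hm : Measurable fun t : ℝ => ENNReal.ofReal (c * t) := by fun_prop
    have hf : ∀ᵐ t ∂μ, ENNReal.ofReal (c * t) < ∞ := ae_of_all _ fun t => ENNReal.ofReal_lt_top
    refine ⟨?_, ?_⟩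
    · rw [integrable_withDensity_iff_integrable_smul' hm hf]
      refine Integrable.mono' (hi2.const_mul |c|) (by fun_prop) (ae_of_all _ fun t => ?_)
      rw [ENNReal.toReal_ofReal', smul_eq_mul, norm_mul, Real.norm_eq_abs, Real.norm_eq_abs,
        ← sq_abs t, pow_two, ← mul_assoc]
      refine mul_le_mul_of_nonneg_right ?_ (abs_nonneg t)
      rw [← abs_mul, abs_of_nonneg (le_max_right _ _)]
      exact max_le (le_abs_self _) (abs_nonneg _)
    · rw [integral_withDensity_eq_integral_toReal_smul hm hf]
      simp only [ENNReal.toReal_ofReal', smul_eq_mul]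
  have h4 := congrArg (fun ν : Measure ℝ => ∫ t, t ∂ν) hmeas
  simp only [← neg_mul] at h4
  rw [integral_add_measure (hE.integrable_id (v + w).2) (hd _).1,
    integral_add_measure (hE.integrable_id (v - w).2) (hd _).1, (hd _).2, (hd _).2] at h4
  have h5 : ∫ t, max (4 * t) 0 * t ∂μ - ∫ t, max (-4 * t) 0 * t ∂μ = 4 * ∫ t, t ^ 2 ∂μ := by
    have hc : ∀ c : ℝ, Integrable (fun t => max (c * t) 0 * t) μ := fun c => by
      have := (hd c).1
      rw [integrable_withDensity_iff_integrable_smul' (by fun_prop)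
        (ae_of_all _ fun t => ENNReal.ofReal_lt_top)] at this
      simpa only [ENNReal.toReal_ofReal', smul_eq_mul] using this
    rw [← integral_sub (hc _) (hc _), ← integral_const_mul]
    refine integral_congr_ae (ae_of_all _ fun t => ?_)
    simp only
    rcases le_total 0 t with h | h
    · rw [max_eq_left (by linarith), max_eq_right (by linarith)]; ring
    · rw [max_eq_right (by linarith), max_eq_left (by linarith)]; ring
  have h6 := hE.inner_apply (v + w)
  have h7 := hE.inner_apply (v - w)
  have h8 := hL.inner_apply_left v w
  have h9 : ⟪(w : K), L v⟫_ℂ = ((‖L v‖ ^ 2 : ℝ) : ℂ) := by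
    rw [hw', inner_self_eq_norm_sq_to_K]; norm_cast
  have h10 : ⟪(v : K), L w⟫_ℂ = ((‖L v‖ ^ 2 : ℝ) : ℂ) := by
    rw [← h8, hw', inner_self_eq_norm_sq_to_K]; norm_cast
  rw [LinearPMap.map_add, Submodule.coe_add, inner_add_left, inner_add_right, inner_add_right, h9,
    h10] at h6
  rw [LinearPMap.map_sub, Submodule.coe_sub, inner_sub_left, inner_sub_right, inner_sub_right, h9,
    h10] at h7
  have h11 : ((4 * ‖L v‖ ^ 2 : ℝ) : ℂ) = ((4 * ∫ t, t ^ 2 ∂μ : ℝ) : ℂ) := by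
    have : ∫ t, t ∂(E.diag ((v + w : L.domain) : K)) - ∫ t, t ∂(E.diag ((v - w : L.domain) : K))
        = 4 * ∫ t, t ^ 2 ∂μ := by linarith
    rw [← this]
    push_cast at h6 h7 ⊢
    linear_combination h6 - h7
  have := Complex.ofReal_injective h11
  linarith

/-- `dE_{L y} = t² dE_y`. -/
theorem norm_sq_proj_apply (hE : E.IsSpectralMeasureOf L) (hL : IsSelfAdjoint L)
    (hs : MeasurableSet s) (y : L.domain) :
    ‖E.proj s (L y)‖ ^ 2 = ∫ t in s, t ^ 2 ∂(E.diag (y : K)) := by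
  have hbdd : ∀ u : Set ℝ, MeasurableSet u → ∀ r : ℝ, u ⊆ Set.Icc (-r) r →
      ‖E.proj u (L y)‖ ^ 2 = ∫ t in u, t ^ 2 ∂(E.diag (y : K)) := fun u hu r hr => by
    rw [← hE.apply_proj hL.dense_domain hu, hE.norm_sq_apply_of_bounded hL hu hr, E.diag_proj hu]
    simp only [E.proj_proj hu hu, Set.inter_self]
  have hfin := hE.integrable_sq y.2
  have hμ : E.diag (L y) = (E.diag (y : K)).withDensity (fun t => ENNReal.ofReal (t ^ 2)) := by
    refine Measure.ext_of_iUnion_eq_univ (s := fun n : ℕ => Set.Icc (-(n : ℝ)) n) ?_ fun n => ?_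
    · refine Set.eq_univ_of_forall fun t => Set.mem_iUnion.2 ?_
      obtain ⟨n, hn⟩ := exists_nat_ge |t|
      exact ⟨n, abs_le.1 hn⟩
    · ext u hu
      have hm : MeasurableSet (u ∩ Set.Icc (-(n : ℝ)) n) := hu.inter measurableSet_Icc
      rw [Measure.restrict_apply hu, Measure.restrict_apply hu, withDensity_apply _ hm,
        E.diag_apply _ hm, hbdd _ hm n Set.inter_subset_right,
        ofReal_integral_eq_lintegral_ofReal hfin.restrict (ae_of_all _ fun t => sq_nonneg t)]
  rw [← E.diag_real_apply _ hs, hμ, Measure.real, withDensity_apply _ hs,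
    ← ofReal_integral_eq_lintegral_ofReal hfin.restrict (ae_of_all _ fun t => sq_nonneg t),
    ENNReal.toReal_ofReal (integral_nonneg fun t => sq_nonneg t)]

/-- `dE_{(L - z) y} = |t - z|² dE_y`. -/
theorem diag_sub_smul (hE : E.IsSpectralMeasureOf L) (hL : IsSelfAdjoint L) (z : ℂ)
    (y : L.domain) :
    E.diag (L y - z • (y : K))
      = (E.diag (y : K)).withDensity fun t => ENNReal.ofReal (‖(t : ℂ) - z‖ ^ 2) := by
  have hi1 := hE.integrable_id y.2
  have hi2 := hE.integrable_sq y.2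
  have hn : ∀ t : ℝ, ‖(t : ℂ) - z‖ ^ 2 = t ^ 2 - 2 * z.re * t + ‖z‖ ^ 2 := fun t => by
    rw [← Complex.normSq_eq_norm_sq, ← Complex.normSq_eq_norm_sq, Complex.normSq_apply,
      Complex.normSq_apply]
    simp only [Complex.sub_re, Complex.sub_im, Complex.ofReal_re, Complex.ofReal_im]
    ring
  have hi3 : Integrable (fun t : ℝ => t ^ 2 - 2 * z.re * t) (E.diag (y : K)) :=
    hi2.sub (hi1.const_mul _)
  have hi : Integrable (fun t : ℝ => ‖(t : ℂ) - z‖ ^ 2) (E.diag (y : K)) := by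
    simp only [hn]
    exact hi3.add (integrable_const _)
  ext u hu
  rw [withDensity_apply _ hu, E.diag_apply _ hu,
    ← ofReal_integral_eq_lintegral_ofReal hi.restrict (ae_of_all _ fun t => by positivity)]
  congr 1
  simp only [hn]
  rw [integral_add hi3.restrict (integrable_const _),
    integral_sub hi2.restrict (hi1.restrict.const_mul _), integral_const_mul, integral_const,
    map_sub, map_smul, @norm_sub_sq ℂ, hE.norm_sq_proj_apply hL hu, norm_smul, mul_pow,
    measureReal_restrict_apply_univ, E.diag_real_apply _ hu, inner_smul_right,
    ← inner_conj_symm, hE.inner_proj_apply hL hu, Complex.conj_ofReal]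
  simp only [RCLike.re_eq_complex_re, Complex.re_mul_ofReal, smul_eq_mul]
  ring

/-- The resolvent of `L` is the integral of `1 / (t - z)`. -/
theorem integral_inv_sub (hE : E.IsSpectralMeasureOf L) (hL : IsSelfAdjoint L) {z : ℂ}
    (hz : z.im ≠ 0) (y : L.domain) :
    ∫ t : ℝ, ((t : ℂ) - z)⁻¹ ∂(E.diag (L y - z • (y : K))) = ⟪L y - z • (y : K), (y : K)⟫_ℂ := by
  have hi1 := hE.integrable_id y.2
  have h0 : ∀ t : ℝ, (t : ℂ) - z ≠ 0 := fun t h => hz (by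
    have := congrArg Complex.im h
    simpa using this)
  rw [hE.diag_sub_smul hL, integral_withDensity_eq_integral_toReal_smul (by fun_prop)
    (ae_of_all _ fun t => ENNReal.ofReal_lt_top)]
  have h1 : ∀ t : ℝ, (ENNReal.ofReal (‖(t : ℂ) - z‖ ^ 2)).toReal • ((t : ℂ) - z)⁻¹
      = (t : ℂ) - (starRingEnd ℂ) z := fun t => by
    rw [ENNReal.toReal_ofReal (by positivity), Complex.real_smul, Complex.ofReal_pow,
      ← Complex.conj_mul', mul_inv_cancel_right₀ (h0 t), map_sub, Complex.conj_ofReal]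
  have h2 : ⟪(y : K), (y : K)⟫_ℂ = ((‖(y : K)‖ ^ 2 : ℝ) : ℂ) := by
    rw [inner_self_eq_norm_sq_to_K]; norm_cast
  simp only [h1]
  rw [integral_sub hi1.ofReal (integrable_const _), integral_complex_ofReal, integral_const,
    E.diag_real_univ, inner_sub_left, inner_smul_left, hL.inner_apply_left, hE.inner_apply, h2,
    Complex.real_smul, mul_comm]

end IsSpectralMeasureOf

end ProjectionValuedMeasure

/-- The spectral measure of the dilation at the vector `x` is a measure on `ℝ` whose Stieltjes transform is the quadratic form of the resolvent. -/
theorem IsXi.exists_measure {H : Type u} [NormedAddCommGroup H] [InnerProductSpace ℂ H]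
    [CompleteSpace H] {T X : H →L[ℂ] H} (h : IsXi T X) (x : H) :
    ∃ μ : Measure ℝ, IsFiniteMeasure μ ∧ μ.real Set.univ = ‖x‖ ^ 2 ∧
      ⟪x, X x⟫_ℂ = (μ.real (Set.Iio 0) : ℂ) ∧
      ∀ z : ℂ, z.im < 0 → ∃ y : H, T y - z • y = x ∧ ∫ t : ℝ, ((t : ℂ) - z)⁻¹ ∂μ = ⟪x, y⟫_ℂ := by
  obtain ⟨K, _, _, _, V, L, E, hV, hE, rfl⟩ := h
  refine ⟨E.diag (V x), inferInstance, ?_, ?_, fun z hz => ?_⟩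
  · rw [E.diag_real_univ, V.norm_map]
  · rw [E.diag_real_apply _ measurableSet_Iio, ← E.inner_proj_self_eq measurableSet_Iio]
    exact ContinuousLinearMap.adjoint_inner_right V.toContinuousLinearMap x _
  · obtain ⟨y, h1, h2⟩ := hV.dilation z hz x
    refine ⟨_, h2, ?_⟩
    have h3 := hE.integral_inv_sub hV.isSelfAdjoint hz.ne y
    rw [h1] at h3
    exact h3.trans (ContinuousLinearMap.adjoint_inner_right V.toContinuousLinearMap x y).symm

/-! ### Integrating the resolvent along the imaginary half-axis -/

section ArctanKernel

open Filter Topology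

variable (μ : Measure ℝ) [IsFiniteMeasure μ]

theorem integrable_arctan_div (N : ℝ) (g : ℝ → ℝ) (hg : Measurable g) :
    Integrable (fun t => Real.arctan (N / g t)) μ := by
  refine Integrable.of_bound (C := Real.pi / 2)
    (Real.measurable_arctan.comp (measurable_const.div hg)).aestronglyMeasurable
    (ae_of_all _ fun t => ?_)
  rw [Real.norm_eq_abs]
  exact abs_le.2 ⟨(Real.neg_pi_div_two_lt_arctan _).le, (Real.arctan_lt_pi_div_two _).le⟩

/-- The kernel is unbounded at the origin, but its absolute value integrates to `arctan (N / |t|)`, so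
Fubini's theorem applies. At `t = 0` both sides vanish, as `N / 0 = 0`. -/
theorem integral_integral_div_sq_add_sq {N : ℝ} (hN : 0 ≤ N) :
    ∫ η in (0 : ℝ)..N, ∫ t, t / (t ^ 2 + η ^ 2) ∂μ = ∫ t, Real.arctan (N / t) ∂μ := by
  have hm : Measurable fun p : ℝ × ℝ => p.2 / (p.2 ^ 2 + p.1 ^ 2) := by fun_prop
  have hi : Integrable (Function.uncurry fun η t : ℝ => t / (t ^ 2 + η ^ 2))
      ((volume.restrict (Set.Ioc 0 N)).prod μ) := by
    rw [integrable_prod_iff' (by exact hm.aestronglyMeasurable)]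
    refine ⟨ae_of_all _ fun t => ?_, ?_⟩
    · rcases eq_or_ne t 0 with rfl | ht
      · simp
      · have h0 : ∀ η : ℝ, t ^ 2 + η ^ 2 ≠ 0 := fun η => by positivity
        have : Continuous fun η : ℝ => t / (t ^ 2 + η ^ 2) :=
          Continuous.div continuous_const (by fun_prop) h0
        exact (this.intervalIntegrable 0 N).1
    · have h : ∀ t : ℝ, ∫ η, ‖t / (t ^ 2 + η ^ 2)‖ ∂(volume.restrict (Set.Ioc 0 N))
          = Real.arctan (N / |t|) := fun t => by
        have e := integral_div_sq_add_sq (a := 0) (b := N) (c := |t|)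
        rw [zero_div, Real.arctan_zero, sub_zero, intervalIntegral.integral_of_le hN] at e
        rw [← e]
        refine integral_congr_ae (ae_of_all _ fun η => ?_)
        simp only
        rw [Real.norm_eq_abs, abs_div, sq_abs, abs_of_nonneg (a := t ^ 2 + η ^ 2) (by positivity)]
      simp only [Function.uncurry_apply_pair, h]
      exact integrable_arctan_div μ N _ measurable_norm
  rw [intervalIntegral.integral_of_le hN, integral_integral_swap hi]
  refine integral_congr_ae (ae_of_all _ fun t => ?_)
  have e := integral_div_sq_add_sq (a := 0) (b := N) (c := t)
  rwa [zero_div, Real.arctan_zero, sub_zero, intervalIntegral.integral_of_le hN] at e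

/-- `arctan (N / t)` converges boundedly to `π/2` times the sign of `t`. -/
theorem tendsto_integral_arctan_div :
    Tendsto (fun N : ℝ => ∫ t, Real.arctan (N / t) ∂μ) atTop
      (𝓝 (Real.pi / 2 * (μ.real (Set.Ioi 0) - μ.real (Set.Iio 0)))) := by
  have h0 : Real.pi / 2 * (μ.real (Set.Ioi 0) - μ.real (Set.Iio 0))
      = ∫ t, ((Set.Ioi (0 : ℝ)).indicator (fun _ => Real.pi / 2) t
        - (Set.Iio (0 : ℝ)).indicator (fun _ => Real.pi / 2) t) ∂μ := by
    rw [integral_sub ((integrable_const _).indicator measurableSet_Ioi)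
      ((integrable_const _).indicator measurableSet_Iio), integral_indicator_const _ measurableSet_Ioi,
      integral_indicator_const _ measurableSet_Iio]
    simp only [smul_eq_mul]
    ring
  rw [h0]
  refine tendsto_integral_filter_of_dominated_convergence (fun _ => Real.pi / 2)
    (Eventually.of_forall fun N =>
      (integrable_arctan_div μ N (fun t => t) measurable_id).aestronglyMeasurable)
    (Eventually.of_forall fun N => ae_of_all _ fun t => ?_) (integrable_const _)
    (ae_of_all _ fun t => ?_)
  · rw [Real.norm_eq_abs]
    exact abs_le.2 ⟨(Real.neg_pi_div_two_lt_arctan _).le, (Real.arctan_lt_pi_div_two _).le⟩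
  · rcases lt_trichotomy t 0 with h | h | h
    · rw [Set.indicator_of_notMem (by simpa using h.le), Set.indicator_of_mem (by simpa using h),
        zero_sub]
      exact (Real.tendsto_arctan_atBot.mono_right nhdsWithin_le_nhds).comp
        (tendsto_id.atTop_div_const_of_neg h)
    · subst h; simp
    · rw [Set.indicator_of_mem (by simpa using h), Set.indicator_of_notMem (by simpa using h.le),
        sub_zero]
      exact (Real.tendsto_arctan_atTop.mono_right nhdsWithin_le_nhds).comp
        (tendsto_id.atTop_div_const h)

theorem norm_inv_ofReal_add_le {η : ℝ} (hη : 0 < η) (t : ℝ) :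
    ‖((t : ℂ) + Complex.I * η)⁻¹‖ ≤ η⁻¹ := by
  rw [norm_inv]
  refine inv_anti₀ hη ?_
  have := Complex.abs_im_le_norm ((t : ℂ) + Complex.I * η)
  simpa [abs_of_pos hη] using this

theorem re_integral_inv_ofReal_add {η : ℝ} (hη : 0 < η) :
    (∫ t : ℝ, ((t : ℂ) + Complex.I * η)⁻¹ ∂μ).re = ∫ t, t / (t ^ 2 + η ^ 2) ∂μ := by
  have hi : Integrable (fun t : ℝ => ((t : ℂ) + Complex.I * η)⁻¹) μ :=
    Integrable.of_bound (by fun_prop) η⁻¹ (ae_of_all _ (norm_inv_ofReal_add_le hη))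
  rw [← RCLike.re_eq_complex_re, ← integral_re hi]
  refine integral_congr_ae (ae_of_all _ fun t => ?_)
  simp only [RCLike.re_eq_complex_re, Complex.inv_re, Complex.normSq_apply, Complex.add_re,
    Complex.add_im, Complex.ofReal_re, Complex.ofReal_im, Complex.re_mul_ofReal,
    Complex.im_mul_ofReal, Complex.I_re, Complex.I_im]
  congr 1
  · ring
  · ring

/-- The mass at the origin is recovered from the Stieltjes transform. -/
theorem tendsto_mul_integral_inv :
    Tendsto (fun η : ℝ => (Complex.I * η) * ∫ t : ℝ, ((t : ℂ) + Complex.I * η)⁻¹ ∂μ) (𝓝[>] 0)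
      (𝓝 (μ.real {0} : ℂ)) := by
  have h0 : (μ.real {0} : ℂ) = ∫ t, ({0} : Set ℝ).indicator (fun _ => (1 : ℂ)) t ∂μ := by
    rw [integral_indicator_const _ (measurableSet_singleton _)]
    simp
  rw [h0]
  simp only [← integral_const_mul]
  refine tendsto_integral_filter_of_dominated_convergence (fun _ => 1)
    (Eventually.of_forall fun η => by fun_prop) ?_ (integrable_const _)
    (ae_of_all _ fun t => ?_)
  · filter_upwards [self_mem_nhdsWithin] with η hη
    refine ae_of_all _ fun t => ?_
    have hη' : 0 < η := hη
    rw [norm_mul]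
    calc ‖Complex.I * η‖ * ‖((t : ℂ) + Complex.I * η)⁻¹‖ ≤ η * η⁻¹ := by
          refine mul_le_mul ?_ (norm_inv_ofReal_add_le hη' t) (norm_nonneg _) hη'.le
          simp [abs_of_pos hη']
      _ = 1 := mul_inv_cancel₀ hη'.ne'
  · rcases eq_or_ne t 0 with rfl | ht
    · refine tendsto_const_nhds.congr' ?_
      filter_upwards [self_mem_nhdsWithin] with η hη
      have hη' : (η : ℂ) ≠ 0 := Complex.ofReal_ne_zero.2 (ne_of_gt hη)
      rw [Set.indicator_of_mem (Set.mem_singleton _), Complex.ofReal_zero, zero_add,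
        mul_inv_cancel₀ (mul_ne_zero Complex.I_ne_zero hη')]
    · rw [Set.indicator_of_notMem (by simpa using ht)]
      have hc : ContinuousAt (fun η : ℝ => (Complex.I * η) * ((t : ℂ) + Complex.I * η)⁻¹) 0 := by
        refine ContinuousAt.mul (by fun_prop) (ContinuousAt.inv₀ (by fun_prop) ?_)
        simpa using ht
      have := hc.tendsto.mono_left (nhdsWithin_le_nhds (s := Set.Ioi 0))
      simpa using this

end ArctanKernel

section Resolvent

open Filter Topology

variable {H : Type u} [NormedAddCommGroup H] [InnerProductSpace ℂ H] [CompleteSpace H]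

/-- The quadratic form of `Ξ(T)` as an integral of the resolvent along the imaginary half-axis.
The resolvent of `T` is allowed a pole at the origin: `(T + i η)⁻¹ = R(η) - (1 + i η)⁻¹ P + (i η)⁻¹ P`
with `R` continuous up to `η = 0`, as happens when `P` is the projection onto a kernel of `T` which
is removed in `R`. -/
theorem IsXi.tendsto_integral_re_inner {T X P : H →L[ℂ] H} (h : IsXi T X)
    (hP : IsStarProjection P) {R : ℝ → H →L[ℂ] H} (hR : ContinuousOn R (Set.Ici 0))
    (hG : ∀ η : ℝ, 0 < η → (R η - (1 + Complex.I * η)⁻¹ • P + (Complex.I * η)⁻¹ • P)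
      * (T + (Complex.I * η) • (1 : H →L[ℂ] H)) = 1) (x : H) :
    Tendsto (fun N : ℝ => ∫ η in (0 : ℝ)..N, (⟪x, R η x⟫_ℂ).re) atTop
      (𝓝 (Real.pi / 2 * ‖x‖ ^ 2 - Real.pi * (⟪x, X x⟫_ℂ).re)) := by
  obtain ⟨μ, hμ, h1, h2, h3⟩ := h.exists_measure x
  have hPx : ⟪x, P x⟫_ℂ = ((‖P x‖ ^ 2 : ℝ) : ℂ) := by
    have e1 : P (P x) = P x := congrArg (fun S : H →L[ℂ] H => S x) hP.isIdempotentElem.eq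
    have e2 := ContinuousLinearMap.adjoint_inner_left P (P x) x
    rw [hP.isSelfAdjoint.adjoint_eq, e1, inner_self_eq_norm_sq_to_K] at e2
    rw [← e2]
    norm_cast
  have hint : ∀ η : ℝ, 0 < η → ∫ t : ℝ, ((t : ℂ) + Complex.I * η)⁻¹ ∂μ
      = ⟪x, R η x⟫_ℂ - (1 + Complex.I * η)⁻¹ * ((‖P x‖ ^ 2 : ℝ) : ℂ)
        + (Complex.I * η)⁻¹ * ((‖P x‖ ^ 2 : ℝ) : ℂ) := fun η hη => by
    obtain ⟨y, hy1, hy2⟩ := h3 (-(Complex.I * η)) (by simpa using hη)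
    have e1 : (R η - (1 + Complex.I * η)⁻¹ • P + (Complex.I * η)⁻¹ • P) x = y := by
      have := congrArg (fun S : H →L[ℂ] H => S y) (hG η hη)
      rw [← hy1]
      simpa using this
    simp only [sub_neg_eq_add] at hy2
    rw [hy2, ← e1]
    simp only [add_apply, sub_apply, smul_apply, inner_add_right, inner_sub_right,
      inner_smul_right, hPx]
  have hcont : ContinuousOn (fun η => ⟪x, R η x⟫_ℂ) (Set.Ici 0) := by
    have : Continuous fun S : H →L[ℂ] H => ⟪x, S x⟫_ℂ := by fun_prop
    exact this.comp_continuousOn hR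
  -- the pole of the resolvent at the origin is the point mass of the spectral measure
  have hzero : μ.real {0} = ‖P x‖ ^ 2 := by
    have e1 := tendsto_mul_integral_inv μ
    have e2 : Tendsto (fun η : ℝ => (Complex.I * η) * ⟪x, R η x⟫_ℂ
        - (Complex.I * η) * ((1 + Complex.I * η)⁻¹ * ((‖P x‖ ^ 2 : ℝ) : ℂ))
        + ((‖P x‖ ^ 2 : ℝ) : ℂ)) (𝓝[>] 0) (𝓝 ((‖P x‖ ^ 2 : ℝ) : ℂ)) := by
      have c0 : Tendsto (fun η : ℝ => Complex.I * (η : ℂ)) (𝓝[>] 0) (𝓝 0) := by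
        have : Continuous fun η : ℝ => Complex.I * (η : ℂ) := by fun_prop
        simpa using (this.tendsto 0).mono_left nhdsWithin_le_nhds
      have c1 := (hcont 0 Set.self_mem_Ici).tendsto.mono_left
        (nhdsWithin_mono 0 Set.Ioi_subset_Ici_self)
      have c2 : Tendsto (fun η : ℝ => (1 + Complex.I * (η : ℂ))⁻¹ * ((‖P x‖ ^ 2 : ℝ) : ℂ)) (𝓝[>] 0)
          (𝓝 ((1 + 0)⁻¹ * ((‖P x‖ ^ 2 : ℝ) : ℂ))) :=
        ((c0.const_add 1).inv₀ (by simp)).mul_const _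
      simpa only [zero_mul, sub_zero, zero_add] using
        ((c0.mul c1).sub (c0.mul c2)).add_const ((‖P x‖ ^ 2 : ℝ) : ℂ)
    have e3 := tendsto_nhds_unique (e1.congr' ?_) e2
    · exact_mod_cast e3
    · filter_upwards [self_mem_nhdsWithin] with η hη
      have hη' : Complex.I * (η : ℂ) ≠ 0 :=
        mul_ne_zero Complex.I_ne_zero (Complex.ofReal_ne_zero.2 (ne_of_gt hη))
      rw [hint η hη, mul_add, mul_sub, mul_inv_cancel_left₀ hη']
  have hre : ∀ η : ℝ, 0 < η → (⟪x, R η x⟫_ℂ).re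
      = ∫ t, t / (t ^ 2 + η ^ 2) ∂μ + ‖P x‖ ^ 2 * (1 + η ^ 2)⁻¹ := fun η hη => by
    rw [← re_integral_inv_ofReal_add μ hη, hint η hη]
    simp only [Complex.add_re, Complex.sub_re, Complex.re_mul_ofReal, Complex.inv_re,
      Complex.normSq_apply, Complex.add_im, Complex.one_re, Complex.one_im,
      Complex.im_mul_ofReal, Complex.I_re, Complex.I_im]
    ring
  have hN : ∀ N : ℝ, 0 ≤ N → ∫ η in (0 : ℝ)..N, (⟪x, R η x⟫_ℂ).re
      = ∫ t, Real.arctan (N / t) ∂μ + ‖P x‖ ^ 2 * Real.arctan N := fun N hN => by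
    have hi1 : IntervalIntegrable (fun η => (⟪x, R η x⟫_ℂ).re) volume 0 N :=
      (Complex.continuous_re.comp_continuousOn
        (hcont.mono Set.Icc_subset_Ici_self)).intervalIntegrable_of_Icc hN
    have hi2 : IntervalIntegrable (fun η : ℝ => ‖P x‖ ^ 2 * (1 + η ^ 2)⁻¹) volume 0 N := by
      refine Continuous.intervalIntegrable (continuous_const.mul ?_) _ _
      exact Continuous.inv₀ (by fun_prop) fun η => by positivity
    have e1 : ∫ η in (0 : ℝ)..N, ((⟪x, R η x⟫_ℂ).re - ‖P x‖ ^ 2 * (1 + η ^ 2)⁻¹)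
        = ∫ η in (0 : ℝ)..N, ∫ t, t / (t ^ 2 + η ^ 2) ∂μ := by
      rw [intervalIntegral.integral_of_le hN, intervalIntegral.integral_of_le hN]
      refine setIntegral_congr_fun measurableSet_Ioc fun η hη => ?_
      simp only [hre η hη.1, add_sub_cancel_right]
    rw [integral_integral_div_sq_add_sq μ hN, intervalIntegral.integral_sub hi1 hi2,
      intervalIntegral.integral_const_mul, integral_inv_one_add_sq, Real.arctan_zero, sub_zero] at e1
    linarith
  have hlim := (tendsto_integral_arctan_div μ).add
    ((Real.tendsto_arctan_atTop.mono_right nhdsWithin_le_nhds).const_mul (‖P x‖ ^ 2))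
  have hval : Real.pi / 2 * (μ.real (Set.Ioi 0) - μ.real (Set.Iio 0)) + ‖P x‖ ^ 2 * (Real.pi / 2)
      = Real.pi / 2 * ‖x‖ ^ 2 - Real.pi * (⟪x, X x⟫_ℂ).re := by
    have e1 : μ.real (Set.Iio 0) + μ.real (Set.Ici 0) = ‖x‖ ^ 2 := by
      rw [← h1, ← measureReal_add_measureReal_compl (μ := μ) (measurableSet_Iio (a := (0 : ℝ))),
        Set.compl_Iio]
    have e2 : μ.real (Set.Ici 0) = μ.real {0} + μ.real (Set.Ioi 0) := by
      rw [← measureReal_union (by simp) measurableSet_Ioi, Set.singleton_union, Set.Ioi_insert]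
    rw [h2, Complex.ofReal_re, ← e1, e2, ← hzero]
    ring
  rw [← hval]
  refine hlim.congr' ?_
  filter_upwards [eventually_ge_atTop 0] with N h0
  exact (hN N h0).symm

end Resolvent

/-! ### The kernel of a perturbed signature operator -/

section Kernel

variable {H : Type u} [NormedAddCommGroup H] [InnerProductSpace ℂ H] [CompleteSpace H]

/-- The kernel of a dissipative operator is the common kernel of its real and imaginary parts. -/
theorem apply_eq_zero_of_dissipative {A B : H →L[ℂ] H} (hA : IsSelfAdjoint A) (hB : B.IsPositive)
    {x : H} (hx : (A + Complex.I • B) x = 0) : A x = 0 ∧ B x = 0 := by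
  have hB0 : 0 ≤ B := (ContinuousLinearMap.nonneg_iff_isPositive B).2 hB
  have hx' : A x + Complex.I • B x = 0 := hx
  have h1 := hA.im_inner_apply_self x
  have h2 : (⟪x, B x⟫_ℂ).re = 0 := by
    have h3 := congrArg (fun y => (⟪x, y⟫_ℂ).im) hx'
    simpa only [inner_add_right, inner_smul_right, inner_zero_right, Complex.add_im, h1,
      Complex.I_mul_im, zero_add, Complex.zero_im] using h3
  have hBx : B x = 0 := by
    have h3 := norm_sqrt_apply_sq hB0 x
    rw [h2] at h3
    have h4 : CFC.sqrt B x = 0 := by simpa using h3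
    have h5 := congrArg (fun S : H →L[ℂ] H => S x) (CFC.sqrt_mul_sqrt_self B hB0)
    rw [← h5]
    change CFC.sqrt B (CFC.sqrt B x) = 0
    rw [h4, map_zero]
  exact ⟨by simpa [hBx] using hx', hBx⟩

/-- The kernel of `T = S + A + i B` reduces `T`; its projection `P` is
trace class, as `S P = - W P` with `W = A + i B` gives `P = (S W)² P`, and `T + P` is invertible by the
Fredholm alternative. -/
theorem exists_kernel_projection {S A B : H →L[ℂ] H} (hS : IsSelfAdjoint S) (hS2 : S * S = 1)
    (hA : IsSelfAdjoint A) (hA2 : IsHilbertSchmidt A) (hB : B.IsPositive) (hB1 : IsTraceClass B) :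
    ∃ P : H →L[ℂ] H, IsStarProjection P ∧ IsNuclear P ∧ (S + A + Complex.I • B) * P = 0 ∧
      P * (S + A + Complex.I • B) = 0 ∧ IsUnit (S + A + Complex.I • B + P) := by
  set T := S + A + Complex.I • B with hT
  set P := T.ker.starProjection with hPdef
  have hP : IsStarProjection P := isStarProjection_starProjection
  have hker : ∀ x, T (P x) = 0 := fun x => T.ker.starProjection_apply_mem x
  have hSA : (S + A) * P = 0 := by
    ext x
    exact (apply_eq_zero_of_dissipative (hS.add hA) hB (hker x)).1
  have hBP : B * P = 0 := by
    ext x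
    exact (apply_eq_zero_of_dissipative (hS.add hA) hB (hker x)).2
  have hTP : T * P = 0 := by
    ext x
    exact hker x
  have hPT : P * T = 0 := by
    have h1 := congrArg star hSA
    have h2 := congrArg star hBP
    rw [star_mul, hP.isSelfAdjoint.star_eq, (hS.add hA).star_eq, star_zero] at h1
    rw [star_mul, hP.isSelfAdjoint.star_eq, hB.isSelfAdjoint.star_eq, star_zero] at h2
    rw [hT, mul_add, h1, mul_smul_comm, h2, smul_zero, add_zero]
  set W := A + Complex.I • B with hW
  have hTW : T = S + W := by rw [hT, hW, add_assoc]
  have hSP : P = -(S * (W * P)) := by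
    have h1 : S * (T * P) = 0 := by rw [hTP, mul_zero]
    rw [hTW, add_mul, mul_add, ← mul_assoc, hS2, one_mul] at h1
    exact eq_neg_of_add_eq_zero_left h1
  have hSP2 : P = S * (W * S * W) * P := by
    conv_lhs => rw [hSP, hSP]
    simp only [mul_neg, neg_neg, mul_assoc]
  obtain ⟨w, b, hb⟩ := hA2
  have hBn : IsNuclear B := isTraceClass_iff_isNuclear.1 hB1
  have hASA : IsNuclear (A * (S * A)) := by
    refine b.isNuclear_mul hb (Summable.of_nonneg_of_le (fun i => sq_nonneg _) (fun i => ?_)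
      (hb.mul_left (‖S‖ ^ 2)))
    rw [← mul_pow]
    exact pow_le_pow_left₀ (norm_nonneg _) (S.le_opNorm _) 2
  have hWSW : IsNuclear (W * S * W) := by
    have e : W * S * W = A * (S * A) + Complex.I • (A * S * B) + Complex.I • (B * (S * W)) := by
      rw [hW]
      simp only [add_mul, mul_add, smul_mul_assoc, mul_smul_comm, mul_assoc, smul_add, smul_smul]
      abel
    rw [e]
    exact (hASA.add ((hBn.mul_left _).smul _)).add ((hBn.mul_right _).smul _)
  have hWc : IsCompactOperator W :=
    (b.isCompactOperator hb).add ((hB1.isCompactOperator hB).smul Complex.I)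
  have hPn : IsNuclear P := by
    rw [hSP2]
    exact (hWSW.mul_left S).mul_right P
  have hPc : IsCompactOperator P := by
    have h1 : IsCompactOperator (-(S * (W * P)) : H →L[ℂ] H) :=
      ((hWc.comp_clm P).clm_comp S).neg
    rwa [← hSP] at h1
  refine ⟨P, hP, hPn, hTP, hPT, ?_⟩
  -- `T + P = S (1 - K)` with `K` compact, and `T + P` is injective since `P T = 0`
  set K : H →L[ℂ] H := -(S * (W + P)) with hK
  have hKc : IsCompactOperator K := ((hWc.add hPc).clm_comp S).neg
  have hfac : T + P = S * (1 - K) := by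
    rw [hK, sub_neg_eq_add, mul_add, mul_one, ← mul_assoc, hS2, one_mul, hTW, add_assoc]
  have hSu : IsUnit S := ⟨⟨S, S, hS2, hS2⟩, rfl⟩
  rw [hfac]
  refine hSu.mul ?_
  rcases hKc.hasEigenvalue_or_mem_resolventSet (μ := (1 : ℂ)) one_ne_zero with h | h
  · exfalso
    obtain ⟨v, hv⟩ := h.exists_hasEigenvector
    have hKv : K v = v := by simpa using hv.apply_eq_smul
    refine hv.2 ?_
    have h1 : T v + P v = 0 := by
      have : (T + P) v = S ((1 - K) v) := by rw [hfac]; rfl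
      rw [sub_apply, one_apply_eq_self, hKv, sub_self, map_zero] at this
      exact this
    have h2 : P v = 0 := by
      have e1 : P (T v) = 0 := congrArg (fun S : H →L[ℂ] H => S v) hPT
      have e2 : P (P v) = P v := congrArg (fun S : H →L[ℂ] H => S v) hP.isIdempotentElem.eq
      have e3 := congrArg P h1
      rwa [map_add, e1, e2, zero_add, map_zero] at e3
    rw [h2, add_zero] at h1
    rw [← h2]
    exact (Submodule.starProjection_eq_self_iff.2 h1).symm
  · rw [spectrum.mem_resolventSet_iff, map_one] at h
    exact h

end Kernel

/-! ### The perturbation expansion of the resolvent -/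

section Expansion

open Filter Topology

variable {H : Type u} [NormedAddCommGroup H] [InnerProductSpace ℂ H] [CompleteSpace H]

/-- The resolvent `(S + i η)⁻¹` of a signature operator, in closed form. -/
noncomputable def signatureResolvent (S : H →L[ℂ] H) (η : ℝ) : H →L[ℂ] H :=
  (((1 + η ^ 2)⁻¹ : ℝ) : ℂ) • (S - (Complex.I * η) • (1 : H →L[ℂ] H))

theorem ofReal_one_add_sq_mul_inv (η : ℝ) :
    (((1 + η ^ 2)⁻¹ : ℝ) : ℂ) * (1 + (η : ℂ) ^ 2) = 1 := by
  have h : (1 + η ^ 2)⁻¹ * (1 + η ^ 2) = 1 := inv_mul_cancel₀ (by positivity)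
  exact_mod_cast congrArg (fun r : ℝ => (r : ℂ)) h

omit [CompleteSpace H] in
theorem signatureResolvent_mul {S : H →L[ℂ] H} (hS2 : S * S = 1) (η : ℝ) :
    signatureResolvent S η * (S + (Complex.I * η) • (1 : H →L[ℂ] H)) = 1 := by
  have h : (S - (Complex.I * η) • (1 : H →L[ℂ] H)) * (S + (Complex.I * η) • (1 : H →L[ℂ] H))
      = (1 + (η : ℂ) ^ 2) • (1 : H →L[ℂ] H) := by
    simp only [sub_mul, mul_add, mul_smul_comm, smul_mul_assoc, mul_one, one_mul, hS2]
    match_scalars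
    · linear_combination (-(η : ℂ) ^ 2) * Complex.I_mul_I
    · ring
  rw [signatureResolvent, smul_mul_assoc, h, smul_smul, ofReal_one_add_sq_mul_inv, one_smul]

omit [CompleteSpace H] in
theorem continuous_signatureResolvent (S : H →L[ℂ] H) : Continuous (signatureResolvent S) := by
  have h : Continuous fun η : ℝ => (1 + η ^ 2)⁻¹ :=
    Continuous.inv₀ (by fun_prop) fun η => by positivity
  exact (Complex.continuous_ofReal.comp h).smul (by fun_prop)

omit [CompleteSpace H] in
theorem norm_signatureResolvent_le (S : H →L[ℂ] H) {η : ℝ} (hη : 0 ≤ η) :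
    ‖signatureResolvent S η‖ ≤ (‖S‖ + 1) * ((1 + η) * (1 + η ^ 2)⁻¹) := by
  have h1 : ‖(Complex.I * η) • (1 : H →L[ℂ] H)‖ ≤ η := by
    rw [norm_smul, norm_mul, Complex.norm_I, Complex.norm_real, Real.norm_eq_abs, abs_of_nonneg hη,
      one_mul]
    exact mul_le_of_le_one_right hη ContinuousLinearMap.norm_id_le
  have h2 : ‖S - (Complex.I * η) • (1 : H →L[ℂ] H)‖ ≤ (‖S‖ + 1) * (1 + η) := by
    refine (norm_sub_le _ _).trans ?_
    nlinarith [norm_nonneg S]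
  rw [signatureResolvent, norm_smul, Complex.norm_real, Real.norm_of_nonneg (by positivity),
    ← mul_assoc, mul_comm]
  exact mul_le_mul_of_nonneg_right h2 (by positivity)

/-- The first order term of the expansion: its real part only sees `S A S - η² A`. -/
theorem re_inner_signatureResolvent_mul {S A : H →L[ℂ] H} (hS : IsSelfAdjoint S)
    (hA : IsSelfAdjoint A) (η : ℝ) (x : H) :
    (⟪x, (signatureResolvent S η * A * signatureResolvent S η) x⟫_ℂ).re
      = ((⟪x, (S * A * S) x⟫_ℂ).re - η ^ 2 * (⟪x, A x⟫_ℂ).re) / (1 + η ^ 2) ^ 2 := by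
  have h1 : signatureResolvent S η * A * signatureResolvent S η
      = ((((1 + η ^ 2)⁻¹ ^ 2 : ℝ)) : ℂ) • (S * A * S - ((η ^ 2 : ℝ) : ℂ) • A
        - (Complex.I * η) • (S * A + A * S)) := by
    have h2 : (S - (Complex.I * η) • (1 : H →L[ℂ] H)) * A * (S - (Complex.I * η) • 1)
        = S * A * S - ((η ^ 2 : ℝ) : ℂ) • A - (Complex.I * η) • (S * A + A * S) := by
      simp only [sub_mul, mul_sub, mul_smul_comm, smul_mul_assoc, mul_one, one_mul, smul_sub,
        smul_smul, smul_add]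
      push_cast
      match_scalars <;>
        first | ring1 | linear_combination ((η : ℂ) ^ 2) * Complex.I_mul_I
    rw [signatureResolvent, smul_mul_assoc, smul_mul_assoc, mul_smul_comm, h2, smul_smul,
      ← Complex.ofReal_mul, ← pow_two]
  have hsum : IsSelfAdjoint (S * A + A * S) := by
    rw [isSelfAdjoint_iff, star_add, star_mul, star_mul, hS.star_eq, hA.star_eq, add_comm]
  have h3 := hsum.im_inner_apply_self x
  rw [h1]
  simp only [smul_apply, sub_apply, inner_smul_right, inner_sub_right, Complex.re_ofReal_mul,
    Complex.sub_re]
  rw [mul_assoc Complex.I, Complex.I_mul_re, Complex.im_ofReal_mul, h3, inv_pow, div_eq_inv_mul]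
  ring

/-- Both `∫ (1 + η²)⁻²` and `∫ η² (1 + η²)⁻²` over the half-line equal `π/4`. -/
theorem tendsto_integral_sub_sq_mul_div (α β : ℝ) :
    Tendsto (fun N : ℝ => ∫ η in (0 : ℝ)..N, (α - η ^ 2 * β) / (1 + η ^ 2) ^ 2) atTop
      (𝓝 (Real.pi / 4 * (α - β))) := by
  have h0 : ∀ η : ℝ, 1 + η ^ 2 ≠ 0 := fun η => by positivity
  have hd : ∀ η : ℝ, HasDerivAt
      (fun η => ((α - β) * Real.arctan η + (α + β) * (η * (1 + η ^ 2)⁻¹)) / 2)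
      ((α - η ^ 2 * β) / (1 + η ^ 2) ^ 2) η := fun η => by
    have h1 := (Real.hasDerivAt_arctan η).const_mul (α - β)
    have h2 : HasDerivAt (fun y : ℝ => (α + β) * (y * (1 + y ^ 2)⁻¹))
        ((α + β) * (1 * (1 + η ^ 2)⁻¹ + η * (-(2 * η) / (1 + η ^ 2) ^ 2))) η := by
      have h3 : HasDerivAt (fun y : ℝ => 1 + y ^ 2) (2 * η) η := by
        simpa using (hasDerivAt_pow 2 η).const_add 1
      exact ((hasDerivAt_id' η).mul (h3.inv (h0 η))).const_mul (α + β)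
    refine ((h1.add h2).div_const 2).congr_deriv ?_
    have := h0 η
    field_simp
    ring
  have hi : ∀ N : ℝ, ∫ η in (0 : ℝ)..N, (α - η ^ 2 * β) / (1 + η ^ 2) ^ 2
      = ((α - β) * Real.arctan N + (α + β) * (N * (1 + N ^ 2)⁻¹)) / 2 := fun N => by
    rw [intervalIntegral.integral_eq_sub_of_hasDerivAt (fun η _ => hd η)]
    · simp
    · exact (Continuous.div (by fun_prop) (by fun_prop)
        fun η => pow_ne_zero 2 (h0 η)).intervalIntegrable _ _
  simp only [hi]
  have hz : Tendsto (fun N : ℝ => N * (1 + N ^ 2)⁻¹) atTop (𝓝 0) := by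
    refine squeeze_zero' (g := fun N : ℝ => N⁻¹) ?_ ?_ tendsto_inv_atTop_zero
    · filter_upwards [eventually_ge_atTop 0] with N hN
      positivity
    · filter_upwards [eventually_gt_atTop 0] with N hN
      rw [← div_eq_mul_inv, div_le_iff₀ (by positivity), inv_mul_eq_div, le_div_iff₀ hN]
      nlinarith
  have hlim := (((Real.tendsto_arctan_atTop.mono_right nhdsWithin_le_nhds).const_mul (α - β)).add
    (hz.const_mul (α + β))).div_const 2
  convert hlim using 2
  ring

/-- The resolvent of an invertible dissipative operator is continuous and bounded on the closed
imaginary half-axis. -/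
theorem continuousOn_and_bounded_inverse {A B : H →L[ℂ] H} (hA : IsSelfAdjoint A)
    (hB : B.IsPositive) (hu : IsUnit (A + Complex.I • B)) :
    (∀ η : ℝ, 0 ≤ η → IsUnit (A + Complex.I • B + (Complex.I * η) • (1 : H →L[ℂ] H))) ∧
    ContinuousOn (fun η : ℝ => Ring.inverse (A + Complex.I • B + (Complex.I * η) • 1))
      (Set.Ici 0) ∧
    ∃ c : ℝ, 0 ≤ c ∧ ∀ η : ℝ, 0 ≤ η →
      ‖Ring.inverse (A + Complex.I • B + (Complex.I * η) • (1 : H →L[ℂ] H))‖ ≤ c := by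
  have hunit : ∀ η : ℝ, 0 ≤ η →
      IsUnit (A + Complex.I • B + (Complex.I * η) • (1 : H →L[ℂ] H)) := fun η hη => by
    rcases hη.eq_or_lt with rfl | h
    · simpa using hu
    · exact isUnit_dissipative_add hA hB h
  have hcont : ContinuousOn (fun η : ℝ => Ring.inverse (A + Complex.I • B + (Complex.I * η) • 1))
      (Set.Ici 0) := fun η hη => by
    obtain ⟨v, hv⟩ := hunit η hη
    have h1 : Continuous fun η : ℝ =>
        A + Complex.I • B + (Complex.I * η) • (1 : H →L[ℂ] H) := by fun_prop
    have h2 := NormedRing.inverse_continuousAt v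
    rw [hv] at h2
    exact (ContinuousAt.comp (f := fun η : ℝ =>
      A + Complex.I • B + (Complex.I * η) • (1 : H →L[ℂ] H)) h2 h1.continuousAt).continuousWithinAt
  refine ⟨hunit, hcont, ?_⟩
  obtain ⟨c, hc⟩ := isCompact_Icc.exists_bound_of_continuousOn
    (hcont.mono (Set.Icc_subset_Ici_self (a := 1) (b := 0)))
  refine ⟨max c 1, zero_le_one.trans (le_max_right _ _), fun η hη => ?_⟩
  rcases le_total η 1 with h | h
  · exact (hc η ⟨hη, h⟩).trans (le_max_left _ _)
  · refine ContinuousLinearMap.opNorm_le_bound _ (zero_le_one.trans (le_max_right _ _)) fun y => ?_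
    set v := Ring.inverse (A + Complex.I • B + (Complex.I * η) • (1 : H →L[ℂ] H)) y with hv
    have h1 : (A + Complex.I • B + (Complex.I * η) • (1 : H →L[ℂ] H)) v = y :=
      congrArg (fun S : H →L[ℂ] H => S y) (Ring.mul_inverse_cancel _ (hunit η hη))
    have h2 := le_norm_inner_dissipative hA hB η v
    rw [h1] at h2
    have h3 := h2.trans (norm_inner_le_norm y v)
    have h4 : ‖v‖ ≤ ‖y‖ := by
      rcases (norm_nonneg v).eq_or_lt with h0 | h0
      · rw [← h0]; exact norm_nonneg _
      · refine le_of_mul_le_mul_right ?_ h0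
        nlinarith [sq_nonneg ‖v‖]
    exact h4.trans (le_mul_of_one_le_left (norm_nonneg _) (le_max_right _ _))

/-- The second order remainder of the resolvent expansion is trace class, with trace norm
integrable along the imaginary half-axis. -/
theorem exists_traceBound_remainder {S A Y : H →L[ℂ] H} (hS2 : S * S = 1)
    (hA2 : IsHilbertSchmidt A) (hY : IsNuclear Y) {R : ℝ → H →L[ℂ] H} {c : ℝ}
    (hR : ∀ η : ℝ, 0 ≤ η → (S + A + Y + (Complex.I * η) • (1 : H →L[ℂ] H)) * R η = 1)
    (hc : ∀ η : ℝ, 0 ≤ η → ‖R η‖ ≤ c) :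
    ∃ C : ℝ, ∀ η : ℝ, 0 ≤ η → TraceBound (R η - signatureResolvent S η
      + signatureResolvent S η * A * signatureResolvent S η) (C * (1 + η ^ 2)⁻¹) := by
  set W := A + Y with hW
  obtain ⟨w, b, hb⟩ := hA2
  have hHS : ∀ Q : H →L[ℂ] H, Summable fun i => ‖(Q * A) (b i)‖ ^ 2 := fun Q => by
    refine Summable.of_nonneg_of_le (fun i => sq_nonneg _) (fun i => ?_) (hb.mul_left (‖Q‖ ^ 2))
    rw [← mul_pow]
    exact pow_le_pow_left₀ (norm_nonneg _) (Q.le_opNorm _) 2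
  have hWQW : ∀ Q : H →L[ℂ] H, IsNuclear (W * Q * W) := fun Q => by
    have e : W * Q * W = A * (Q * A) + A * Q * Y + Y * (Q * W) := by
      rw [hW]; noncomm_ring
    rw [e]
    exact ((b.isNuclear_mul hb (hHS Q)).add (hY.mul_left _)).add (hY.mul_right _)
  obtain ⟨C1, h1⟩ := hWQW S
  obtain ⟨C2, h2⟩ := hWQW 1
  obtain ⟨C3, h3⟩ := hY
  set k := ‖S‖ + 1 with hk
  have hk0 : 0 ≤ k := by positivity
  refine ⟨k * C3 * k * 2 + k * (C1 + C2) * c * 2, fun η hη => ?_⟩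
  set Q := signatureResolvent S η with hQ
  set e : ℝ := (1 + η ^ 2)⁻¹ with he
  have he0 : 0 ≤ e := by positivity
  have hQn : ‖Q‖ ≤ k * ((1 + η) * e) := norm_signatureResolvent_le S hη
  have hc0 : 0 ≤ c := (norm_nonneg _).trans (hc η hη)
  -- `(1 + η)² ≤ 2 (1 + η²)`
  have hsq : ((1 + η) * e) * ((1 + η) * e) ≤ 2 * e := by
    have h4 : (1 + η ^ 2) * e = 1 := mul_inv_cancel₀ (by positivity)
    have h5 : (1 + η) * (1 + η) ≤ 2 * (1 + η ^ 2) := by nlinarith [sq_nonneg (1 - η)]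
    calc ((1 + η) * e) * ((1 + η) * e) = ((1 + η) * (1 + η)) * (e * e) := by ring
      _ ≤ (2 * (1 + η ^ 2)) * (e * e) := mul_le_mul_of_nonneg_right h5 (by positivity)
      _ = 2 * ((1 + η ^ 2) * e) * e := by ring
      _ = 2 * e := by rw [h4, mul_one]
  -- the resolvent identity, iterated once
  have hres : R η = Q - Q * W * R η := by
    have h4 : Q * ((S + A + Y + (Complex.I * η) • (1 : H →L[ℂ] H)) * R η)
        = R η + Q * W * R η := by
      have h5 : S + A + Y + (Complex.I * η) • (1 : H →L[ℂ] H)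
          = (S + (Complex.I * η) • (1 : H →L[ℂ] H)) + W := by rw [hW]; abel
      rw [← mul_assoc, h5, mul_add, hQ, signatureResolvent_mul hS2, add_mul, one_mul]
    rw [hR η hη, mul_one] at h4
    exact eq_sub_of_add_eq h4.symm
  have hexp : R η - Q + Q * A * Q = -(Q * Y * Q) + Q * (W * Q * W) * R η := by
    have h4 : R η - Q = -(Q * W * Q) + Q * W * Q * W * R η := by
      conv_lhs => rw [hres, hres]
      noncomm_ring
    rw [h4, hW]
    noncomm_ring
  have hmid : TraceBound (W * Q * W) ((C1 + C2) * ((1 + η) * e)) := by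
    have h4 : W * Q * W = (e : ℂ) • (W * S * W) - ((e : ℂ) * (Complex.I * η)) • (W * 1 * W) := by
      rw [hQ, signatureResolvent]
      simp only [mul_sub, sub_mul, mul_smul_comm, smul_mul_assoc, smul_sub, smul_smul]
      rfl
    rw [h4]
    refine ((h1.smul _).sub (h2.smul _)).mono ?_
    rw [norm_mul, norm_mul, Complex.norm_I, Complex.norm_real, Complex.norm_real,
      Real.norm_of_nonneg he0, Real.norm_of_nonneg hη]
    nlinarith [mul_nonneg he0 h1.1, mul_nonneg he0 h2.1, mul_nonneg (mul_nonneg he0 h1.1) hη]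
  rw [hexp]
  refine TraceBound.mono ((((h3.mul_left Q).mul_right Q).neg).add ((hmid.mul_left Q).mul_right _)) ?_
  have hm0 : 0 ≤ (1 + η) * e := by positivity
  have e1 : ‖Q‖ * C3 * ‖Q‖ ≤ k * C3 * k * (2 * e) := by
    calc ‖Q‖ * C3 * ‖Q‖ ≤ (k * ((1 + η) * e)) * C3 * (k * ((1 + η) * e)) := by
          have := h3.1
          gcongr
      _ = (k * C3 * k) * (((1 + η) * e) * ((1 + η) * e)) := by ring
      _ ≤ _ := mul_le_mul_of_nonneg_left hsq (mul_nonneg (mul_nonneg hk0 h3.1) hk0)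
  have e2 : ‖Q‖ * ((C1 + C2) * ((1 + η) * e)) * ‖R η‖ ≤ k * (C1 + C2) * c * (2 * e) := by
    have h12 : 0 ≤ C1 + C2 := add_nonneg h1.1 h2.1
    calc ‖Q‖ * ((C1 + C2) * ((1 + η) * e)) * ‖R η‖
        ≤ (k * ((1 + η) * e)) * ((C1 + C2) * ((1 + η) * e)) * c := by
          have := hc η hη
          gcongr
      _ = (k * (C1 + C2) * c) * (((1 + η) * e) * ((1 + η) * e)) := by ring
      _ ≤ _ := mul_le_mul_of_nonneg_left hsq (mul_nonneg (mul_nonneg hk0 h12) hc0)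
  linarith

omit [CompleteSpace H] in
/-- By polarization, convergence of the quadratic forms is weak convergence of the operators. -/
theorem tendsto_inner_of_tendsto_inner_self {ι : Type*} {l : Filter ι} {F : ι → H →L[ℂ] H}
    {T : H →L[ℂ] H} (h : ∀ x : H, Tendsto (fun i => ⟪x, F i x⟫_ℂ) l (𝓝 ⟪x, T x⟫_ℂ)) (x y : H) :
    Tendsto (fun i => ⟪x, F i y⟫_ℂ) l (𝓝 ⟪x, T y⟫_ℂ) := by
  have key : ∀ S : H →L[ℂ] H, ⟪x, S y⟫_ℂ =
      (⟪x + y, S (x + y)⟫_ℂ - ⟪x - y, S (x - y)⟫_ℂ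
        - Complex.I * ⟪x + Complex.I • y, S (x + Complex.I • y)⟫_ℂ
        + Complex.I * ⟪x - Complex.I • y, S (x - Complex.I • y)⟫_ℂ) / 4 := fun S => by
    simp only [map_add, map_sub, map_smul, inner_add_left, inner_sub_left, inner_add_right,
      inner_sub_right, inner_smul_left, inner_smul_right, Complex.conj_I]
    linear_combination (1 / 2 * ⟪x, S y⟫_ℂ - 1 / 2 * ⟪y, S x⟫_ℂ) * Complex.I_mul_I
  simp only [key]
  exact ((((h _).sub (h _)).sub ((h _).const_mul _)).add ((h _).const_mul _)).div_const 4

/-- Up to trace class operators, `Ξ(S + A + i B) - Ξ(S) = (S A S - A) / 4`. -/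
theorem isNuclear_xi_sub {S A B X X' : H →L[ℂ] H} (hS : IsSelfAdjoint S) (hS2 : S * S = 1)
    (hA : IsSelfAdjoint A) (hA2 : IsHilbertSchmidt A) (hB : B.IsPositive) (hB1 : IsTraceClass B)
    (hX : IsXi (S + A + Complex.I • B) X) (hX' : IsXi S X') :
    IsNuclear (((Real.pi / 4 : ℝ) : ℂ) • (S * A * S - A) - (Real.pi : ℂ) • (X - X')) := by
  obtain ⟨P, hP, hPn, hTP, hPT, hu⟩ := exists_kernel_projection hS hS2 hA hA2 hB hB1
  set T := S + A + Complex.I • B with hT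
  have hM : S + A + P + Complex.I • B = T + P := by rw [hT]; abel
  have hSAP : IsSelfAdjoint (S + A + P) := (hS.add hA).add hP.isSelfAdjoint
  obtain ⟨hunit, hcont, c, hc0, hc⟩ := continuousOn_and_bounded_inverse hSAP hB (hM ▸ hu)
  set R : ℝ → H →L[ℂ] H := fun η =>
    Ring.inverse (S + A + P + Complex.I • B + (Complex.I * η) • 1) with hR
  have hRl : ∀ η : ℝ, 0 ≤ η → R η * (T + P + (Complex.I * η) • (1 : H →L[ℂ] H)) = 1 :=
    fun η hη => by rw [← hM]; exact Ring.inverse_mul_cancel _ (hunit η hη)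
  have hRr : ∀ η : ℝ, 0 ≤ η →
      (S + A + (Complex.I • B + P) + (Complex.I * η) • (1 : H →L[ℂ] H)) * R η = 1 :=
    fun η hη => by
      have e : S + A + (Complex.I • B + P) = S + A + P + Complex.I • B := by abel
      rw [e]; exact Ring.mul_inverse_cancel _ (hunit η hη)
  have hPP : P * P = P := hP.isIdempotentElem.eq
  -- the limits of the resolvent integrals
  have hlimT := hX.tendsto_integral_re_inner hP hcont fun η hη => by
    have hz : (1 + Complex.I * (η : ℂ)) ≠ 0 := fun h => by
      have := congrArg Complex.re h
      simp at this
    have hη' : Complex.I * (η : ℂ) ≠ 0 :=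
      mul_ne_zero Complex.I_ne_zero (Complex.ofReal_ne_zero.2 hη.ne')
    have h1 : R η * P = (1 + Complex.I * (η : ℂ))⁻¹ • P := by
      have h2 : R η * ((T + P + (Complex.I * η) • (1 : H →L[ℂ] H)) * P) = P := by
        rw [← mul_assoc, hRl η hη.le, one_mul]
      rw [add_mul, add_mul, hTP, hPP, zero_add, smul_mul_assoc, one_mul] at h2
      have h3 : P + (Complex.I * (η : ℂ)) • P = (1 + Complex.I * (η : ℂ)) • P := by module
      rw [h3, mul_smul_comm] at h2
      rw [← h2, smul_smul, inv_mul_cancel₀ hz, one_smul, h2]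
    have h4 : R η * (T + (Complex.I * η) • (1 : H →L[ℂ] H)) = 1 - R η * P := by
      have h5 : T + (Complex.I * η) • (1 : H →L[ℂ] H)
          = (T + P + (Complex.I * η) • (1 : H →L[ℂ] H)) - P := by abel
      rw [h5, mul_sub, hRl η hη.le]
    have h6 : P * (T + (Complex.I * η) • (1 : H →L[ℂ] H)) = (Complex.I * (η : ℂ)) • P := by
      rw [mul_add, hPT, zero_add, mul_smul_comm, mul_one]
    change (R η - _ + _) * _ = 1
    rw [add_mul, sub_mul, h4, smul_mul_assoc, smul_mul_assoc, h6, h1, smul_smul, smul_smul,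
      inv_mul_cancel₀ hη', one_smul]
    have h7 : (1 : H →L[ℂ] H) - (1 + Complex.I * (η : ℂ))⁻¹ • P
        - ((1 + Complex.I * (η : ℂ))⁻¹ * (Complex.I * (η : ℂ))) • P + P
        = 1 + (1 - (1 + Complex.I * (η : ℂ))⁻¹ * (1 + Complex.I * (η : ℂ))) • P := by module
    rw [h7, inv_mul_cancel₀ hz, sub_self, zero_smul, add_zero]
  have hlimS := hX'.tendsto_integral_re_inner (P := 0) (IsStarProjection.zero _)
    (continuous_signatureResolvent S).continuousOn fun η hη => by
      rw [smul_zero, smul_zero, sub_zero, add_zero, signatureResolvent_mul hS2]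
  -- the remainder of the expansion and the integral of its real part
  have hY : IsNuclear (Complex.I • B + P) := ((isTraceClass_iff_isNuclear.1 hB1).smul _).add hPn
  obtain ⟨C, hC⟩ := exists_traceBound_remainder hS2 hA2 hY hRr hc
  set E : ℝ → H →L[ℂ] H := fun η => R η - signatureResolvent S η
      + signatureResolvent S η * A * signatureResolvent S η with hE
  have hEc : ContinuousOn E (Set.Ici 0) :=
    (hcont.sub (continuous_signatureResolvent S).continuousOn).add
      ((((continuous_signatureResolvent S).mul continuous_const).mul
        (continuous_signatureResolvent S)).continuousOn)
  set F : ℝ → H →L[ℂ] H := fun η => (1 / 2 : ℂ) • (E η + star (E η)) with hF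
  have hFc : ContinuousOn F (Set.Ici 0) := (hEc.add hEc.star).const_smul (1 / 2 : ℂ)
  have hFb : ∀ η : ℝ, 0 ≤ η → TraceBound (F η) (C * (1 + η ^ 2)⁻¹) := fun η hη => by
    refine (((hC η hη).add (hC η hη).star).smul (1 / 2)).mono (le_of_eq ?_)
    rw [norm_div, norm_one, Complex.norm_ofNat]
    ring
  have hFi : ∀ N : ℝ, 0 ≤ N → IntervalIntegrable F volume 0 N := fun N hN =>
    (hFc.mono Set.Icc_subset_Ici_self).intervalIntegrable_of_Icc hN
  have hC0 : 0 ≤ C := by simpa using (hC 0 le_rfl).1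
  have hbound : ∀ N : ℝ, 0 ≤ N → TraceBound (∫ η in (0 : ℝ)..N, F η) (C * (Real.pi / 2)) :=
    fun N hN => by
    have hgi : IntervalIntegrable (fun η : ℝ => C * (1 + η ^ 2)⁻¹) volume 0 N :=
      (continuous_const.mul (Continuous.inv₀ (by fun_prop)
        fun η => by positivity)).intervalIntegrable _ _
    refine (TraceBound.intervalIntegral hN (hFi N hN) hgi fun η hη => hFb η hη.1).mono ?_
    rw [intervalIntegral.integral_const_mul, integral_inv_one_add_sq, Real.arctan_zero, sub_zero]
    exact mul_le_mul_of_nonneg_left (Real.arctan_lt_pi_div_two N).le hC0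
  refine ⟨C * (Real.pi / 2), TraceBound.of_weak_tendsto (l := atTop)
    (F := fun N : ℝ => ∫ η in (0 : ℝ)..(max N 0), F η)
    (tendsto_inner_of_tendsto_inner_self fun x => ?_) fun N => hbound _ (le_max_right _ _)⟩
  have hinner : ∀ N : ℝ, 0 ≤ N → ⟪x, (∫ η in (0 : ℝ)..N, F η) x⟫_ℂ
      = (((∫ η in (0 : ℝ)..N, (⟪x, R η x⟫_ℂ).re)
        - (∫ η in (0 : ℝ)..N, (⟪x, signatureResolvent S η x⟫_ℂ).re)
        + ∫ η in (0 : ℝ)..N, ((⟪x, (S * A * S) x⟫_ℂ).re - η ^ 2 * (⟪x, A x⟫_ℂ).re)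
          / (1 + η ^ 2) ^ 2 : ℝ) : ℂ) := fun N hN => by
    let φ : (H →L[ℂ] H) →L[ℂ] ℂ := (innerSL ℂ x) ∘L (ContinuousLinearMap.apply ℂ H x)
    have hφ : ∀ Z : H →L[ℂ] H, φ Z = ⟪x, Z x⟫_ℂ := fun Z => rfl
    have hi : ∀ G : ℝ → H →L[ℂ] H, ContinuousOn G (Set.Ici 0) →
        IntervalIntegrable (fun η => (⟪x, G η x⟫_ℂ).re) volume 0 N := fun G hG =>
      (Complex.continuous_re.comp_continuousOn ((φ.continuous.comp_continuousOn hG).mono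
        Set.Icc_subset_Ici_self)).intervalIntegrable_of_Icc hN
    have hi3 : IntervalIntegrable (fun η : ℝ => ((⟪x, (S * A * S) x⟫_ℂ).re
        - η ^ 2 * (⟪x, A x⟫_ℂ).re) / (1 + η ^ 2) ^ 2) volume 0 N :=
      (Continuous.div (by fun_prop) (by fun_prop)
        fun η => pow_ne_zero 2 (by positivity)).intervalIntegrable _ _
    rw [← intervalIntegral.integral_sub (hi R hcont)
      (hi _ (continuous_signatureResolvent S).continuousOn),
      ← intervalIntegral.integral_add ((hi R hcont).sub
        (hi _ (continuous_signatureResolvent S).continuousOn)) hi3,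
      ← hφ, ← φ.intervalIntegral_comp_comm (hFi N hN), ← intervalIntegral.integral_ofReal]
    refine intervalIntegral.integral_congr fun η _ => ?_
    have h1 : ⟪x, star (E η) x⟫_ℂ = (starRingEnd ℂ) ⟪x, E η x⟫_ℂ := by
      rw [inner_conj_symm, ContinuousLinearMap.star_eq_adjoint,
        ContinuousLinearMap.adjoint_inner_right]
    have h2 : φ (F η) = (((⟪x, E η x⟫_ℂ).re : ℝ) : ℂ) := by
      rw [hφ, Complex.re_eq_add_conj, ← h1]
      simp only [hF, smul_apply, add_apply, inner_smul_right, inner_add_right]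
      ring
    simp only [h2]
    congr 1
    rw [← re_inner_signatureResolvent_mul hS hA η x]
    simp only [hE, add_apply, sub_apply, inner_add_right, inner_sub_right, Complex.add_re,
      Complex.sub_re]
  have hreal : ∀ {T' Z : H →L[ℂ] H}, IsXi T' Z → ⟪x, Z x⟫_ℂ = (((⟪x, Z x⟫_ℂ).re : ℝ) : ℂ) :=
    fun h => by
    obtain ⟨μ, -, -, h2, -⟩ := h.exists_measure x
    rw [h2, Complex.ofReal_re]
  have hSAS : IsSelfAdjoint (S * A * S) := by
    rw [isSelfAdjoint_iff, star_mul, star_mul, hS.star_eq, hA.star_eq, mul_assoc]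
  have hval : ⟪x, (((Real.pi / 4 : ℝ) : ℂ) • (S * A * S - A) - (Real.pi : ℂ) • (X - X')) x⟫_ℂ
      = (((Real.pi / 2 * ‖x‖ ^ 2 - Real.pi * (⟪x, X x⟫_ℂ).re)
        - (Real.pi / 2 * ‖x‖ ^ 2 - Real.pi * (⟪x, X' x⟫_ℂ).re)
        + Real.pi / 4 * ((⟪x, (S * A * S) x⟫_ℂ).re - (⟪x, A x⟫_ℂ).re) : ℝ) : ℂ) := by
    simp only [sub_apply, smul_apply, inner_sub_right, inner_smul_right]
    rw [hreal hX, hreal hX',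
      Complex.ext (z := ⟪x, A x⟫_ℂ) (w := (((⟪x, A x⟫_ℂ).re : ℝ) : ℂ)) rfl
        (hA.im_inner_apply_self x),
      Complex.ext (z := ⟪x, (S * A * S) x⟫_ℂ) (w := (((⟪x, (S * A * S) x⟫_ℂ).re : ℝ) : ℂ)) rfl
        (hSAS.im_inner_apply_self x)]
    simp only [Complex.ofReal_re]
    push_cast
    ring
  rw [hval]
  have hlim := (((hlimT x).sub (hlimS x)).add (tendsto_integral_sub_sq_mul_div
    (⟪x, (S * A * S) x⟫_ℂ).re (⟪x, A x⟫_ℂ).re)).ofReal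
  refine hlim.congr' ?_
  filter_upwards [eventually_ge_atTop 0] with N hN
  rw [max_eq_left hN, hinner N hN]

theorem isXi_xi {T : H →L[ℂ] H} (h : ∃ X, IsXi T X) : IsXi T (Xi T) := by
  rw [Xi, dif_pos h]
  exact h.choose_spec

end Expansion

theorem mainTheorem11 {H : Type u} [NormedAddCommGroup H] [InnerProductSpace ℂ H]
    [CompleteSpace H] [TopologicalSpace.SeparableSpace H]
    (S A B : H →L[ℂ] H)
    (hS : IsSelfAdjoint S) (hS2 : S * S = 1)
    (hA : IsSelfAdjoint A) (hA2 : IsHilbertSchmidt A)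
    (hB : B.IsPositive) (hB1 : IsTraceClass B) :
    IsTraceClass (Xi (S + A + Complex.I • B) - Xi S) ↔ IsTraceClass (A * S - S * A) := by
  have hX : IsXi (S + A + Complex.I • B) (Xi (S + A + Complex.I • B)) :=
    isXi_xi (Colligation.exists_isXi (hS.add hA) hB)
  have hX' : IsXi S (Xi S) := isXi_xi (by
    have := Colligation.exists_isXi hS (ContinuousLinearMap.isPositive_zero (E := H) (𝕜 := ℂ))
    rwa [smul_zero, add_zero] at this)
  have hmain := isNuclear_xi_sub hS hS2 hA hA2 hB hB1 hX hX'
  set D := Xi (S + A + Complex.I • B) - Xi S with hD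
  have hpi : (Real.pi : ℂ) ≠ 0 := Complex.ofReal_ne_zero.2 Real.pi_ne_zero
  rw [isTraceClass_iff_isNuclear, isTraceClass_iff_isNuclear]
  constructor
  · intro h
    have h1 := (hmain.add (h.smul (Real.pi : ℂ))).smul ((Real.pi / 4 : ℝ) : ℂ)⁻¹
    rw [sub_add_cancel, smul_smul, inv_mul_cancel₀
      (Complex.ofReal_ne_zero.2 (by positivity)), one_smul] at h1
    have h2 := h1.mul_left S
    rwa [mul_sub, ← mul_assoc, ← mul_assoc, hS2, one_mul] at h2
  · intro h
    have h1 := h.mul_left S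
    have h2 : S * (A * S - S * A) = S * A * S - A := by
      rw [mul_sub, ← mul_assoc, ← mul_assoc, hS2, one_mul]
    rw [h2] at h1
    have h3 := ((h1.smul ((Real.pi / 4 : ℝ) : ℂ)).sub hmain).smul (Real.pi : ℂ)⁻¹
    rwa [sub_sub_cancel, smul_smul, inv_mul_cancel₀ hpi, one_smul] at h3
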